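/- Let $\mathbb K$ be a field, $l\ge 1$, and let $\mathfrak A$ be a free abelian group of rank $2l+2$ with basis $\alpha_1,\dots,\alpha_{2l+2}$. Put $I=\{1,\dots,l\}$, $\mathfrak A_\pi=\bigoplus_{i\in I}\mathbb Z\alpha_i$ and $\mathfrak A_\pi^+=\bigoplus_{i\in I}\mathbb Z_{\ge 0}\alpha_i$. Let $\chi:\mathfrak A\times\mathfrak A\to\mathbb K^\times$ be a bicharacter (multiplicative in each variable), $\omega:\mathfrak A_\pi\to\mathbb K^\times$ a homomorphism, and $\breve q\in\mathbb K^\times$ an element that is not a root of unity, such that $$\chi(\alpha_i,\alpha_{j+l+1})=\chi(\alpha_{j+l+1},\alpha_i)=\breve q^{\,\delta_{ij}},\qquad \chi(\alpha_{i+l+1},\alpha_{j+l+1})=1\qquad(1\le i,j\le l+1),$$ $$\omega(\alpha_i)=\chi(\alpha_i,\alpha_{l+1}),\qquad \chi(\alpha_{l+1},\alpha_i)=1\qquad(i\in I).$$ **The algebra.** Let $\tilde B^+$ be the bialgebra with generators $K_\lambda,E_i$ and $\tilde B^-$ the one with generators $L_\lambda,F_i$ ($\lambda\in\mathfrak A$,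 $i\in I$), subject to those relations displayed below that involve only these generators, with coproduct $\Delta K_\lambda=K_\lambda\otimes K_\lambda$, $\Delta E_i=E_i\otimes 1+K_{\alpha_i}\otimes E_i$, $\Delta L_\lambda=L_\lambda\otimes L_\lambda$, $\Delta F_i=F_i\otimes L_{\alpha_i}+1\otimes F_i$ and counit $K_\lambda,L_\lambda\mapsto1$, $E_i,F_i\mapsto0$, and let $\vartheta:\tilde B^+\times\tilde B^-\to\mathbb K$ be the Drinfeld pairing: $\vartheta(K_\lambda,L_\mu)=\chi(\lambda,\mu)$, $\vartheta(E_i,F_j)=\delta_{ij}$, $\vartheta(K_\lambda,F_j)=\vartheta(E_i,L_\lambda)=0$, $\vartheta(XX',Y)=\sum\vartheta(X,Y^{(2)})\vartheta(X',Y^{(1)})$, $\vartheta(X,YY')=\sum\vartheta(X^{(1)},Y)\vartheta(X^{(2)},Y')$, $\vartheta(1,Y)=\varepsilon(Y)$, $\vartheta(X,1)=\varepsilon(X)$. Let $U=U(\chi,\pi)$ be the generalized quantum group: the $\mathbb K$-algebra generated by $K_\lambda,L_\lambda,E_i,F_i$ with $$K_0=L_0=1,\quad K_\lambda K_\mu=K_{\lambda+\mu},\quad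 L_\lambda L_\mu=L_{\lambda+\mu},\quad K_\lambda L_\mu=L_\mu K_\lambda,$$ $$K_\lambda E_i=\chi(\lambda,\alpha_i)E_iK_\lambda,\quad L_\lambda E_i=\chi(-\alpha_i,\lambda)E_iL_\lambda,\quad K_\lambda F_i=\chi(\lambda,-\alpha_i)F_iK_\lambda,\quad L_\lambda F_i=\chi(\alpha_i,\lambda)F_iL_\lambda,$$ $$[E_i,F_j]=\delta_{ij}(-K_{\alpha_i}+L_{\alpha_i}),$$ together with the vanishing of all noncommutative polynomials in the $E_i$ (resp. in the $F_i$) that lie in the left (resp. right) kernel of the pairing $\vartheta$ between polynomials in the $E_i$ and polynomials in the $F_i$. Let $U=\bigoplus_{\nu\in\mathfrak A_\pi}U_\nu$ be the grading with $K_\lambda,L_\lambda\in U_0$, $E_i\in U_{\alpha_i}$, $F_i\in U_{-\alpha_i}$; let $U^{+}$, $U^-$ be the subalgebras generated by the $E_i$, resp. the $F_i$, $U^{+,\flat}$, $U^{-,\flat}$ those generated by the $K_\lambda,E_i$, resp. the $L_\lambda,F_i$ (the pairing $\vartheta$ induces a pairing $U^{+,\flat}\times U^{-,\flat}\to\mathbb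 K$, again denoted $\vartheta$), let $U^-_{-\nu}=U^-\cap U_{-\nu}$, and let $\varepsilon$ be the counit ($K_\lambda,L_\lambda\mapsto 1$, $E_i,F_i\mapsto 0$). Let $Z=\{z\in U_0: zx=xz\ \text{for all } x\in U_\nu,\ \nu\in\mathfrak A_\pi\}$, which is the center of $U$. Let $\mathrm{Sh}:U\to U$ be the linear map with $\mathrm{Sh}(YK_\lambda L_\mu X)=\varepsilon(Y)\varepsilon(X)K_\lambda L_\mu$ for $Y\in U^-$, $X\in U^+$ (the Harish-Chandra projection). Let $\Omega:U\to U^*$ be the linear map with $$\Omega(b_2a_2)(a_1b_1)=\vartheta(a_1,b_2)\,\vartheta(a_2,b_1)\qquad(a_1,a_2\in U^{+,\flat},\ b_1,b_2\in U^{-,\flat}).$$ **The module.** Let $\lambda,\mu\in\mathfrak A$, and let $\breve V$ be a finite-dimensional $U$-module generated by a non-zero vector $\breve v$ with $E_i\breve v=0$ ($i\in I$) and $K_{\lambda'}L_{\mu'}\breve v=\chi(\lambda,\mu')\chi(\lambda',\mu)\breve v$ ($\lambda',\mu'\in\mathfrak A$). Put $\breve m_\nu=\dim U^-_{-\nu}\breve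 v$ for $\nu\in\mathfrak A_\pi^+$, let $\hat\rho:\mathfrak A_\pi\to\mathbb K^\times$ be the homomorphism with $\hat\rho(\alpha_i)=\chi(\alpha_i,\alpha_i)$, let $\breve\rho\in\mathrm{End}_{\mathbb K}(\breve V)$ be the map with $\breve\rho(Y\breve v)=\hat\rho(\nu)Y\breve v$ for $Y\in U^-_{-\nu}$, and let $\breve f\in U^*$ be $\breve f(X)=\mathrm{Tr}_{\breve V}(X\circ\breve\rho)$. **Proposition.** The maps $\Omega$, $\mathrm{Sh}$ and $\breve\rho$ exist and are uniquely determined by these properties, $\Omega$ is injective, only finitely many $\breve m_\nu$ are non-zero, and $$\breve f\in\Omega(Z),\qquad \mathrm{Sh}\bigl(\Omega^{-1}(\breve f)\bigr)=\sum_{\nu\in\mathfrak A_\pi^+}\hat\rho(\nu)\,\breve m_\nu\,K_{\lambda+\nu}L_{\mu-\nu}.$$ -/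

import Mathlib

open scoped TensorProduct

noncomputable section

namespace GQG

/-- A bicharacter `χ : A × A → 𝕜ˣ` on an abelian group `A`. -/
structure Bicharacter (𝕜 A : Type*) [Field 𝕜] [AddCommGroup A] where
  toFun : A → A → 𝕜ˣ
  map_add_left : ∀ a b c : A, toFun (a + b) c = toFun a c * toFun b c
  map_add_right : ∀ a b c : A, toFun a (b + c) = toFun a b * toFun a c

instance {𝕜 A : Type*} [Field 𝕜] [AddCommGroup A] :
    CoeFun (Bicharacter 𝕜 A) (fun _ => A → A → 𝕜ˣ) := ⟨Bicharacter.toFun⟩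

section

variable {𝕜 A : Type*} [Field 𝕜] [AddCommGroup A]

theorem Bicharacter.map_zero_left (χ : Bicharacter 𝕜 A) (a : A) : χ 0 a = 1 := by
  have h := χ.map_add_left 0 0 a
  rw [add_zero] at h
  exact (mul_eq_left.mp h.symm)

theorem Bicharacter.map_zero_right (χ : Bicharacter 𝕜 A) (a : A) : χ a 0 = 1 := by
  have h := χ.map_add_right a 0 0
  rw [add_zero] at h
  exact (mul_eq_left.mp h.symm)

variable {l : ℕ}

/-! ### The two Borel bialgebras before the Serre-type relations are imposed -/

/-- Generators of the positive Borel algebra. -/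
inductive PosGen (A : Type*) (l : ℕ)
  | K (a : A) : PosGen A l
  | E (i : Fin l) : PosGen A l

/-- Generators of the negative Borel algebra. -/
inductive NegGen (A : Type*) (l : ℕ)
  | L (a : A) : NegGen A l
  | F (i : Fin l) : NegGen A l

open FreeAlgebra in
/-- `K_0 = 1`, `K_a K_b = K_{a+b}`, `K_a E_i = χ(a, α_i) E_i K_a`, where `α_i = π i`. -/
inductive PosRel (χ : Bicharacter 𝕜 A) (π : Fin l → A) :
    FreeAlgebra 𝕜 (PosGen A l) → FreeAlgebra 𝕜 (PosGen A l) → Prop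
  | K_zero : PosRel χ π (ι 𝕜 (.K 0)) 1
  | K_add (a b : A) : PosRel χ π (ι 𝕜 (.K a) * ι 𝕜 (.K b)) (ι 𝕜 (.K (a + b)))
  | K_E (a : A) (i : Fin l) : PosRel χ π (ι 𝕜 (.K a) * ι 𝕜 (.E i))
      ((χ a (π i) : 𝕜) • (ι 𝕜 (.E i) * ι 𝕜 (.K a)))

open FreeAlgebra in
/-- `L_0 = 1`, `L_a L_b = L_{a+b}`, `L_a F_i = χ(α_i, a) F_i L_a`, where `α_i = π i`. -/
inductive NegRel (χ : Bicharacter 𝕜 A) (π : Fin l → A) :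
    FreeAlgebra 𝕜 (NegGen A l) → FreeAlgebra 𝕜 (NegGen A l) → Prop
  | L_zero : NegRel χ π (ι 𝕜 (.L 0)) 1
  | L_add (a b : A) : NegRel χ π (ι 𝕜 (.L a) * ι 𝕜 (.L b)) (ι 𝕜 (.L (a + b)))
  | L_F (a : A) (i : Fin l) : NegRel χ π (ι 𝕜 (.L a) * ι 𝕜 (.F i))
      ((χ (π i) a : 𝕜) • (ι 𝕜 (.F i) * ι 𝕜 (.L a)))

/-- The algebra generated by the `K_a` and `E_i` subject to `PosRel`. -/
def PosBorel (χ : Bicharacter 𝕜 A) (π : Fin l → A) : Type _ := RingQuot (PosRel χ π)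

/-- The algebra generated by the `L_a` and `F_i` subject to `NegRel`. -/
def NegBorel (χ : Bicharacter 𝕜 A) (π : Fin l → A) : Type _ := RingQuot (NegRel χ π)

variable (χ : Bicharacter 𝕜 A) (π : Fin l → A)

instance : Ring (PosBorel χ π) := inferInstanceAs (Ring (RingQuot (PosRel χ π)))
instance : Algebra 𝕜 (PosBorel χ π) := inferInstanceAs (Algebra 𝕜 (RingQuot (PosRel χ π)))
instance : Ring (NegBorel χ π) := inferInstanceAs (Ring (RingQuot (NegRel χ π)))
instance : Algebra 𝕜 (NegBorel χ π) := inferInstanceAs (Algebra 𝕜 (RingQuot (NegRel χ π)))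

/-- The generators as elements of the positive Borel algebra. -/
def PosBorel.of (x : PosGen A l) : PosBorel χ π :=
  RingQuot.mkAlgHom 𝕜 (PosRel χ π) (FreeAlgebra.ι 𝕜 x)

/-- The generators as elements of the negative Borel algebra. -/
def NegBorel.of (x : NegGen A l) : NegBorel χ π :=
  RingQuot.mkAlgHom 𝕜 (NegRel χ π) (FreeAlgebra.ι 𝕜 x)

section lifts

variable {χ π} {B : Type*} [Ring B] [Algebra 𝕜 B]

/-- The universal property of the positive Borel algebra. -/
def PosBorel.lift (k : A → B) (e : Fin l → B) (h0 : k 0 = 1)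
    (hadd : ∀ a b, k a * k b = k (a + b))
    (hke : ∀ a i, k a * e i = (χ a (π i) : 𝕜) • (e i * k a)) : PosBorel χ π →ₐ[𝕜] B :=
  RingQuot.liftAlgHom 𝕜 ⟨FreeAlgebra.lift 𝕜 (fun g => match g with | .K a => k a | .E i => e i), by
    intro x y h
    cases h <;> simp [h0, hadd, hke]⟩

/-- The universal property of the negative Borel algebra. -/
def NegBorel.lift (k : A → B) (f : Fin l → B) (h0 : k 0 = 1)
    (hadd : ∀ a b, k a * k b = k (a + b))
    (hkf : ∀ a i, k a * f i = (χ (π i) a : 𝕜) • (f i * k a)) : NegBorel χ π →ₐ[𝕜] B :=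
  RingQuot.liftAlgHom 𝕜 ⟨FreeAlgebra.lift 𝕜 (fun g => match g with | .L a => k a | .F i => f i), by
    intro x y h
    cases h <;> simp [h0, hadd, hkf]⟩

@[simp] theorem PosBorel.lift_K (k : A → B) (e : Fin l → B) (h0 hadd hke) (a : A) :
    PosBorel.lift (χ := χ) (π := π) k e h0 hadd hke (PosBorel.of χ π (.K a)) = k a := by
  simp only [PosBorel.lift, PosBorel.of]
  exact (RingQuot.liftAlgHom_mkAlgHom_apply ..).trans (by simp)

@[simp] theorem PosBorel.lift_E (k : A → B) (e : Fin l → B) (h0 hadd hke) (i : Fin l) :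
    PosBorel.lift (χ := χ) (π := π) k e h0 hadd hke (PosBorel.of χ π (.E i)) = e i := by
  simp only [PosBorel.lift, PosBorel.of]
  exact (RingQuot.liftAlgHom_mkAlgHom_apply ..).trans (by simp)

@[simp] theorem NegBorel.lift_L (k : A → B) (f : Fin l → B) (h0 hadd hkf) (a : A) :
    NegBorel.lift (χ := χ) (π := π) k f h0 hadd hkf (NegBorel.of χ π (.L a)) = k a := by
  simp only [NegBorel.lift, NegBorel.of]
  exact (RingQuot.liftAlgHom_mkAlgHom_apply ..).trans (by simp)

@[simp] theorem NegBorel.lift_F (k : A → B) (f : Fin l → B) (h0 hadd hkf) (i : Fin l) :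
    NegBorel.lift (χ := χ) (π := π) k f h0 hadd hkf (NegBorel.of χ π (.F i)) = f i := by
  simp only [NegBorel.lift, NegBorel.of]
  exact (RingQuot.liftAlgHom_mkAlgHom_apply ..).trans (by simp)

theorem NegBorel.hom_ext {φ ψ : NegBorel χ π →ₐ[𝕜] B}
    (h : ∀ g, φ (NegBorel.of χ π g) = ψ (NegBorel.of χ π g)) : φ = ψ := by
  refine RingQuot.ringQuot_ext' (S := 𝕜) (s := NegRel χ π) φ ψ (FreeAlgebra.hom_ext ?_)
  funext g
  exact h g

theorem NegBorel.induction {P : NegBorel χ π → Prop} (hof : ∀ g, P (NegBorel.of χ π g))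
    (hc : ∀ r : 𝕜, P (algebraMap 𝕜 _ r)) (hmul : ∀ x y, P x → P y → P (x * y))
    (hadd : ∀ x y, P x → P y → P (x + y)) (x : NegBorel χ π) : P x := by
  obtain ⟨y, rfl⟩ := RingQuot.mkAlgHom_surjective 𝕜 (NegRel χ π) x
  induction y using FreeAlgebra.induction with
  | grade0 r => rw [AlgHom.commutes]; exact hc r
  | grade1 g => exact hof g
  | mul a b ha hb => rw [map_mul]; exact hmul _ _ ha hb
  | add a b ha hb => rw [map_add]; exact hadd _ _ ha hb

end lifts

theorem NegBorel.L_zero : NegBorel.of χ π (.L 0) = 1 :=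
  (RingQuot.mkAlgHom_rel 𝕜 (NegRel.L_zero (χ := χ) (π := π))).trans (map_one _)

theorem NegBorel.L_add (a b : A) :
    NegBorel.of χ π (.L a) * NegBorel.of χ π (.L b) = NegBorel.of χ π (.L (a + b)) :=
  (map_mul (RingQuot.mkAlgHom 𝕜 (NegRel χ π)) _ _).symm.trans
    (RingQuot.mkAlgHom_rel 𝕜 (NegRel.L_add (χ := χ) (π := π) a b))

theorem NegBorel.L_F (a : A) (i : Fin l) :
    NegBorel.of χ π (.L a) * NegBorel.of χ π (.F i) =
      (χ (π i) a : 𝕜) • (NegBorel.of χ π (.F i) * NegBorel.of χ π (.L a)) := by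
  have h := RingQuot.mkAlgHom_rel 𝕜 (NegRel.L_F (χ := χ) (π := π) a i)
  rw [map_mul, map_smul, map_mul] at h
  exact h

/-- `Δ(L_a) = L_a ⊗ L_a`, `Δ(F_i) = F_i ⊗ L_{α_i} + 1 ⊗ F_i`. -/
def NegBorel.comul : NegBorel χ π →ₐ[𝕜] NegBorel χ π ⊗[𝕜] NegBorel χ π :=
  NegBorel.lift
    (fun a => NegBorel.of χ π (.L a) ⊗ₜ NegBorel.of χ π (.L a))
    (fun i => NegBorel.of χ π (.F i) ⊗ₜ NegBorel.of χ π (.L (π i)) +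
      1 ⊗ₜ NegBorel.of χ π (.F i))
    (by rw [NegBorel.L_zero]; rfl)
    (fun a b => by simp [NegBorel.L_add])
    (fun a i => by
      simp only [mul_add, add_mul, Algebra.TensorProduct.tmul_mul_tmul, NegBorel.L_add,
        NegBorel.L_F, mul_one, one_mul, smul_add, TensorProduct.smul_tmul',
        TensorProduct.tmul_smul, add_comm (π i) a])

/-- `ε(L_a) = 1`, `ε(F_i) = 0`. -/
def NegBorel.counit : NegBorel χ π →ₐ[𝕜] 𝕜 :=
  NegBorel.lift (fun _ => 1) (fun _ => 0) rfl (fun _ _ => by simp) (fun _ _ => by simp)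

instance : Bialgebra 𝕜 (NegBorel χ π) :=
  Bialgebra.ofAlgHom (NegBorel.comul χ π) (NegBorel.counit χ π)
    (NegBorel.hom_ext fun g => by
      cases g with
      | L a => simp [NegBorel.comul]
      | F i => simp [NegBorel.comul, TensorProduct.add_tmul, TensorProduct.tmul_add, add_assoc,
          Algebra.TensorProduct.one_def])
    (NegBorel.hom_ext fun g => by
      cases g <;> simp [NegBorel.comul, NegBorel.counit])
    (NegBorel.hom_ext fun g => by
      cases g <;> simp [NegBorel.comul, NegBorel.counit])


/-! ### The pairing of the two Borel bialgebras -/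

/-- The functional `ϑ(K_a, ·)`: the algebra homomorphism with `L_b ↦ χ(a, b)`, `F_j ↦ 0`. -/
def thetaK (a : A) : NegBorel χ π →ₐ[𝕜] 𝕜 :=
  NegBorel.lift (fun b => (χ a b : 𝕜)) (fun _ => 0) (by simp [χ.map_zero_right])
    (fun b c => by simp [χ.map_add_right]) (fun _ _ => by simp)

/-- The matrix representation `Y ↦ !![ϑ(K_{α_i}, Y), ϑ(E_i, Y); 0, ε(Y)]`. Its multiplicativity
says `ϑ(E_i, Y Y') = ϑ(E_i, Y) ε(Y') + ϑ(K_{α_i}, Y) ϑ(E_i, Y')`, in accordance with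
`Δ(E_i) = E_i ⊗ 1 + K_{α_i} ⊗ E_i`. -/
def thetaMatrix (i : Fin l) : NegBorel χ π →ₐ[𝕜] Matrix (Fin 2) (Fin 2) 𝕜 :=
  NegBorel.lift (fun b => !![(χ (π i) b : 𝕜), 0; 0, 1])
    (fun j => if i = j then !![0, 1; 0, 0] else 0)
    (by simp [χ.map_zero_right, Matrix.one_fin_two])
    (fun b c => by simp [χ.map_add_right])
    (fun b j => by
      by_cases h : i = j
      · subst h; simp
      · simp [h])

/-- The functional `ϑ(E_i, ·)`. -/
def thetaE (i : Fin l) : NegBorel χ π →ₗ[𝕜] 𝕜 :=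
  Matrix.entryLinearMap 𝕜 𝕜 (0 : Fin 2) (1 : Fin 2) ∘ₗ (thetaMatrix χ π i).toLinearMap

theorem thetaK_zero : thetaK χ π 0 = NegBorel.counit χ π :=
  NegBorel.hom_ext fun g => by cases g <;> simp [thetaK, NegBorel.counit, χ.map_zero_left]

theorem thetaK_add (a b : A) :
    (Algebra.TensorProduct.lift (thetaK χ π b) (thetaK χ π a)
      (fun _ _ => Commute.all _ _)).comp (NegBorel.comul χ π) = thetaK χ π (a + b) :=
  NegBorel.hom_ext fun g => by
    cases g <;> simp [thetaK, NegBorel.comul, χ.map_add_left, mul_comm]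

theorem thetaK_commute (a : A) (i : Fin l) (x y : NegBorel χ π) :
    Commute (((Algebra.ofId 𝕜 (Matrix (Fin 2) (Fin 2) 𝕜)).comp (thetaK χ π a)) x)
      (thetaMatrix χ π i y) :=
  Algebra.commutes (thetaK χ π a x) (thetaMatrix χ π i y)

theorem thetaMatrix_conj (a : A) (i : Fin l) (Y : NegBorel χ π) :
    (Algebra.TensorProduct.lift (thetaMatrix χ π i)
        ((Algebra.ofId 𝕜 (Matrix (Fin 2) (Fin 2) 𝕜)).comp (thetaK χ π a))
        (fun x y => (thetaK_commute χ π a i y x).symm)) (NegBorel.comul χ π Y) *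
      !![(χ a (π i) : 𝕜), 0; 0, 1] =
    !![(χ a (π i) : 𝕜), 0; 0, 1] *
      (Algebra.TensorProduct.lift
        ((Algebra.ofId 𝕜 (Matrix (Fin 2) (Fin 2) 𝕜)).comp (thetaK χ π a)) (thetaMatrix χ π i)
        (thetaK_commute χ π a i)) (NegBorel.comul χ π Y) := by
  induction Y using NegBorel.induction with
  | hof g =>
    cases g with
    | L b => simp [thetaMatrix, thetaK, NegBorel.comul, Algebra.ofId_apply,
        Algebra.algebraMap_eq_smul_one, mul_comm, mul_left_comm]
    | F j =>
      by_cases h : i = j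
      · subst h
        simp [thetaMatrix, thetaK, NegBorel.comul, Algebra.ofId_apply,
          Algebra.algebraMap_eq_smul_one]
        ext k; fin_cases k <;> rfl
      · simp [thetaMatrix, thetaK, NegBorel.comul, h]
  | hc r => simp only [AlgHom.commutes]; exact Algebra.commutes _ _
  | hmul x y hx hy =>
    rw [map_mul, map_mul, map_mul, mul_assoc, hy, ← mul_assoc, hx, mul_assoc]
  | hadd x y hx hy => rw [map_add, map_add, map_add, add_mul, mul_add, hx, hy]

theorem thetaMatrix_lift_left (a : A) (i : Fin l) (t : NegBorel χ π ⊗[𝕜] NegBorel χ π) :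
    LinearMap.mul' 𝕜 𝕜 (TensorProduct.map (thetaE χ π i) (thetaK χ π a).toLinearMap t) =
      Algebra.TensorProduct.lift (thetaMatrix χ π i)
        ((Algebra.ofId 𝕜 (Matrix (Fin 2) (Fin 2) 𝕜)).comp (thetaK χ π a))
        (fun x y => (thetaK_commute χ π a i y x).symm) t 0 1 := by
  induction t with
  | zero => simp
  | tmul x y =>
    rw [Algebra.TensorProduct.lift_tmul]
    simp [thetaE, Algebra.ofId_apply, Algebra.algebraMap_eq_smul_one, mul_comm]
  | add x y hx hy => simp only [map_add, hx, hy, Matrix.add_apply]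

theorem thetaMatrix_lift_right (a : A) (i : Fin l) (t : NegBorel χ π ⊗[𝕜] NegBorel χ π) :
    LinearMap.mul' 𝕜 𝕜 (TensorProduct.map (thetaK χ π a).toLinearMap (thetaE χ π i) t) =
      Algebra.TensorProduct.lift
        ((Algebra.ofId 𝕜 (Matrix (Fin 2) (Fin 2) 𝕜)).comp (thetaK χ π a)) (thetaMatrix χ π i)
        (thetaK_commute χ π a i) t 0 1 := by
  induction t with
  | zero => simp
  | tmul x y =>
    rw [Algebra.TensorProduct.lift_tmul]
    simp [thetaE, Algebra.ofId_apply, Algebra.algebraMap_eq_smul_one]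
  | add x y hx hy => simp only [map_add, hx, hy, Matrix.add_apply]

open WithConv in
/-- The Drinfeld pairing `ϑ(X⁺, X⁻)` of the positive and the negative Borel algebra, as a linear
functional of `X⁻` for each `X⁺`. It is given on the generators `X⁺ = K_a, E_i` by `thetaK`,
`thetaE`, and extended to all `X⁺` by the rule
`ϑ(X⁺ Y⁺, X⁻) = ∑ ϑ(X⁺, (X⁻)⁽²⁾) ϑ(Y⁺, (X⁻)⁽¹⁾)`, that is, as an algebra homomorphism into the
opposite of the convolution algebra of the negative Borel bialgebra. -/
def thetaHom : PosBorel χ π →ₐ[𝕜] (WithConv (NegBorel χ π →ₗ[𝕜] 𝕜))ᵐᵒᵖ :=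
  PosBorel.lift
    (fun a => MulOpposite.op (toConv (thetaK χ π a).toLinearMap))
    (fun i => MulOpposite.op (toConv (thetaE χ π i)))
    (by
      rw [thetaK_zero]; rfl)
    (fun a b => by
      rw [← MulOpposite.op_mul, ← thetaK_add, LinearMap.convMul_def]
      congr 2
      ext Y
      change LinearMap.mul' 𝕜 𝕜 (TensorProduct.map (thetaK χ π b).toLinearMap
        (thetaK χ π a).toLinearMap (NegBorel.comul χ π Y)) = _
      simp only [AlgHom.toLinearMap_apply, AlgHom.comp_apply]
      generalize NegBorel.comul χ π Y = t
      induction t with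
      | zero => simp
      | tmul x y => simp
      | add x y hx hy => simp only [map_add, hx, hy])
    (fun a i => by
      rw [← MulOpposite.op_mul, ← MulOpposite.op_mul, ← MulOpposite.op_smul]
      congr 1
      ext Y
      have h := congrFun (congrFun (thetaMatrix_conj χ π a i Y) 0) 1
      rw [LinearMap.convMul_def, LinearMap.convMul_def]
      change LinearMap.mul' 𝕜 𝕜 (TensorProduct.map (thetaE χ π i) (thetaK χ π a).toLinearMap
          (NegBorel.comul χ π Y)) = (χ a (π i) : 𝕜) * LinearMap.mul' 𝕜 𝕜 (TensorProduct.map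
          (thetaK χ π a).toLinearMap (thetaE χ π i) (NegBorel.comul χ π Y))
      rw [thetaMatrix_lift_left, thetaMatrix_lift_right]
      simpa [Matrix.mul_apply, Fin.sum_univ_two] using h)

/-- The Drinfeld pairing `ϑ`. -/
def theta (X : PosBorel χ π) (Y : NegBorel χ π) : 𝕜 := (thetaHom χ π X).unop.ofConv Y

/-! ### The generalized quantum group -/

/-- The free algebra on the `E_i`, mapped to the positive Borel algebra. -/
def posWord : FreeAlgebra 𝕜 (Fin l) →ₐ[𝕜] PosBorel χ π :=
  FreeAlgebra.lift 𝕜 fun i => PosBorel.of χ π (.E i)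

/-- The free algebra on the `F_i`, mapped to the negative Borel algebra. -/
def negWord : FreeAlgebra 𝕜 (Fin l) →ₐ[𝕜] NegBorel χ π :=
  FreeAlgebra.lift 𝕜 fun i => NegBorel.of χ π (.F i)

/-- The noncommutative polynomials in the `E_i` in the left kernel of the pairing `ϑ` with the
noncommutative polynomials in the `F_i`. -/
def radPos : Set (FreeAlgebra 𝕜 (Fin l)) :=
  {x | ∀ y, theta χ π (posWord χ π x) (negWord χ π y) = 0}

/-- The noncommutative polynomials in the `F_i` in the right kernel of the pairing `ϑ` with the
noncommutative polynomials in the `E_i`. -/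
def radNeg : Set (FreeAlgebra 𝕜 (Fin l)) :=
  {y | ∀ x, theta χ π (posWord χ π x) (negWord χ π y) = 0}

/-- The augmentation of a free algebra, sending the generators to `0`. -/
def augmentation (𝕜 : Type*) [Field 𝕜] (l : ℕ) : FreeAlgebra 𝕜 (Fin l) →ₐ[𝕜] 𝕜 :=
  FreeAlgebra.lift 𝕜 fun _ => 0

theorem augmentation_eq_zero_of_mem_radNeg {y : FreeAlgebra 𝕜 (Fin l)} (hy : y ∈ radNeg χ π) :
    augmentation 𝕜 l y = 0 := by
  have h : theta χ π 1 (negWord χ π y) = 0 := by simpa using hy 1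
  have h1 : theta χ π 1 (negWord χ π y) = NegBorel.counit χ π (negWord χ π y) := by
    simp only [theta, map_one, MulOpposite.unop_one]
    rfl
  have h2 : (NegBorel.counit χ π).comp (negWord χ π) = augmentation 𝕜 l :=
    FreeAlgebra.hom_ext (funext fun i => by simp [negWord, augmentation, NegBorel.counit])
  rw [← h2, AlgHom.comp_apply, ← h1, h]

theorem theta_mul_one (X X' : PosBorel χ π) :
    theta χ π (X * X') 1 = theta χ π X 1 * theta χ π X' 1 := by
  simp only [theta, map_mul, MulOpposite.unop_mul, LinearMap.convMul_def]
  change LinearMap.mul' 𝕜 𝕜 (TensorProduct.map _ _ (NegBorel.comul χ π 1)) = _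
  rw [map_one, Algebra.TensorProduct.one_def, TensorProduct.map_tmul, LinearMap.mul'_apply,
    mul_comm]

theorem augmentation_eq_zero_of_mem_radPos {x : FreeAlgebra 𝕜 (Fin l)} (hx : x ∈ radPos χ π) :
    augmentation 𝕜 l x = 0 := by
  have h : theta χ π (posWord χ π x) 1 = 0 := by simpa using hx 1
  rw [← h]
  clear h hx
  induction x using FreeAlgebra.induction with
  | grade0 r =>
    rw [AlgHom.commutes, AlgHom.commutes, theta, AlgHom.commutes]
    simp [Algebra.algebraMap_eq_smul_one]
  | grade1 i => simp [augmentation, posWord, theta, thetaHom, thetaE]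
  | mul a b ha hb => rw [map_mul, map_mul, theta_mul_one, ha, hb]
  | add a b ha hb => rw [map_add, map_add, ha, hb]; simp [theta]

/-- Generators of the generalized quantum group. -/
inductive Gen (A : Type*) (l : ℕ)
  | K (a : A) : Gen A l
  | L (a : A) : Gen A l
  | E (i : Fin l) : Gen A l
  | F (i : Fin l) : Gen A l

open FreeAlgebra in
/-- The defining relations of the generalized quantum group: the commutation relations of the
generators, and the vanishing of the kernels of the pairing `ϑ` on the nilpotent parts. -/
inductive Rel (χ : Bicharacter 𝕜 A) (π : Fin l → A) :
    FreeAlgebra 𝕜 (Gen A l) → FreeAlgebra 𝕜 (Gen A l) → Prop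
  | K_zero : Rel χ π (ι 𝕜 (.K 0)) 1
  | L_zero : Rel χ π (ι 𝕜 (.L 0)) 1
  | K_add (a b : A) : Rel χ π (ι 𝕜 (.K a) * ι 𝕜 (.K b)) (ι 𝕜 (.K (a + b)))
  | L_add (a b : A) : Rel χ π (ι 𝕜 (.L a) * ι 𝕜 (.L b)) (ι 𝕜 (.L (a + b)))
  | K_L (a b : A) : Rel χ π (ι 𝕜 (.K a) * ι 𝕜 (.L b)) (ι 𝕜 (.L b) * ι 𝕜 (.K a))
  | K_E (a : A) (i : Fin l) : Rel χ π (ι 𝕜 (.K a) * ι 𝕜 (.E i))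
      ((χ a (π i) : 𝕜) • (ι 𝕜 (.E i) * ι 𝕜 (.K a)))
  | L_E (a : A) (i : Fin l) : Rel χ π (ι 𝕜 (.L a) * ι 𝕜 (.E i))
      ((χ (-π i) a : 𝕜) • (ι 𝕜 (.E i) * ι 𝕜 (.L a)))
  | K_F (a : A) (i : Fin l) : Rel χ π (ι 𝕜 (.K a) * ι 𝕜 (.F i))
      ((χ a (-π i) : 𝕜) • (ι 𝕜 (.F i) * ι 𝕜 (.K a)))
  | L_F (a : A) (i : Fin l) : Rel χ π (ι 𝕜 (.L a) * ι 𝕜 (.F i))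
      ((χ (π i) a : 𝕜) • (ι 𝕜 (.F i) * ι 𝕜 (.L a)))
  | E_F (i j : Fin l) :
      Rel χ π (ι 𝕜 (.E i) * ι 𝕜 (.F j) - ι 𝕜 (.F j) * ι 𝕜 (.E i))
        (if i = j then -ι 𝕜 (.K (π i)) + ι 𝕜 (.L (π i)) else 0)
  | radE (x : FreeAlgebra 𝕜 (Fin l)) (hx : x ∈ radPos χ π) :
      Rel χ π (FreeAlgebra.lift 𝕜 (fun i => ι 𝕜 (Gen.E i)) x) 0
  | radF (y : FreeAlgebra 𝕜 (Fin l)) (hy : y ∈ radNeg χ π) :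
      Rel χ π (FreeAlgebra.lift 𝕜 (fun i => ι 𝕜 (Gen.F i)) y) 0

/-- The generalized quantum group `U(χ, π)`. -/
def U (χ : Bicharacter 𝕜 A) (π : Fin l → A) : Type _ := RingQuot (Rel χ π)

instance : Ring (U χ π) := inferInstanceAs (Ring (RingQuot (Rel χ π)))
instance : Algebra 𝕜 (U χ π) := inferInstanceAs (Algebra 𝕜 (RingQuot (Rel χ π)))

namespace U

/-- The quotient map onto `U(χ, π)`. -/
def mk : FreeAlgebra 𝕜 (Gen A l) →ₐ[𝕜] U χ π := RingQuot.mkAlgHom 𝕜 (Rel χ π)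

/-- The generators as elements of `U(χ, π)`. -/
def of (x : Gen A l) : U χ π := mk χ π (FreeAlgebra.ι 𝕜 x)

/-- The element `K_a`. -/
abbrev K (a : A) : U χ π := of χ π (.K a)
/-- The element `L_a`. -/
abbrev L (a : A) : U χ π := of χ π (.L a)
/-- The element `E_i`. -/
abbrev E (i : Fin l) : U χ π := of χ π (.E i)
/-- The element `F_i`. -/
abbrev F (i : Fin l) : U χ π := of χ π (.F i)

variable {χ π} in
theorem rel {x y : FreeAlgebra 𝕜 (Gen A l)} (h : Rel χ π x y) :
    FreeAlgebra.lift 𝕜 (of χ π) x = FreeAlgebra.lift 𝕜 (of χ π) y := by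
  have e : mk χ π = FreeAlgebra.lift 𝕜 (of χ π) :=
    FreeAlgebra.hom_ext (funext fun g => (FreeAlgebra.lift_ι_apply _ g).symm)
  have h' : mk χ π x = mk χ π y := RingQuot.mkAlgHom_rel 𝕜 h
  rwa [e] at h'

/-- The canonical map from the positive Borel algebra, onto the subalgebra `U^{+,♭}` of `U`
generated by the `K_a` and `E_i`. -/
def ofPos : PosBorel χ π →ₐ[𝕜] U χ π :=
  PosBorel.lift (K χ π) (E χ π) (by simpa using rel (Rel.K_zero (χ := χ) (π := π)))
    (fun a b => by simpa using rel (Rel.K_add (χ := χ) (π := π) a b))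
    (fun a i => by simpa using rel (Rel.K_E (χ := χ) (π := π) a i))

/-- The canonical map from the negative Borel algebra, onto the subalgebra `U^{-,♭}` of `U`
generated by the `L_a` and `F_i`. -/
def ofNeg : NegBorel χ π →ₐ[𝕜] U χ π :=
  NegBorel.lift (L χ π) (F χ π) (by simpa using rel (Rel.L_zero (χ := χ) (π := π)))
    (fun a b => by simpa using rel (Rel.L_add (χ := χ) (π := π) a b))
    (fun a i => by simpa using rel (Rel.L_F (χ := χ) (π := π) a i))

/-- The counit of `U`: `K_a, L_a ↦ 1` and `E_i, F_i ↦ 0`. -/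
def counit : U χ π →ₐ[𝕜] 𝕜 :=
  RingQuot.liftAlgHom 𝕜 ⟨FreeAlgebra.lift 𝕜 (fun g => match g with
    | .K _ => 1 | .L _ => 1 | .E _ => 0 | .F _ => 0), by
    intro x y h
    cases h with
    | E_F i j => split_ifs <;> simp
    | radE x hx =>
      rw [map_zero, ← AlgHom.comp_apply]
      refine Eq.trans ?_ (augmentation_eq_zero_of_mem_radPos χ π hx)
      refine DFunLike.congr_fun (FreeAlgebra.hom_ext (funext fun i => ?_)) x
      simp [augmentation]
    | radF y hy =>
      rw [map_zero, ← AlgHom.comp_apply]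
      refine Eq.trans ?_ (augmentation_eq_zero_of_mem_radNeg χ π hy)
      refine DFunLike.congr_fun (FreeAlgebra.hom_ext (funext fun i => ?_)) y
      simp [augmentation]
    | _ => simp⟩

/-- The subalgebra `U^+` generated by the `E_i`. -/
def pos : Subalgebra 𝕜 (U χ π) := Algebra.adjoin 𝕜 (Set.range (E χ π))

/-- The subalgebra `U^-` generated by the `F_i`. -/
def neg : Subalgebra 𝕜 (U χ π) := Algebra.adjoin 𝕜 (Set.range (F χ π))

/-- The degrees of the generators. -/
def genDegree (π : Fin l → A) : Gen A l → A
  | .K _ => 0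
  | .L _ => 0
  | .E i => π i
  | .F i => -π i

/-- The homogeneous component `U_a`, spanned by the monomials of degree `a` in the generators. -/
def homog (a : A) : Submodule 𝕜 (U χ π) :=
  Submodule.span 𝕜 {X | ∃ w : List (Gen A l),
    (w.map (genDegree π)).sum = a ∧ X = (w.map (of χ π)).prod}

/-- The homogeneous component `U^-_a` of `U^-`. -/
def negHomog (a : A) : Submodule 𝕜 (U χ π) := Subalgebra.toSubmodule (neg χ π) ⊓ homog χ π a

/-- The lattice `A_π` spanned by the `α_i = π i`. -/
abbrev rootLattice (π : Fin l → A) : AddSubgroup A := AddSubgroup.closure (Set.range π)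

/-- The skew center `Z_ω`, for a homomorphism `ω : A_π → 𝕜ˣ`. -/
def skewCenter (ω : Multiplicative (rootLattice π) →* 𝕜ˣ) : Set (U χ π) :=
  {Z | Z ∈ homog χ π 0 ∧ ∀ a : rootLattice π, ∀ X ∈ homog χ π (a : A),
    Z * X = (ω (Multiplicative.ofAdd a) : 𝕜) • (X * Z)}

/-- `Sh` is the linear map with `Sh(Y K_a L_b X) = ε(Y) ε(X) K_a L_b` for `Y ∈ U^-`, `X ∈ U^+`. -/
def IsHarishChandra (Sh : U χ π →ₗ[𝕜] U χ π) : Prop :=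
  ∀ Y ∈ neg χ π, ∀ X ∈ pos χ π, ∀ a b : A,
    Sh (Y * (K χ π a * L χ π b) * X) =
      (counit χ π Y * counit χ π X) • (K χ π a * L χ π b)

/-- `Ω` is the linear map `U → U^*`, `(Ω(x))(y) = ⟨y, x⟩`, where `⟨ , ⟩` is the bilinear form
`⟨a₁ b₁, b₂ a₂⟩ = ϑ(a₁, b₂) ϑ(a₂, b₁)` for `a₁, a₂ ∈ U^{+,♭}` and `b₁, b₂ ∈ U^{-,♭}`. -/
def IsOmega (Ω : U χ π →ₗ[𝕜] Module.Dual 𝕜 (U χ π)) : Prop :=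
  ∀ (a₁ a₂ : PosBorel χ π) (b₁ b₂ : NegBorel χ π),
    Ω (ofNeg χ π b₂ * ofPos χ π a₂) (ofPos χ π a₁ * ofNeg χ π b₁) =
      theta χ π a₁ b₂ * theta χ π a₂ b₁

end U

/-! ### Modules -/

/-- The element `∑ n_i α_i` of `A_π^+`. -/
def posRoot (π : Fin l → A) (n : Fin l → ℕ) : A := ∑ i, n i • π i

/-- The value at `∑ n_i α_i` of the homomorphism `ρ̂ : A_π → 𝕜ˣ` with
`ρ̂(α_i) = χ(α_i, α_i)`. -/
def rhoHat (n : Fin l → ℕ) : 𝕜ˣ := ∏ i, χ (π i) (π i) ^ n i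

variable {χ π} {V : Type*} [AddCommGroup V] [Module 𝕜 V]

/-- `v` is a highest weight vector of weight `K_a L_b ↦ χ(lam, b) χ(a, mu)` that generates the
module. -/
structure IsHighestWeight (ρ : U χ π →ₐ[𝕜] Module.End 𝕜 V) (lam mu : A) (v : V) : Prop where
  ne_zero : v ≠ 0
  generates : Function.Surjective fun X => ρ X v
  weight : ∀ a b : A, ρ (U.K χ π a * U.L χ π b) v = (χ lam b * χ a mu : 𝕜) • v
  E_smul : ∀ i, ρ (U.E χ π i) v = 0

/-- The subspace `U^-_{-ν} v` of the module, where `ν = ∑ n_i α_i`. -/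
def weightPart (ρ : U χ π →ₐ[𝕜] Module.End 𝕜 V) (v : V) (n : Fin l → ℕ) : Submodule 𝕜 V :=
  (U.negHomog χ π (-posRoot π n)).map (LinearMap.applyₗ v ∘ₗ ρ.toLinearMap)

/-- `r` is the endomorphism `ρ̆` of the module with `ρ̆(Y v) = ρ̂(ν) Y v` for `Y ∈ U^-_{-ν}`. -/
def IsTwist (ρ : U χ π →ₐ[𝕜] Module.End 𝕜 V) (v : V) (r : Module.End 𝕜 V) : Prop :=
  ∀ n : Fin l → ℕ, ∀ Y ∈ U.negHomog χ π (-posRoot π n),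
    r (ρ Y v) = (rhoHat χ π n : 𝕜) • ρ Y v

/-- The functional `X ↦ Tr(X ∘ r)` on `U`. -/
def twistedTrace (ρ : U χ π →ₐ[𝕜] Module.End 𝕜 V) (r : Module.End 𝕜 V) :
    Module.Dual 𝕜 (U χ π) :=
  LinearMap.trace 𝕜 V ∘ₗ LinearMap.mulRight 𝕜 r ∘ₗ ρ.toLinearMap

end

/-! ### The extended setting -/

section

variable {𝕜 A : Type*} [Field 𝕜] [AddCommGroup A] {l : ℕ}

/-- The simple roots `α_1, …, α_l`, the first `l` of the `2l + 2` elements of a basis. The basis is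
indexed so that `inl` stands for `α_1, …, α_{l+1}` and `inr` for `α_{l+2}, …, α_{2l+2}`. -/
def simpleRoot (α : Module.Basis (Fin (l + 1) ⊕ Fin (l + 1)) ℤ A) (i : Fin l) : A :=
  α (.inl i.castSucc)

/-- The assumptions of the extended setting on the bicharacter `χ`, the basis `α` of `A`, the
element `q` and the homomorphism `ω : A_π → 𝕜ˣ`. -/
structure IsExtended (χ : Bicharacter 𝕜 A) (α : Module.Basis (Fin (l + 1) ⊕ Fin (l + 1)) ℤ A)
    (q : 𝕜ˣ) (ω : Multiplicative (U.rootLattice (simpleRoot α)) →* 𝕜ˣ) : Prop where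
  not_root_of_unity : ∀ n : ℕ, 0 < n → q ^ n ≠ 1
  inl_inr : ∀ i j, χ (α (.inl i)) (α (.inr j)) = if i = j then q else 1
  inr_inl : ∀ i j, χ (α (.inr j)) (α (.inl i)) = if i = j then q else 1
  inr_inr : ∀ i j, χ (α (.inr i)) (α (.inr j)) = 1
  omega_eq : ∀ i : Fin l,
    ω (Multiplicative.ofAdd ⟨simpleRoot α i, AddSubgroup.subset_closure ⟨i, rfl⟩⟩) =
      χ (simpleRoot α i) (α (.inl (Fin.last l)))
  last_simpleRoot : ∀ i : Fin l, χ (α (.inl (Fin.last l))) (simpleRoot α i) = 1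

end

end GQG

end

/-!
The form on polynomials in the `E_i` and `F_i` that the Drinfeld pairing induces is `wordForm p`,
with `p i j = χ(α_i, α_j)`: multiplication by a generator in one argument is adjoint to a skew
derivation in the other (`theta_word`). The same skew derivations describe the commutation of `E_i`
with polynomials in the `F_j`, and they preserve the kernels of the form. So there is a
representation of `U` on the tensor product of the two nondegenerate quotients and of the group
algebra of `A × A`; the orbit map of its unit vector is inverse to multiplication, which gives the
triangular decomposition `U = U^- U^0 U^+` (`U.coordFE_injective`). The relations are symmetric
under the exchange of `(F, L)` with `(E, K)` (`DoubleRel.swap`), so `U = U^+ U^0 U^-` comes from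
the same argument.

In these coordinates `Sh` is the tensor product of the two augmentations with the identity of `U^0`,
and `Ω` is a tensor product of three pairings: the nondegenerate form on words, twice, and a pairing
of group algebras. The last one is nondegenerate because different characters are linearly
independent; this is the only place where injectivity of `Ω` needs the extended lattice, on which
`χ` separates points (`U.omega_injective`).

Multiplications of `z` by generators correspond under `Ω` to operations on functionals. Comparing
them with the commutation relations shows that an element `z` of degree `0` is central as soon as
`Ω(z)` has the trace property `f(xy) = f(yx)` up to the twist by `ρ̂`
(`IsTraceLike.mem_skewCenter`).

The module is the direct sum of its weight spaces, these are the subspaces `U^-_{-ν} v`, and `ρ̆`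
acts on them by scalars, so `X ↦ Tr(X ∘ ρ̆)` has the trace property. It remains to write this
functional as `Ω(z)`. In a basis of weight vectors, each matrix coefficient of `U^+` or `U^-` is
supported in one degree and kills the kernel of the form, hence is represented by a homogeneous
polynomial (`exists_wordForm_eq`, a duality of finite-dimensional spaces). Expanding the trace of
`E(x) K_a F(y) L_b` in the basis gives `z` explicitly as a sum over pairs of basis vectors
(`exists_omega_eq_twistedTrace`). In `Sh(z)` only the diagonal pairs survive, and each basis vector
of weight `(λ + ν, μ - ν)` contributes `ρ̂(ν) K_{λ+ν} L_{μ-ν}`.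
-/

noncomputable section

namespace GQG

/-! ### Skew derivations and the bilinear form on a free algebra -/

section FreeWords

variable {𝕜 ι : Type*} [Field 𝕜]

/-- Induction on noncommutative polynomials, by multiplication with generators from the left. -/
theorem free_left_induction {P : FreeAlgebra 𝕜 ι → Prop} (one : P 1)
    (ι_mul : ∀ i x, P x → P (FreeAlgebra.ι 𝕜 i * x)) (add : ∀ x y, P x → P y → P (x + y))
    (smul : ∀ (r : 𝕜) x, P x → P (r • x)) (x : FreeAlgebra 𝕜 ι) : P x := by
  suffices h : ∀ y, P y → P (x * y) by simpa using h 1 one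
  induction x using FreeAlgebra.induction with
  | grade0 r => exact fun y hy => by rw [← Algebra.smul_def]; exact smul r y hy
  | grade1 i => exact fun y hy => ι_mul i y hy
  | mul a b ha hb => exact fun y hy => by rw [mul_assoc]; exact ha _ (hb _ hy)
  | add a b ha hb => exact fun y hy => by rw [add_mul]; exact add _ _ (ha _ hy) (hb _ hy)

/-- The scaling automorphism of a free algebra, multiplying the generator `i` by `c i`. -/
def scale (c : ι → 𝕜ˣ) : FreeAlgebra 𝕜 ι →ₐ[𝕜] FreeAlgebra 𝕜 ι :=
  FreeAlgebra.lift 𝕜 fun i => (c i : 𝕜) • FreeAlgebra.ι 𝕜 i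

@[simp] theorem scale_ι (c : ι → 𝕜ˣ) (i : ι) :
    scale c (FreeAlgebra.ι 𝕜 i) = (c i : 𝕜) • FreeAlgebra.ι 𝕜 i := by simp [scale]

@[simp] theorem scale_one (x : FreeAlgebra 𝕜 ι) : scale 1 x = x := by
  have h : scale (1 : ι → 𝕜ˣ) = AlgHom.id 𝕜 (FreeAlgebra 𝕜 ι) :=
    FreeAlgebra.hom_ext (funext fun i => by simp)
  rw [h, AlgHom.id_apply]

theorem scale_scale (c c' : ι → 𝕜ˣ) (x : FreeAlgebra 𝕜 ι) :
    scale c (scale c' x) = scale (c * c') x := by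
  have h : (scale c).comp (scale c') = scale (c * c') :=
    FreeAlgebra.hom_ext (funext fun i => by simp [smul_smul, mul_comm])
  rw [← h, AlgHom.comp_apply]

/-- The augmentation of a free algebra, sending the generators to `0`. -/
def wordCounit (𝕜 ι : Type*) [Field 𝕜] : FreeAlgebra 𝕜 ι →ₐ[𝕜] 𝕜 := FreeAlgebra.lift 𝕜 fun _ => 0

@[simp] theorem wordCounit_ι (i : ι) : wordCounit 𝕜 ι (FreeAlgebra.ι 𝕜 i) = 0 := by
  simp [wordCounit]

@[simp] theorem wordCounit_scale (c : ι → 𝕜ˣ) (x : FreeAlgebra 𝕜 ι) :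
    wordCounit 𝕜 ι (scale c x) = wordCounit 𝕜 ι x := by
  have h : (wordCounit 𝕜 ι).comp (scale c) = wordCounit 𝕜 ι :=
    FreeAlgebra.hom_ext (funext fun i => by simp)
  exact DFunLike.congr_fun h x

variable [DecidableEq ι]

/-- The matrix representation `x ↦ !![scale c x, d x; 0, scale c' x]` in which `d` is the skew
derivation `skewDer c c' i`. -/
def skewMatrix (c c' : ι → 𝕜ˣ) (i : ι) :
    FreeAlgebra 𝕜 ι →ₐ[𝕜] Matrix (Fin 2) (Fin 2) (FreeAlgebra 𝕜 ι) :=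
  FreeAlgebra.lift 𝕜 fun j => !![(c j : 𝕜) • FreeAlgebra.ι 𝕜 j, if i = j then 1 else 0;
    0, (c' j : 𝕜) • FreeAlgebra.ι 𝕜 j]

/-- The skew derivation `d` with `d (x y) = scale c x * d y + d x * scale c' y` that sends the
generator `i` to `1` and the others to `0`. -/
def skewDer (c c' : ι → 𝕜ˣ) (i : ι) : FreeAlgebra 𝕜 ι →ₗ[𝕜] FreeAlgebra 𝕜 ι :=
  Matrix.entryLinearMap 𝕜 _ (0 : Fin 2) (1 : Fin 2) ∘ₗ (skewMatrix c c' i).toLinearMap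

theorem skewMatrix_eq (c c' : ι → 𝕜ˣ) (i : ι) (x : FreeAlgebra 𝕜 ι) :
    skewMatrix c c' i x = !![scale c x, skewDer c c' i x; 0, scale c' x] := by
  suffices h : skewMatrix c c' i x 0 0 = scale c x ∧ skewMatrix c c' i x 1 0 = 0 ∧
      skewMatrix c c' i x 1 1 = scale c' x by
    ext a b
    fin_cases a <;> fin_cases b <;> simp [h, skewDer]
  induction x using FreeAlgebra.induction with
  | grade0 r => simp [Matrix.algebraMap_matrix_apply]
  | grade1 j => simp [skewMatrix]
  | mul a b ha hb => simp [Matrix.mul_apply, Fin.sum_univ_two, ha, hb]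
  | add a b ha hb => simp [ha, hb]

theorem skewDer_mul (c c' : ι → 𝕜ˣ) (i : ι) (x y : FreeAlgebra 𝕜 ι) :
    skewDer c c' i (x * y) = scale c x * skewDer c c' i y + skewDer c c' i x * scale c' y := by
  have h := congrFun (congrFun (map_mul (skewMatrix c c' i) x y) 0) 1
  rw [skewMatrix_eq, skewMatrix_eq, skewMatrix_eq] at h
  simpa [Matrix.mul_apply, Fin.sum_univ_two] using h

@[simp] theorem skewDer_one (c c' : ι → 𝕜ˣ) (i : ι) : skewDer c c' i 1 = 0 := by
  simp [skewDer]

theorem skewDer_ι (c c' : ι → 𝕜ˣ) (i j : ι) :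
    skewDer c c' i (FreeAlgebra.ι 𝕜 j) = if i = j then 1 else 0 := by
  simp [skewDer, skewMatrix]

theorem skewDer_ι_mul (c c' : ι → 𝕜ˣ) (i j : ι) (x : FreeAlgebra 𝕜 ι) :
    skewDer c c' i (FreeAlgebra.ι 𝕜 j * x) = (if i = j then scale c' x else 0) +
      (c j : 𝕜) • (FreeAlgebra.ι 𝕜 j * skewDer c c' i x) := by
  rw [skewDer_mul, skewDer_ι, scale_ι, smul_mul_assoc, add_comm]
  split_ifs <;> simp

theorem skewDer_scale (c c' s : ι → 𝕜ˣ) (i : ι) (x : FreeAlgebra 𝕜 ι) :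
    skewDer c c' i (scale s x) = (s i : 𝕜) • scale s (skewDer c c' i x) := by
  induction x using free_left_induction with
  | one => simp
  | ι_mul j x hx =>
    rw [map_mul, scale_ι, smul_mul_assoc, map_smul, skewDer_ι_mul, skewDer_ι_mul, hx, map_add,
      map_smul, map_mul, scale_ι]
    split_ifs with h
    · subst h
      simp only [smul_add, smul_mul_assoc, mul_smul_comm, smul_smul, scale_scale, mul_comm]
    · simp only [smul_mul_assoc, mul_smul_comm, smul_smul, zero_add, map_zero]
      congr 1
      ring
  | add x y hx hy => simp only [map_add, hx, hy, smul_add]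
  | smul r x hx => simp only [map_smul, hx, smul_comm r]

/-- The skew derivation with `d (x_j x) = δ_{ij} x + p_{ij} x_j d x`. -/
def leftDer (p : ι → ι → 𝕜ˣ) (i : ι) : FreeAlgebra 𝕜 ι →ₗ[𝕜] FreeAlgebra 𝕜 ι :=
  skewDer (p i) 1 i

/-- The skew derivation with `d (x x_j) = δ_{ij} x + p_{ji} (d x) x_j`. -/
def rightDer (p : ι → ι → 𝕜ˣ) (i : ι) : FreeAlgebra 𝕜 ι →ₗ[𝕜] FreeAlgebra 𝕜 ι :=
  skewDer 1 (fun j => p j i) i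

variable (p : ι → ι → 𝕜ˣ)

@[simp] theorem leftDer_one (i : ι) : leftDer p i 1 = 0 := skewDer_one _ _ _

@[simp] theorem rightDer_one (i : ι) : rightDer p i 1 = 0 := skewDer_one _ _ _

theorem leftDer_ι_mul (i j : ι) (x : FreeAlgebra 𝕜 ι) :
    leftDer p i (FreeAlgebra.ι 𝕜 j * x) = (if i = j then x else 0) +
      (p i j : 𝕜) • (FreeAlgebra.ι 𝕜 j * leftDer p i x) := by
  rw [leftDer, skewDer_ι_mul, scale_one]

theorem rightDer_ι_mul (i j : ι) (x : FreeAlgebra 𝕜 ι) :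
    rightDer p i (FreeAlgebra.ι 𝕜 j * x) = (if i = j then scale (fun m => p m i) x else 0) +
      FreeAlgebra.ι 𝕜 j * rightDer p i x := by
  rw [rightDer, skewDer_ι_mul]
  simp

theorem leftDer_scale (s : ι → 𝕜ˣ) (i : ι) (x : FreeAlgebra 𝕜 ι) :
    leftDer p i (scale s x) = (s i : 𝕜) • scale s (leftDer p i x) := skewDer_scale _ _ _ _ _

theorem rightDer_scale (s : ι → 𝕜ˣ) (i : ι) (x : FreeAlgebra 𝕜 ι) :
    rightDer p i (scale s x) = (s i : 𝕜) • scale s (rightDer p i x) := skewDer_scale _ _ _ _ _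

/-- Left and right skew derivations commute. -/
theorem leftDer_rightDer (i k : ι) (x : FreeAlgebra 𝕜 ι) :
    leftDer p k (rightDer p i x) = rightDer p i (leftDer p k x) := by
  induction x using free_left_induction with
  | one => simp
  | ι_mul j x hx =>
    rw [rightDer_ι_mul, leftDer_ι_mul, map_add, map_add, leftDer_ι_mul, map_smul,
      rightDer_ι_mul, hx]
    by_cases hi : i = j
    · subst hi
      by_cases hk : k = i <;> simp [hk, leftDer_scale] <;> abel
    · by_cases hk : k = j <;> simp [hk, hi]
  | add x y hx hy => simp only [map_add, hx, hy]
  | smul r x hx => simp only [map_smul, hx]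

/-- The iterated left derivations `D_w = D_{w_n} ∘ ⋯ ∘ D_{w_1}` for words `w`. -/
def leftDerHom : FreeAlgebra 𝕜 ι →ₐ[𝕜] (Module.End 𝕜 (FreeAlgebra 𝕜 ι))ᵐᵒᵖ :=
  FreeAlgebra.lift 𝕜 fun i => MulOpposite.op (leftDer p i)

/-- The bilinear form on the free algebra with `(1, y) = ε(y)` and `(x_i x, y) = (x, D_i y)`, where
`D_i` is the derivation `leftDer p i`. -/
def wordForm : FreeAlgebra 𝕜 ι →ₗ[𝕜] FreeAlgebra 𝕜 ι →ₗ[𝕜] 𝕜 :=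
  LinearMap.compr₂ ((MulOpposite.opLinearEquiv 𝕜).symm.toLinearMap ∘ₗ (leftDerHom p).toLinearMap)
    (wordCounit 𝕜 ι).toLinearMap

theorem wordForm_apply (x y : FreeAlgebra 𝕜 ι) :
    wordForm p x y = wordCounit 𝕜 ι ((leftDerHom p x).unop y) := rfl

@[simp] theorem wordForm_one_left (y : FreeAlgebra 𝕜 ι) :
    wordForm p 1 y = wordCounit 𝕜 ι y := by simp [wordForm_apply]

theorem wordForm_ι_mul (i : ι) (x y : FreeAlgebra 𝕜 ι) :
    wordForm p (FreeAlgebra.ι 𝕜 i * x) y = wordForm p x (leftDer p i y) := by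
  simp [wordForm_apply, leftDerHom]

@[simp] theorem wordForm_one_right (x : FreeAlgebra 𝕜 ι) :
    wordForm p x 1 = wordCounit 𝕜 ι x := by
  induction x using free_left_induction with
  | one => simp
  | ι_mul j x hx => simp [wordForm_ι_mul]
  | add x y hx hy => simp only [map_add, LinearMap.add_apply, hx, hy]
  | smul r x hx => simp only [map_smul, LinearMap.smul_apply, hx]

/-- Both sides are the coefficient of the generator `i` in `y`. -/
theorem wordCounit_leftDer (i : ι) (y : FreeAlgebra 𝕜 ι) :
    wordCounit 𝕜 ι (leftDer p i y) = wordCounit 𝕜 ι (rightDer p i y) := by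
  induction y using free_left_induction with
  | one => simp
  | ι_mul j x hx => rw [leftDer_ι_mul, rightDer_ι_mul]; split_ifs <;> simp
  | add x y hx hy => simp only [map_add, hx, hy]
  | smul r x hx => simp only [map_smul, hx]

/-- Right multiplication by a generator is adjoint to the right derivation. -/
theorem wordForm_mul_ι (i : ι) (x y : FreeAlgebra 𝕜 ι) :
    wordForm p (x * FreeAlgebra.ι 𝕜 i) y = wordForm p x (rightDer p i y) := by
  induction x using free_left_induction generalizing y with
  | one =>
    rw [one_mul, ← mul_one (FreeAlgebra.ι 𝕜 i), wordForm_ι_mul, wordForm_one_left,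
      wordForm_one_left, wordCounit_leftDer]
  | ι_mul j x hx => rw [mul_assoc, wordForm_ι_mul, hx, wordForm_ι_mul, leftDer_rightDer]
  | add x y hx hy => simp only [add_mul, map_add, LinearMap.add_apply, hx, hy]
  | smul r x hx => simp only [smul_mul_assoc, map_smul, LinearMap.smul_apply, hx]

theorem wordForm_apply_ι_mul (j : ι) (x y : FreeAlgebra 𝕜 ι) :
    wordForm p x (FreeAlgebra.ι 𝕜 j * y) = wordForm p (leftDer (flip p) j x) y := by
  induction x using free_left_induction generalizing y with
  | one => simp
  | ι_mul i x hx =>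
    rw [wordForm_ι_mul, leftDer_ι_mul, leftDer_ι_mul, map_add, map_smul, hx, map_add, map_smul,
      LinearMap.add_apply, LinearMap.smul_apply, wordForm_ι_mul]
    by_cases h : i = j
    · simp [h, flip]
    · simp [h, Ne.symm h, flip]
  | add x y hx hy => simp only [map_add, LinearMap.add_apply, hx, hy]
  | smul r x hx => simp only [map_smul, LinearMap.smul_apply, hx]

/-- Exchanging the arguments of the form transposes its matrix. -/
theorem wordForm_flip (x y : FreeAlgebra 𝕜 ι) : wordForm (flip p) y x = wordForm p x y := by
  induction y using free_left_induction generalizing x with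
  | one => simp
  | ι_mul j y hy => rw [wordForm_ι_mul, hy, wordForm_apply_ι_mul]
  | add x y hx hy => simp only [map_add, LinearMap.add_apply, hx, hy]
  | smul r x hx => simp only [map_smul, LinearMap.smul_apply, hx]

theorem wordForm_apply_mul_ι (j : ι) (x y : FreeAlgebra 𝕜 ι) :
    wordForm p x (y * FreeAlgebra.ι 𝕜 j) = wordForm p (rightDer (flip p) j x) y := by
  rw [← wordForm_flip, wordForm_mul_ι, wordForm_flip]

/-- Scaling automorphisms are self-adjoint. -/
theorem wordForm_scale (c : ι → 𝕜ˣ) (x y : FreeAlgebra 𝕜 ι) :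
    wordForm p (scale c x) y = wordForm p x (scale c y) := by
  induction x using free_left_induction generalizing y with
  | one => simp
  | ι_mul j x hx =>
    rw [map_mul, scale_ι, smul_mul_assoc, map_smul, LinearMap.smul_apply, wordForm_ι_mul, hx,
      wordForm_ι_mul, leftDer_scale, map_smul]
  | add x y hx hy => simp only [map_add, LinearMap.add_apply, hx, hy]
  | smul r x hx => simp only [map_smul, LinearMap.smul_apply, hx]

/-- The right kernel of `wordForm p`. By `wordForm_flip` the left kernel is `wordRad (flip p)`. -/
def wordRad : Submodule 𝕜 (FreeAlgebra 𝕜 ι) := LinearMap.ker (wordForm p).flip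

variable {p}

theorem mem_wordRad {y : FreeAlgebra 𝕜 ι} : y ∈ wordRad p ↔ ∀ x, wordForm p x y = 0 := by
  simp [wordRad, LinearMap.ext_iff]

theorem mem_wordRad_flip {x : FreeAlgebra 𝕜 ι} :
    x ∈ wordRad (flip p) ↔ ∀ y, wordForm p x y = 0 := by
  simp only [mem_wordRad, wordForm_flip]

theorem mul_mem_wordRad_left (z : FreeAlgebra 𝕜 ι) {y : FreeAlgebra 𝕜 ι} (hy : y ∈ wordRad p) :
    z * y ∈ wordRad p := by
  induction z using free_left_induction with
  | one => simpa using hy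
  | ι_mul i z hz =>
    rw [mul_assoc, mem_wordRad]
    intro x
    rw [wordForm_apply_ι_mul]
    exact mem_wordRad.1 hz _
  | add a b ha hb => rw [add_mul]; exact add_mem ha hb
  | smul r a ha => rw [smul_mul_assoc]; exact Submodule.smul_mem _ _ ha

theorem mul_mem_wordRad_right (z : FreeAlgebra 𝕜 ι) {y : FreeAlgebra 𝕜 ι} (hy : y ∈ wordRad p) :
    y * z ∈ wordRad p := by
  induction z using free_left_induction generalizing y with
  | one => simpa using hy
  | ι_mul i z hz =>
    rw [← mul_assoc]
    refine hz (mem_wordRad.2 fun x => ?_)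
    rw [wordForm_apply_mul_ι]
    exact mem_wordRad.1 hy _
  | add a b ha hb => rw [mul_add]; exact add_mem (ha hy) (hb hy)
  | smul r a ha => rw [mul_smul_comm]; exact Submodule.smul_mem _ _ (ha hy)

theorem scale_mem_wordRad (c : ι → 𝕜ˣ) {y : FreeAlgebra 𝕜 ι} (hy : y ∈ wordRad p) :
    scale c y ∈ wordRad p :=
  mem_wordRad.2 fun x => by rw [← wordForm_scale]; exact mem_wordRad.1 hy _

theorem leftDer_mem_wordRad (i : ι) {y : FreeAlgebra 𝕜 ι} (hy : y ∈ wordRad p) :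
    leftDer p i y ∈ wordRad p :=
  mem_wordRad.2 fun x => by rw [← wordForm_ι_mul]; exact mem_wordRad.1 hy _

theorem rightDer_mem_wordRad (i : ι) {y : FreeAlgebra 𝕜 ι} (hy : y ∈ wordRad p) :
    rightDer p i y ∈ wordRad p :=
  mem_wordRad.2 fun x => by rw [← wordForm_mul_ι]; exact mem_wordRad.1 hy _

end FreeWords

/-! ### Algebras with the commutation relations of a quantum double -/

section Double

variable {𝕜 ι A : Type*} [Field 𝕜] [AddCommGroup A]

/-- The parameters of a quantum double with generators `X_i, Y_i, H_a, K_a`: a matrix `p`, the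
roots, and the characters by which `H_a` and `K_a` act on the `X_i`. -/
structure DoubleDatum (𝕜 ι A : Type*) [Field 𝕜] [AddCommGroup A] where
  p : ι → ι → 𝕜ˣ
  root : ι → A
  sH : A → ι → 𝕜ˣ
  sK : A → ι → 𝕜ˣ
  sH_zero : sH 0 = 1
  sK_zero : sK 0 = 1
  sH_add : ∀ a b, sH (a + b) = sH a * sH b
  sK_add : ∀ a b, sK (a + b) = sK a * sK b
  sH_root : ∀ i m, sH (root i) m = p m i
  sK_root : ∀ i m, sK (root i) m = (p i m)⁻¹

/-- The parameters after the exchange of `(X, H)` with `(Y, K)`. -/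
def DoubleDatum.swap (D : DoubleDatum 𝕜 ι A) : DoubleDatum 𝕜 ι A where
  p := flip D.p
  root := D.root
  sH a := (D.sK a)⁻¹
  sK a := (D.sH a)⁻¹
  sH_zero := by rw [D.sK_zero, inv_one]
  sK_zero := by rw [D.sH_zero, inv_one]
  sH_add a b := by rw [D.sK_add, mul_inv]
  sK_add a b := by rw [D.sH_add, mul_inv]
  sH_root i m := by simp [D.sK_root, flip]
  sK_root i m := by simp [D.sH_root, flip]

theorem DoubleDatum.swap_swap (D : DoubleDatum 𝕜 ι A) : D.swap.swap = D := by
  cases D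
  simp [DoubleDatum.swap]

variable [DecidableEq ι]

/-- The elements `X_i, Y_i, H_a, K_a` of an algebra satisfy the commutation relations of the quantum
double with parameters `D`. The relations are symmetric under the exchange of `(X, H)` with
`(Y, K)`, so that they describe `U` in two ways. -/
structure DoubleRel (D : DoubleDatum 𝕜 ι A) {R : Type*} [Ring R] [Algebra 𝕜 R]
    (X Y : ι → R) (H K : A → R) : Prop where
  H_zero : H 0 = 1
  K_zero : K 0 = 1
  H_add : ∀ a b, H a * H b = H (a + b)
  K_add : ∀ a b, K a * K b = K (a + b)
  K_H : ∀ a b, K a * H b = H b * K a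
  H_X : ∀ a i, H a * X i = (D.sH a i : 𝕜) • (X i * H a)
  K_X : ∀ a i, K a * X i = (D.sK a i : 𝕜) • (X i * K a)
  H_Y : ∀ a i, H a * Y i = (((D.sH a i)⁻¹ : 𝕜ˣ) : 𝕜) • (Y i * H a)
  K_Y : ∀ a i, K a * Y i = (((D.sK a i)⁻¹ : 𝕜ˣ) : 𝕜) • (Y i * K a)
  Y_X : ∀ i j, Y i * X j - X j * Y i = if i = j then H (D.root i) - K (D.root i) else 0

/-- Evaluation of noncommutative polynomials. -/
abbrev evalWord {R : Type*} [Ring R] [Algebra 𝕜 R] (X : ι → R) : FreeAlgebra 𝕜 ι →ₐ[𝕜] R :=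
  FreeAlgebra.lift 𝕜 X

omit [DecidableEq ι] in
theorem mul_evalWord_of_scale {R : Type*} [Ring R] [Algebra 𝕜 R] {X : ι → R} {h : R} {c : ι → 𝕜ˣ}
    (hX : ∀ i, h * X i = (c i : 𝕜) • (X i * h)) (x : FreeAlgebra 𝕜 ι) :
    h * evalWord X x = evalWord X (scale c x) * h := by
  induction x using free_left_induction with
  | one => simp
  | ι_mul i x hx =>
    rw [map_mul, ← mul_assoc, FreeAlgebra.lift_ι_apply, hX, smul_mul_assoc, mul_assoc, hx]
    simp [mul_assoc]
  | add x y hx hy => simp only [map_add, mul_add, add_mul, hx, hy]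
  | smul r x hx => simp only [map_smul, mul_smul_comm, smul_mul_assoc, hx]

/-- The span of the ordered products `X(y) H_a Y(x) K_b`, for polynomials `x`, `y`. -/
def orderedSpan (𝕜 : Type*) [Field 𝕜] {R : Type*} [Ring R] [Algebra 𝕜 R] (X Y : ι → R)
    (H K : A → R) : Submodule 𝕜 R :=
  Submodule.span 𝕜 {z | ∃ (y : FreeAlgebra 𝕜 ι) (a : A) (x : FreeAlgebra 𝕜 ι) (b : A),
    z = evalWord X y * H a * evalWord Y x * K b}

variable {D : DoubleDatum 𝕜 ι A} {R : Type*} [Ring R] [Algebra 𝕜 R] {X Y : ι → R} {H K : A → R}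

theorem DoubleRel.swap (h : DoubleRel D X Y H K) : DoubleRel D.swap Y X K H where
  H_zero := h.K_zero
  K_zero := h.H_zero
  H_add := h.K_add
  K_add := h.H_add
  K_H a b := (h.K_H b a).symm
  H_X := h.K_Y
  K_X := h.H_Y
  H_Y a i := by simpa [DoubleDatum.swap] using h.K_X a i
  K_Y a i := by simpa [DoubleDatum.swap] using h.H_X a i
  Y_X i j := by
    have h1 := h.Y_X j i
    by_cases hij : i = j
    · subst hij
      rw [if_pos rfl] at h1 ⊢
      rw [← neg_sub, h1, neg_sub]; rfl
    · rw [if_neg (Ne.symm hij)] at h1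
      rw [if_neg hij, ← neg_sub, h1, neg_zero]

theorem DoubleRel.of_swap (h : DoubleRel D.swap X Y H K) : DoubleRel D Y X K H := by
  simpa only [DoubleDatum.swap_swap] using h.swap

namespace DoubleRel

variable (h : DoubleRel D X Y H K)

include h

theorem H_evalX (a : A) (x : FreeAlgebra 𝕜 ι) :
    H a * evalWord X x = evalWord X (scale (D.sH a) x) * H a := mul_evalWord_of_scale (h.H_X a) x

theorem K_evalX (a : A) (x : FreeAlgebra 𝕜 ι) :
    K a * evalWord X x = evalWord X (scale (D.sK a) x) * K a := mul_evalWord_of_scale (h.K_X a) x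

theorem K_evalY (a : A) (x : FreeAlgebra 𝕜 ι) :
    K a * evalWord Y x = evalWord Y (scale (D.sK a)⁻¹ x) * K a :=
  mul_evalWord_of_scale (fun i => by rw [h.K_Y]; rfl) x

/-- Moving `Y_i` to the right of a polynomial in the `X_j` produces the two skew derivations. -/
theorem Y_evalX (i : ι) (y : FreeAlgebra 𝕜 ι) :
    Y i * evalWord X y = evalWord X y * Y i + evalWord X (rightDer D.p i y) * H (D.root i) -
      K (D.root i) * evalWord X (leftDer D.p i y) := by
  induction y using free_left_induction with
  | one => simp
  | ι_mul j y hy =>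
    have h1 : Y i * X j = X j * Y i + if i = j then H (D.root i) - K (D.root i) else 0 := by
      rw [← h.Y_X]; abel
    have hK : X j * K (D.root i) = (D.p i j : 𝕜) • (K (D.root i) * X j) := by
      rw [h.K_X, smul_smul, D.sK_root]; simp
    have hH : H (D.root i) * evalWord X y =
        evalWord X (scale (fun m => D.p m i) y) * H (D.root i) := by
      rw [h.H_evalX]; congr 4; funext m; rw [D.sH_root]
    rw [map_mul, FreeAlgebra.lift_ι_apply, ← mul_assoc, h1, add_mul, mul_assoc, hy, rightDer_ι_mul,
      leftDer_ι_mul, map_add, map_add, map_mul, map_smul, map_mul, FreeAlgebra.lift_ι_apply,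
      mul_sub, mul_add, ← mul_assoc (X j) (K _), hK]
    split_ifs with hij
    · subst hij
      rw [sub_mul, hH]
      simp only [mul_add, add_mul, mul_assoc, smul_mul_assoc, mul_smul_comm]
      abel
    · simp only [zero_mul, map_zero, zero_add, mul_assoc, smul_mul_assoc, mul_smul_comm, add_zero]
  | add x y hx hy => simp only [map_add, mul_add, add_mul, hx, hy]; abel
  | smul r x hx => simp only [map_smul, mul_smul_comm, smul_mul_assoc, hx, smul_sub, smul_add]

/-- Moving `X_j` to the left of a polynomial in the `Y_i`. -/
theorem evalY_X (j : ι) (x : FreeAlgebra 𝕜 ι) :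
    evalWord Y x * X j = X j * evalWord Y x + H (D.root j) * evalWord Y (leftDer (flip D.p) j x) -
      evalWord Y (rightDer (flip D.p) j x) * K (D.root j) := by
  induction x using free_left_induction with
  | one => simp
  | ι_mul i x hx =>
    have h1 : Y i * X j = X j * Y i + if j = i then H (D.root j) - K (D.root j) else 0 := by
      have := h.Y_X i j
      by_cases hij : i = j
      · subst hij; rw [if_pos rfl] at this ⊢; rw [← this]; abel
      · rw [if_neg hij] at this; rw [if_neg (Ne.symm hij), add_zero]; exact sub_eq_zero.1 this
    have hH : Y i * H (D.root j) = (D.p i j : 𝕜) • (H (D.root j) * Y i) := by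
      rw [h.H_Y, smul_smul, D.sH_root]; simp
    have hK : K (D.root j) * evalWord Y x =
        evalWord Y (scale (fun m => flip D.p m j) x) * K (D.root j) := by
      rw [h.K_evalY]; congr 4; funext m; simp [D.sK_root, flip]
    rw [map_mul, FreeAlgebra.lift_ι_apply, mul_assoc, hx, mul_sub, mul_add, ← mul_assoc, h1,
      ← mul_assoc (Y i) (H _), hH, rightDer_ι_mul, leftDer_ι_mul, map_add, map_add, map_mul,
      map_smul, map_mul, FreeAlgebra.lift_ι_apply]
    split_ifs with hij
    · subst hij
      simp only [mul_add, add_mul, sub_mul, hK, smul_mul_assoc, mul_smul_comm]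
      simp only [mul_assoc, flip]
      abel
    · simp only [map_zero, zero_add, mul_assoc, smul_mul_assoc, mul_smul_comm, add_zero, flip]
  | add x y hx hy => simp only [map_add, mul_add, add_mul, hx, hy]; abel
  | smul r x hx => simp only [map_smul, mul_smul_comm, smul_mul_assoc, hx, smul_sub, smul_add]

theorem K_mul_ordered (c : A) (y : FreeAlgebra 𝕜 ι) (a : A) (x : FreeAlgebra 𝕜 ι) (b : A) :
    K c * (evalWord X y * H a * evalWord Y x * K b) =
      evalWord X (scale (D.sK c) y) * H a * evalWord Y (scale (D.sK c)⁻¹ x) * K (c + b) := by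
  simp only [← mul_assoc]
  rw [h.K_evalX, mul_assoc _ (K c), h.K_H, ← mul_assoc, mul_assoc _ (K c), h.K_evalY,
    ← mul_assoc, mul_assoc _ (K c), h.K_add]

theorem Y_mul_ordered (i : ι) (y : FreeAlgebra 𝕜 ι) (a : A) (x : FreeAlgebra 𝕜 ι) (b : A) :
    Y i * (evalWord X y * H a * evalWord Y x * K b) =
      (D.sH a i : 𝕜) • (evalWord X y * H a * evalWord Y (FreeAlgebra.ι 𝕜 i * x) * K b) +
      evalWord X (rightDer D.p i y) * H (D.root i + a) * evalWord Y x * K b -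
      evalWord X (scale (D.sK (D.root i)) (leftDer D.p i y)) * H a *
        evalWord Y (scale (D.sK (D.root i))⁻¹ x) * K (D.root i + b) := by
  have hH : Y i * H a = (D.sH a i : 𝕜) • (H a * Y i) := by rw [h.H_Y, smul_smul]; simp
  rw [← h.K_mul_ordered, ← h.H_add, map_mul, FreeAlgebra.lift_ι_apply]
  simp only [← mul_assoc]
  rw [h.Y_evalX, sub_mul, sub_mul, sub_mul, add_mul, add_mul, add_mul, mul_assoc _ (Y i), hH]
  simp only [mul_smul_comm, smul_mul_assoc, mul_assoc]

/-- The ordered products `X(y) H_a Y(x) K_b` span a left ideal of the algebra generated by the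
`X_i, Y_i, H_a, K_a`. -/
theorem mul_mem_orderedSpan {g : R} (hg : (∃ i, g = X i) ∨ (∃ i, g = Y i) ∨ (∃ a, g = H a) ∨
    ∃ a, g = K a) {m : R} (hm : m ∈ orderedSpan 𝕜 X Y H K) : g * m ∈ orderedSpan 𝕜 X Y H K := by
  induction hm using Submodule.span_induction with
  | zero => rw [mul_zero]; exact zero_mem _
  | add u v _ _ hu hv => rw [mul_add]; exact add_mem hu hv
  | smul r u _ hu => rw [mul_smul_comm]; exact Submodule.smul_mem _ _ hu
  | mem u hu =>
    obtain ⟨y, a, x, b, rfl⟩ := hu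
    have key : ∀ (y : FreeAlgebra 𝕜 ι) a (x : FreeAlgebra 𝕜 ι) b,
        evalWord X y * H a * evalWord Y x * K b ∈ orderedSpan 𝕜 X Y H K :=
      fun y a x b => Submodule.subset_span ⟨y, a, x, b, rfl⟩
    rcases hg with ⟨i, rfl⟩ | ⟨i, rfl⟩ | ⟨c, rfl⟩ | ⟨c, rfl⟩
    · have e : X i * (evalWord X y * H a * evalWord Y x * K b) =
          evalWord X (FreeAlgebra.ι 𝕜 i * y) * H a * evalWord Y x * K b := by
        simp [mul_assoc]
      rw [e]; exact key _ _ _ _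
    · rw [h.Y_mul_ordered]
      exact sub_mem (add_mem (Submodule.smul_mem _ _ (key _ _ _ _)) (key _ _ _ _)) (key _ _ _ _)
    · have e : H c * (evalWord X y * H a * evalWord Y x * K b) =
          evalWord X (scale (D.sH c) y) * H (c + a) * evalWord Y x * K b := by
        simp only [← mul_assoc]
        rw [h.H_evalX, mul_assoc _ (H c), h.H_add]
      rw [e]; exact key _ _ _ _
    · rw [h.K_mul_ordered]; exact key _ _ _ _

end DoubleRel

end Double

/-! ### The regular representation of a quantum double -/

section Regular

variable {𝕜 ι A : Type*} [Field 𝕜] [AddCommGroup A] [DecidableEq ι] (D : DoubleDatum 𝕜 ι A)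

/-- The free algebra modulo the right kernel of the form with matrix `p`. -/
abbrev WordQuot (p : ι → ι → 𝕜ˣ) : Type _ := FreeAlgebra 𝕜 ι ⧸ wordRad p

/-- The space of the regular representation: its pure tensors `ordered D (a, b) y x` stand for the
ordered products `X(y) H_a Y(x) K_b`. -/
abbrev RegSpace : Type _ := WordQuot D.p ⊗[𝕜] (WordQuot (flip D.p) ⊗[𝕜] (A × A →₀ 𝕜))

/-- The vector that stands for `X(y) H_a Y(x) K_b`, where `g = (a, b)`. -/
def ordered (g : A × A) : FreeAlgebra 𝕜 ι →ₗ[𝕜] FreeAlgebra 𝕜 ι →ₗ[𝕜] RegSpace D :=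
  LinearMap.compl₂ (TensorProduct.mk 𝕜 _ _ ∘ₗ (wordRad D.p).mkQ)
    ((TensorProduct.mk 𝕜 _ _).flip (Finsupp.single g 1) ∘ₗ (wordRad (flip D.p)).mkQ)

theorem ordered_apply (g : A × A) (y x : FreeAlgebra 𝕜 ι) : ordered D g y x =
    (wordRad D.p).mkQ y ⊗ₜ ((wordRad (flip D.p)).mkQ x ⊗ₜ Finsupp.single g 1) := rfl

variable {D}

theorem ordered_eq_zero_left {y : FreeAlgebra 𝕜 ι} (hy : y ∈ wordRad D.p) (g : A × A)
    (x : FreeAlgebra 𝕜 ι) : ordered D g y x = 0 := by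
  rw [ordered_apply, Submodule.mkQ_apply, (Submodule.Quotient.mk_eq_zero _).2 hy,
    TensorProduct.zero_tmul]

theorem ordered_eq_zero_right {x : FreeAlgebra 𝕜 ι} (hx : x ∈ wordRad (flip D.p)) (g : A × A)
    (y : FreeAlgebra 𝕜 ι) : ordered D g y x = 0 := by
  rw [ordered_apply, Submodule.mkQ_apply _ x, (Submodule.Quotient.mk_eq_zero _).2 hx,
    TensorProduct.zero_tmul, TensorProduct.tmul_zero]

theorem regSpace_ext {P : Type*} [AddCommGroup P] [Module 𝕜 P] {φ ψ : RegSpace D →ₗ[𝕜] P}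
    (h : ∀ g y x, φ (ordered D g y x) = ψ (ordered D g y x)) : φ = ψ := by
  refine TensorProduct.ext ?_
  refine Submodule.linearMap_qext _ (LinearMap.ext fun y => ?_)
  refine TensorProduct.ext ?_
  refine Submodule.linearMap_qext _ (LinearMap.ext fun x => ?_)
  exact Finsupp.lhom_ext' fun g => LinearMap.ext_ring (h g y x)

theorem span_ordered : Submodule.span 𝕜 {m | ∃ g y x, m = ordered D g y x} = ⊤ := by
  rw [← Submodule.ker_mkQ (Submodule.span 𝕜 {m | ∃ g y x, m = ordered D g y x}),
    LinearMap.ker_eq_top]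
  refine regSpace_ext fun g y x => ?_
  rw [LinearMap.zero_apply, Submodule.mkQ_apply, Submodule.Quotient.mk_eq_zero]
  exact Submodule.subset_span ⟨g, y, x, rfl⟩

/-- The operator `ordered g y x ↦ κ(g) • ordered (c + g) (φ y) (ψ x)`. -/
def regOp (φ ψ : FreeAlgebra 𝕜 ι →ₗ[𝕜] FreeAlgebra 𝕜 ι)
    (hφ : wordRad D.p ≤ (wordRad D.p).comap φ)
    (hψ : wordRad (flip D.p) ≤ (wordRad (flip D.p)).comap ψ) (κ : A × A → 𝕜) (c : A × A) :
    Module.End 𝕜 (RegSpace D) :=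
  TensorProduct.map (Submodule.mapQ _ _ φ hφ) (TensorProduct.map (Submodule.mapQ _ _ ψ hψ)
    (Finsupp.linearCombination 𝕜 fun g => Finsupp.single (c + g) (κ g)))

@[simp] theorem regOp_ordered (φ ψ : FreeAlgebra 𝕜 ι →ₗ[𝕜] FreeAlgebra 𝕜 ι)
    (hφ : wordRad D.p ≤ (wordRad D.p).comap φ)
    (hψ : wordRad (flip D.p) ≤ (wordRad (flip D.p)).comap ψ) (κ : A × A → 𝕜) (c g : A × A)
    (y x : FreeAlgebra 𝕜 ι) : regOp φ ψ hφ hψ κ c (ordered D g y x) =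
      κ g • ordered D (c + g) (φ y) (ψ x) := by
  have h : (Finsupp.single (c + g) (κ g) : A × A →₀ 𝕜) = κ g • Finsupp.single (c + g) 1 := by simp
  rw [ordered_apply, regOp, TensorProduct.map_tmul, TensorProduct.map_tmul,
    Finsupp.linearCombination_single, one_smul, h, TensorProduct.tmul_smul, TensorProduct.tmul_smul]
  rfl

theorem scale_stable (p : ι → ι → 𝕜ˣ) (c : ι → 𝕜ˣ) :
    wordRad p ≤ (wordRad p).comap (scale c).toLinearMap := fun _ hy => scale_mem_wordRad c hy

theorem mulLeft_stable (p : ι → ι → 𝕜ˣ) (z : FreeAlgebra 𝕜 ι) :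
    wordRad p ≤ (wordRad p).comap (LinearMap.mulLeft 𝕜 z) := fun _ hy => mul_mem_wordRad_left z hy

variable (D)

/-- The action of `X_i`. -/
def regX (i : ι) : Module.End 𝕜 (RegSpace D) :=
  regOp (LinearMap.mulLeft 𝕜 (FreeAlgebra.ι 𝕜 i)) LinearMap.id (mulLeft_stable _ _) le_rfl 1 0

/-- The action of `H_a`. -/
def regH (a : A) : Module.End 𝕜 (RegSpace D) :=
  regOp (scale (D.sH a)).toLinearMap LinearMap.id (scale_stable _ _) le_rfl 1 (a, 0)

/-- The action of `K_a`. -/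
def regK (a : A) : Module.End 𝕜 (RegSpace D) :=
  regOp (scale (D.sK a)).toLinearMap (scale (D.sK a)⁻¹).toLinearMap (scale_stable _ _)
    (scale_stable _ _) 1 (0, a)

/-- The action of `Y_i`, according to `DoubleRel.Y_evalX`. -/
def regY (i : ι) : Module.End 𝕜 (RegSpace D) :=
  regOp LinearMap.id (LinearMap.mulLeft 𝕜 (FreeAlgebra.ι 𝕜 i)) le_rfl (mulLeft_stable _ _)
      (fun g => (D.sH g.1 i : 𝕜)) 0 +
    regOp (rightDer D.p i) LinearMap.id (fun _ hy => rightDer_mem_wordRad i hy) le_rfl 1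
      (D.root i, 0) -
    regK D (D.root i) * regOp (leftDer D.p i) LinearMap.id
      (fun _ hy => leftDer_mem_wordRad i hy) le_rfl 1 0

@[simp] theorem regX_ordered (i : ι) (g : A × A) (y x : FreeAlgebra 𝕜 ι) :
    regX D i (ordered D g y x) = ordered D g (FreeAlgebra.ι 𝕜 i * y) x := by simp [regX]

@[simp] theorem regH_ordered (a : A) (g : A × A) (y x : FreeAlgebra 𝕜 ι) :
    regH D a (ordered D g y x) = ordered D (a + g.1, g.2) (scale (D.sH a) y) x := by
  simp [regH, Prod.add_def]

@[simp] theorem regK_ordered (a : A) (g : A × A) (y x : FreeAlgebra 𝕜 ι) :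
    regK D a (ordered D g y x) =
      ordered D (g.1, a + g.2) (scale (D.sK a) y) (scale (D.sK a)⁻¹ x) := by
  simp [regK, Prod.add_def]

@[simp] theorem regY_ordered (i : ι) (g : A × A) (y x : FreeAlgebra 𝕜 ι) :
    regY D i (ordered D g y x) =
      (D.sH g.1 i : 𝕜) • ordered D g y (FreeAlgebra.ι 𝕜 i * x) +
      ordered D (D.root i + g.1, g.2) (rightDer D.p i y) x -
      ordered D (g.1, D.root i + g.2) (scale (D.sK (D.root i)) (leftDer D.p i y))
        (scale (D.sK (D.root i))⁻¹ x) := by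
  simp [regY, Prod.add_def]

theorem regular_doubleRel : DoubleRel D (regX D) (regY D) (regH D) (regK D) where
  H_zero := regSpace_ext fun g y x => by simp [D.sH_zero]
  K_zero := regSpace_ext fun g y x => by simp [D.sK_zero]
  H_add a b := regSpace_ext fun g y x => by simp [D.sH_add, scale_scale, add_assoc]
  K_add a b := regSpace_ext fun g y x => by
    simp [D.sK_add, scale_scale, add_assoc, mul_comm]
  K_H a b := regSpace_ext fun g y x => by simp [scale_scale, mul_comm]
  H_X a i := regSpace_ext fun g y x => by simp
  K_X a i := regSpace_ext fun g y x => by simp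
  H_Y a i := regSpace_ext fun g y x => by
    simp only [Module.End.mul_apply, LinearMap.smul_apply, regY_ordered, regH_ordered, map_add,
      map_sub, map_smul, rightDer_scale, leftDer_scale, smul_add, smul_sub, smul_smul, scale_scale]
    simp [D.sH_add, mul_comm, add_left_comm]
  K_Y a i := regSpace_ext fun g y x => by
    simp only [Module.End.mul_apply, LinearMap.smul_apply, regY_ordered, regK_ordered, map_add,
      map_sub, map_smul, map_mul, scale_ι, rightDer_scale, leftDer_scale, smul_add, smul_sub,
      smul_smul, scale_scale, smul_mul_assoc]
    simp [mul_comm, add_left_comm]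
  Y_X i j := regSpace_ext fun g y x => by
    have hp : (fun m => D.p m i) = D.sH (D.root i) := funext fun m => (D.sH_root i m).symm
    simp only [LinearMap.sub_apply, Module.End.mul_apply, regX_ordered, regY_ordered, map_add,
      map_sub, map_smul, rightDer_ι_mul, leftDer_ι_mul, map_mul, scale_ι, LinearMap.add_apply,
      LinearMap.smul_apply, smul_mul_assoc, smul_smul, D.sK_root, hp]
    split_ifs with h
    · simp; abel
    · simp

theorem evalWord_regX_ordered (z : FreeAlgebra 𝕜 ι) (g : A × A) (y x : FreeAlgebra 𝕜 ι) :
    evalWord (regX D) z (ordered D g y x) = ordered D g (z * y) x := by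
  induction z using free_left_induction with
  | one => simp
  | ι_mul i z hz => simp [hz, mul_assoc]
  | add a b ha hb => simp only [map_add, add_mul, LinearMap.add_apply, ha, hb]
  | smul r a ha => simp only [map_smul, smul_mul_assoc, LinearMap.smul_apply, ha]

theorem evalWord_regY_ordered_one (z : FreeAlgebra 𝕜 ι) (g : A × A) (x : FreeAlgebra 𝕜 ι) :
    evalWord (regY D) z (ordered D g 1 x) = ordered D g 1 (scale (D.sH g.1) z * x) := by
  induction z using free_left_induction with
  | one => simp
  | ι_mul i z hz => simp [hz, mul_assoc]
  | add a b ha hb => simp only [map_add, add_mul, LinearMap.add_apply, ha, hb]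
  | smul r a ha => simp only [map_smul, smul_mul_assoc, LinearMap.smul_apply, ha]

theorem evalWord_regX_eq_zero {y : FreeAlgebra 𝕜 ι} (hy : y ∈ wordRad D.p) :
    evalWord (regX D) y = 0 :=
  regSpace_ext fun g z x => by
    rw [evalWord_regX_ordered, ordered_eq_zero_left (mul_mem_wordRad_right z hy),
      LinearMap.zero_apply]

/-- Polynomials in the left kernel act by zero: moving them past the `X_j` only produces skew
derivatives, which lie in the kernel again. -/
theorem evalWord_regY_eq_zero {x : FreeAlgebra 𝕜 ι} (hx : x ∈ wordRad (flip D.p)) :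
    evalWord (regY D) x = 0 := by
  refine regSpace_ext fun g y z => ?_
  rw [LinearMap.zero_apply]
  induction y using free_left_induction generalizing x g z with
  | one =>
    rw [evalWord_regY_ordered_one, ordered_eq_zero_right]
    exact mul_mem_wordRad_right z (scale_mem_wordRad _ hx)
  | ι_mul j y hy =>
    have h := DFunLike.congr_fun ((regular_doubleRel D).evalY_X j x) (ordered D g y z)
    simp only [Module.End.mul_apply, LinearMap.sub_apply, LinearMap.add_apply,
      regX_ordered] at h
    have hk : ∀ x' ∈ wordRad (flip D.p),
        evalWord (regY D) x' (regK D (D.root j) (ordered D g y z)) = 0 := by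
      intro x' hx'
      have h2 := DFunLike.congr_fun
        ((regular_doubleRel D).K_evalY (D.root j) (scale (D.sK (D.root j)) x')) (ordered D g y z)
      simp only [Module.End.mul_apply, scale_scale, inv_mul_cancel, scale_one] at h2
      rw [← h2, hy (scale_mem_wordRad _ hx'), map_zero]
    rw [h, hy hx, hy (leftDer_mem_wordRad _ hx), hk _ (rightDer_mem_wordRad _ hx)]
    simp
  | add a b ha hb => rw [map_add, LinearMap.add_apply, map_add, ha hx, hb hx, add_zero]
  | smul r a ha => rw [map_smul, LinearMap.smul_apply, map_smul, ha hx, smul_zero]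

theorem regular_ordered_product (y x : FreeAlgebra 𝕜 ι) (a b : A) :
    (evalWord (regX D) y * regH D a * evalWord (regY D) x * regK D b) (ordered D 0 1 1) =
      ordered D (a, b) y x := by
  simp [evalWord_regX_ordered, evalWord_regY_ordered_one, D.sH_zero]

section Product

variable {D} {R : Type*} [Ring R] [Algebra 𝕜 R]

/-- The linear map from the regular representation to an algebra that sends `ordered (a, b) y x` to
`X(y) H_a Y(x) K_b`. -/
def orderedProduct (X Y : ι → R) (H K : A → R) (hX : ∀ y ∈ wordRad D.p, evalWord X y = 0)
    (hY : ∀ x ∈ wordRad (flip D.p), evalWord Y x = 0) : RegSpace D →ₗ[𝕜] R :=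
  LinearMap.mul' 𝕜 R ∘ₗ TensorProduct.map (Submodule.liftQ _ (evalWord X).toLinearMap hX)
    (LinearMap.mul' 𝕜 R ∘ₗ TensorProduct.map LinearMap.id (LinearMap.mul' 𝕜 R) ∘ₗ
      (TensorProduct.leftComm 𝕜 R R R).toLinearMap ∘ₗ
      TensorProduct.map (Submodule.liftQ _ (evalWord Y).toLinearMap hY)
        (Finsupp.linearCombination 𝕜 fun g : A × A => H g.1 ⊗ₜ[𝕜] K g.2))

theorem orderedProduct_ordered (X Y : ι → R) (H K : A → R)
    (hX : ∀ y ∈ wordRad D.p, evalWord X y = 0)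
    (hY : ∀ x ∈ wordRad (flip D.p), evalWord Y x = 0) (g : A × A) (y x : FreeAlgebra 𝕜 ι) :
    orderedProduct X Y H K hX hY (ordered D g y x) =
      evalWord X y * H g.1 * evalWord Y x * K g.2 := by
  simp only [orderedProduct, ordered_apply, mul_assoc]
  simp [Submodule.mkQ_apply]
  rfl

end Product

end Regular

/-! ### The Drinfeld pairing on words -/

section Pairing

variable {𝕜 A : Type*} [Field 𝕜] [AddCommGroup A] {l : ℕ} (χ : Bicharacter 𝕜 A) (π : Fin l → A)

theorem Bicharacter.map_neg_left (a b : A) : χ (-a) b = (χ a b)⁻¹ := by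
  rw [eq_inv_iff_mul_eq_one, ← χ.map_add_left, neg_add_cancel, χ.map_zero_left]

theorem Bicharacter.map_neg_right (a b : A) : χ a (-b) = (χ a b)⁻¹ := by
  rw [eq_inv_iff_mul_eq_one, ← χ.map_add_right, neg_add_cancel, χ.map_zero_right]

theorem PosBorel.K_zero : PosBorel.of χ π (.K 0) = 1 :=
  (RingQuot.mkAlgHom_rel 𝕜 (PosRel.K_zero (χ := χ) (π := π))).trans (map_one _)

theorem PosBorel.K_add (a b : A) :
    PosBorel.of χ π (.K a) * PosBorel.of χ π (.K b) = PosBorel.of χ π (.K (a + b)) :=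
  (map_mul (RingQuot.mkAlgHom 𝕜 (PosRel χ π)) _ _).symm.trans
    (RingQuot.mkAlgHom_rel 𝕜 (PosRel.K_add (χ := χ) (π := π) a b))

theorem PosBorel.K_E (a : A) (i : Fin l) :
    PosBorel.of χ π (.K a) * PosBorel.of χ π (.E i) =
      (χ a (π i) : 𝕜) • (PosBorel.of χ π (.E i) * PosBorel.of χ π (.K a)) := by
  have h := RingQuot.mkAlgHom_rel 𝕜 (PosRel.K_E (χ := χ) (π := π) a i)
  rw [map_mul, map_smul, map_mul] at h
  exact h

variable {χ π} in
/-- A submodule that contains `1` and is stable under left multiplication by the generators is the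
whole positive Borel algebra. -/
theorem PosBorel.eq_top_of_stable {S : Submodule 𝕜 (PosBorel χ π)} (h1 : 1 ∈ S)
    (hg : ∀ g, ∀ x ∈ S, PosBorel.of χ π g * x ∈ S) : S = ⊤ := by
  refine eq_top_iff.2 fun x _ => ?_
  obtain ⟨y, rfl⟩ := RingQuot.mkAlgHom_surjective 𝕜 (PosRel χ π) x
  induction y using free_left_induction with
  | one => rw [map_one]; exact h1
  | ι_mul g y hy => rw [map_mul]; exact hg g _ (hy trivial)
  | add a b ha hb => rw [map_add]; exact add_mem (ha trivial) (hb trivial)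
  | smul r a ha => rw [map_smul]; exact S.smul_mem r (ha trivial)

variable {χ π} in
/-- A submodule that contains `1` and is stable under left multiplication by the generators is the
whole negative Borel algebra. -/
theorem NegBorel.eq_top_of_stable {S : Submodule 𝕜 (NegBorel χ π)} (h1 : 1 ∈ S)
    (hg : ∀ g, ∀ x ∈ S, NegBorel.of χ π g * x ∈ S) : S = ⊤ := by
  refine eq_top_iff.2 fun x _ => ?_
  obtain ⟨y, rfl⟩ := RingQuot.mkAlgHom_surjective 𝕜 (NegRel χ π) x
  induction y using free_left_induction with
  | one => rw [map_one]; exact h1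
  | ι_mul g y hy => rw [map_mul]; exact hg g _ (hy trivial)
  | add a b ha hb => rw [map_add]; exact add_mem (ha trivial) (hb trivial)
  | smul r a ha => rw [map_smul]; exact S.smul_mem r (ha trivial)

theorem posWord_ι_mul (i : Fin l) (x : FreeAlgebra 𝕜 (Fin l)) :
    posWord χ π (FreeAlgebra.ι 𝕜 i * x) = PosBorel.of χ π (.E i) * posWord χ π x := by
  simp [posWord]

theorem negWord_ι_mul (i : Fin l) (x : FreeAlgebra 𝕜 (Fin l)) :
    negWord χ π (FreeAlgebra.ι 𝕜 i * x) = NegBorel.of χ π (.F i) * negWord χ π x := by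
  simp [negWord]

theorem posWord_mul_K_span :
    Submodule.span 𝕜 {z | ∃ x a, z = posWord χ π x * PosBorel.of χ π (.K a)} = ⊤ := by
  refine PosBorel.eq_top_of_stable
    (Submodule.subset_span ⟨1, 0, by rw [map_one, PosBorel.K_zero, one_mul]⟩) fun g x hx => ?_
  induction hx using Submodule.span_induction with
  | zero => rw [mul_zero]; exact zero_mem _
  | add u v _ _ hu hv => rw [mul_add]; exact add_mem hu hv
  | smul r u _ hu => rw [mul_smul_comm]; exact Submodule.smul_mem _ _ hu
  | mem u hu =>
    obtain ⟨x, a, rfl⟩ := hu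
    cases g with
    | E i => exact Submodule.subset_span ⟨FreeAlgebra.ι 𝕜 i * x, a, by simp [posWord, mul_assoc]⟩
    | K b =>
      refine Submodule.subset_span ⟨scale (fun i => χ b (π i)) x, b + a, ?_⟩
      rw [← mul_assoc, posWord, mul_evalWord_of_scale (PosBorel.K_E χ π b), mul_assoc,
        PosBorel.K_add]

theorem negWord_mul_L_span :
    Submodule.span 𝕜 {z | ∃ y a, z = negWord χ π y * NegBorel.of χ π (.L a)} = ⊤ := by
  refine NegBorel.eq_top_of_stable
    (Submodule.subset_span ⟨1, 0, by rw [map_one, NegBorel.L_zero, one_mul]⟩) fun g x hx => ?_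
  induction hx using Submodule.span_induction with
  | zero => rw [mul_zero]; exact zero_mem _
  | add u v _ _ hu hv => rw [mul_add]; exact add_mem hu hv
  | smul r u _ hu => rw [mul_smul_comm]; exact Submodule.smul_mem _ _ hu
  | mem u hu =>
    obtain ⟨x, a, rfl⟩ := hu
    cases g with
    | F i => exact Submodule.subset_span ⟨FreeAlgebra.ι 𝕜 i * x, a, by simp [negWord, mul_assoc]⟩
    | L b =>
      refine Submodule.subset_span ⟨scale (fun i => χ (π i) b) x, b + a, ?_⟩
      rw [← mul_assoc, negWord, mul_evalWord_of_scale (NegBorel.L_F χ π b), mul_assoc,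
        NegBorel.L_add]

/-- The second row of the matrix that defines `ϑ(E_i, ·)` is `(0, ε)`. -/
theorem thetaMatrix_row_one (i : Fin l) (Y : NegBorel χ π) :
    thetaMatrix χ π i Y 1 0 = 0 ∧ thetaMatrix χ π i Y 1 1 = NegBorel.counit χ π Y := by
  induction Y using NegBorel.induction with
  | hof g =>
    cases g with
    | L a => simp [thetaMatrix, NegBorel.counit]
    | F j => by_cases h : i = j <;> simp [thetaMatrix, NegBorel.counit, h]
  | hc r => simp [Matrix.algebraMap_matrix_apply]
  | hmul x y hx hy => simp [Matrix.mul_apply, Fin.sum_univ_two, hx, hy]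
  | hadd x y hx hy => simp [hx, hy]

theorem thetaE_L_mul (i : Fin l) (a : A) (Y : NegBorel χ π) :
    thetaE χ π i (NegBorel.of χ π (.L a) * Y) = (χ (π i) a : 𝕜) * thetaE χ π i Y := by
  simp only [thetaE, LinearMap.comp_apply, AlgHom.toLinearMap_apply, map_mul,
    Matrix.entryLinearMap_apply, Matrix.mul_apply, Fin.sum_univ_two]
  simp [thetaMatrix]

theorem thetaE_F_mul (i j : Fin l) (Y : NegBorel χ π) :
    thetaE χ π i (NegBorel.of χ π (.F j) * Y) = if i = j then NegBorel.counit χ π Y else 0 := by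
  rw [← (thetaMatrix_row_one χ π i Y).2]
  simp only [thetaE, LinearMap.comp_apply, AlgHom.toLinearMap_apply, map_mul,
    Matrix.entryLinearMap_apply, Matrix.mul_apply, Fin.sum_univ_two]
  by_cases h : i = j <;> simp [thetaMatrix, h]

variable {χ π} in
/-- Contraction of the second tensor factor with a functional. -/
def contractRight (g : NegBorel χ π →ₗ[𝕜] 𝕜) :
    NegBorel χ π ⊗[𝕜] NegBorel χ π →ₗ[𝕜] NegBorel χ π :=
  (TensorProduct.rid 𝕜 _).toLinearMap ∘ₗ LinearMap.lTensor _ g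

variable {χ π} in
/-- Contraction of the first tensor factor with a functional. -/
def contractLeft (g : NegBorel χ π →ₗ[𝕜] 𝕜) :
    NegBorel χ π ⊗[𝕜] NegBorel χ π →ₗ[𝕜] NegBorel χ π :=
  (TensorProduct.lid 𝕜 _).toLinearMap ∘ₗ LinearMap.rTensor _ g

variable {χ π} in
@[simp] theorem contractRight_tmul (g : NegBorel χ π →ₗ[𝕜] 𝕜) (x y : NegBorel χ π) :
    contractRight g (x ⊗ₜ y) = g y • x := by simp [contractRight]

variable {χ π} in
@[simp] theorem contractLeft_tmul (g : NegBorel χ π →ₗ[𝕜] 𝕜) (x y : NegBorel χ π) :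
    contractLeft g (x ⊗ₜ y) = g x • y := by simp [contractLeft]

/-- The functional `ϑ(X, ·)`. -/
def thetaFun (X : PosBorel χ π) : NegBorel χ π →ₗ[𝕜] 𝕜 := (thetaHom χ π X).unop.ofConv

theorem thetaFun_apply (X : PosBorel χ π) (Y : NegBorel χ π) :
    thetaFun χ π X Y = theta χ π X Y := rfl

theorem theta_mul_left (X X' : PosBorel χ π) (Y : NegBorel χ π) : theta χ π (X * X') Y =
    LinearMap.mul' 𝕜 𝕜 (TensorProduct.map (thetaFun χ π X') (thetaFun χ π X)
      (NegBorel.comul χ π Y)) := by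
  simp only [theta, map_mul, MulOpposite.unop_mul, LinearMap.convMul_def]
  rfl

theorem thetaFun_E (i : Fin l) : thetaFun χ π (PosBorel.of χ π (.E i)) = thetaE χ π i := by
  simp [thetaFun, thetaHom]

theorem thetaFun_K (a : A) :
    thetaFun χ π (PosBorel.of χ π (.K a)) = (thetaK χ π a).toLinearMap := by
  simp [thetaFun, thetaHom]

theorem theta_E_mul (i : Fin l) (X : PosBorel χ π) (Y : NegBorel χ π) :
    theta χ π (PosBorel.of χ π (.E i) * X) Y =
      theta χ π X (contractRight (thetaE χ π i) (NegBorel.comul χ π Y)) := by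
  rw [theta_mul_left, thetaFun_E, ← thetaFun_apply]
  generalize NegBorel.comul χ π Y = t
  induction t with
  | zero => simp
  | tmul x y => simp [mul_comm]
  | add x y hx hy => simp only [map_add, hx, hy]

theorem theta_mul_K (a : A) (X : PosBorel χ π) (Y : NegBorel χ π) :
    theta χ π (X * PosBorel.of χ π (.K a)) Y =
      theta χ π X (contractLeft (thetaK χ π a).toLinearMap (NegBorel.comul χ π Y)) := by
  rw [theta_mul_left, thetaFun_K, ← thetaFun_apply]
  generalize NegBorel.comul χ π Y = t
  induction t with
  | zero => simp
  | tmul x y => simp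
  | add x y hx hy => simp only [map_add, hx, hy]

theorem theta_one_left (Y : NegBorel χ π) : theta χ π 1 Y = NegBorel.counit χ π Y := by
  simp only [theta, map_one, MulOpposite.unop_one]
  rfl

theorem comul_F_mul (j : Fin l) (Y : NegBorel χ π) :
    NegBorel.comul χ π (NegBorel.of χ π (.F j) * Y) =
      (NegBorel.of χ π (.F j) ⊗ₜ NegBorel.of χ π (.L (π j))) * NegBorel.comul χ π Y +
      (1 ⊗ₜ NegBorel.of χ π (.F j)) * NegBorel.comul χ π Y := by
  rw [map_mul, ← add_mul]
  simp [NegBorel.comul]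

theorem contractRight_counit_comul (Y : NegBorel χ π) :
    contractRight (NegBorel.counit χ π).toLinearMap (NegBorel.comul χ π Y) = Y := by
  exact (congrArg (TensorProduct.rid 𝕜 _) (Coalgebra.lTensor_counit_comul (R := 𝕜) Y)).trans
    ((TensorProduct.rid_tmul Y 1).trans (one_smul 𝕜 Y))

/-- Pairing the second tensor factor of `Δ(y L_b)` with `E_i` applies the left skew derivation to
`y`. -/
theorem contractRight_thetaE_comul (i : Fin l) (y : FreeAlgebra 𝕜 (Fin l)) (b : A) :
    contractRight (thetaE χ π i)
        (NegBorel.comul χ π (negWord χ π y * NegBorel.of χ π (.L b))) =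
      negWord χ π (leftDer (fun i j => χ (π i) (π j)) i y) * NegBorel.of χ π (.L b) := by
  induction y using free_left_induction with
  | one => simp [NegBorel.comul, thetaE, thetaMatrix]
  | ι_mul j y hy =>
    rw [negWord_ι_mul, mul_assoc, leftDer_ι_mul, map_add (negWord χ π), map_smul (negWord χ π),
      negWord_ι_mul, add_mul, smul_mul_assoc, mul_assoc, ← hy, comul_F_mul, map_add, add_comm]
    congr 1
    · trans if i = j then contractRight (NegBorel.counit χ π).toLinearMap
        (NegBorel.comul χ π (negWord χ π y * NegBorel.of χ π (.L b))) else 0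
      · generalize NegBorel.comul χ π (negWord χ π y * NegBorel.of χ π (.L b)) = t
        induction t with
        | zero => simp
        | tmul u v => simp [thetaE_F_mul]
        | add u v hu hv => rw [mul_add, map_add, hu, hv]; split_ifs <;> simp
      · rw [contractRight_counit_comul]; split_ifs <;> simp
    · generalize NegBorel.comul χ π (negWord χ π y * NegBorel.of χ π (.L b)) = t
      induction t with
      | zero => simp
      | tmul u v => simp [thetaE_L_mul, smul_smul]
      | add u v hu hv => rw [mul_add, map_add, hu, hv, map_add, mul_add, smul_add]
  | add x y hx hy => simp only [map_add, add_mul, hx, hy]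
  | smul r x hx => simp only [map_smul, smul_mul_assoc, hx]

theorem contractLeft_thetaK_comul (a : A) (y : FreeAlgebra 𝕜 (Fin l)) (b : A) :
    contractLeft (thetaK χ π a).toLinearMap
        (NegBorel.comul χ π (negWord χ π y * NegBorel.of χ π (.L b))) =
      (χ a b : 𝕜) • (negWord χ π y * NegBorel.of χ π (.L b)) := by
  induction y using free_left_induction with
  | one => simp [NegBorel.comul, thetaK]
  | ι_mul j y hy =>
    have hF : thetaK χ π a (NegBorel.of χ π (.F j)) = 0 := by simp [thetaK]
    rw [negWord_ι_mul, mul_assoc, ← mul_smul_comm, ← hy, comul_F_mul]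
    generalize NegBorel.comul χ π (negWord χ π y * NegBorel.of χ π (.L b)) = t
    induction t with
    | zero => simp
    | tmul u v => simp [hF]
    | add u v hu hv =>
      rw [map_add] at hu hv
      rw [mul_add, mul_add, map_add, map_add, map_add, map_add, mul_add, ← hu, ← hv]
      abel
  | add x y hx hy => simp only [map_add, add_mul, hx, hy, smul_add]
  | smul r x hx => simp only [map_smul, smul_mul_assoc, hx, smul_comm r]

/-- The Drinfeld pairing in terms of the form on words. -/
theorem theta_word (x y : FreeAlgebra 𝕜 (Fin l)) (a b : A) :
    theta χ π (posWord χ π x * PosBorel.of χ π (.K a)) (negWord χ π y * NegBorel.of χ π (.L b)) =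
      (χ a b : 𝕜) * wordForm (fun i j => χ (π i) (π j)) x y := by
  rw [theta_mul_K, contractLeft_thetaK_comul, ← thetaFun_apply, map_smul, smul_eq_mul,
    thetaFun_apply]
  congr 1
  induction x using free_left_induction generalizing y with
  | one =>
    rw [map_one, theta_one_left, wordForm_one_left, map_mul]
    have h2 : (NegBorel.counit χ π).comp (negWord χ π) = wordCounit 𝕜 (Fin l) :=
      FreeAlgebra.hom_ext (funext fun i => by simp [negWord, NegBorel.counit])
    rw [← h2]
    simp [NegBorel.counit]
  | ι_mul i x hx =>
    rw [posWord_ι_mul, theta_E_mul, contractRight_thetaE_comul, hx, wordForm_ι_mul]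
  | add x x' hx hx' =>
    have e : ∀ Y, theta χ π (posWord χ π (x + x')) Y =
        theta χ π (posWord χ π x) Y + theta χ π (posWord χ π x') Y := by simp [theta]
    rw [e, hx, hx', map_add, LinearMap.add_apply]
  | smul r x hx =>
    have e : ∀ Y, theta χ π (posWord χ π (r • x)) Y = r * theta χ π (posWord χ π x) Y := by
      simp [theta]
    rw [e, hx, map_smul, LinearMap.smul_apply, smul_eq_mul]

theorem theta_posWord_negWord (x y : FreeAlgebra 𝕜 (Fin l)) :
    theta χ π (posWord χ π x) (negWord χ π y) = wordForm (fun i j => χ (π i) (π j)) x y := by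
  have h := theta_word χ π x y 0 0
  rwa [PosBorel.K_zero, NegBorel.L_zero, mul_one, mul_one, χ.map_zero_left, Units.val_one,
    one_mul] at h

theorem mem_radPos_iff (x : FreeAlgebra 𝕜 (Fin l)) :
    x ∈ radPos χ π ↔ x ∈ wordRad (flip fun i j => χ (π i) (π j)) := by
  simp only [radPos, Set.mem_ofPred_eq, theta_posWord_negWord, mem_wordRad_flip]

theorem mem_radNeg_iff (y : FreeAlgebra 𝕜 (Fin l)) :
    y ∈ radNeg χ π ↔ y ∈ wordRad (fun i j => χ (π i) (π j)) := by
  simp only [radNeg, Set.mem_ofPred_eq, theta_posWord_negWord, mem_wordRad]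

end Pairing

/-! ### The generalized quantum group as a quantum double -/

section Structure

variable {𝕜 A : Type*} [Field 𝕜] [AddCommGroup A] {l : ℕ} (χ : Bicharacter 𝕜 A) (π : Fin l → A)

/-- The parameters of `U(χ, π)`, with `X = F`, `Y = E`, `H = L`. -/
def datum : DoubleDatum 𝕜 (Fin l) A where
  p i j := χ (π i) (π j)
  root := π
  sH a i := χ (π i) a
  sK a i := χ a (-π i)
  sH_zero := funext fun _ => χ.map_zero_right _
  sK_zero := funext fun _ => χ.map_zero_left _
  sH_add _ _ := funext fun _ => χ.map_add_right _ _ _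
  sK_add _ _ := funext fun _ => χ.map_add_left _ _ _
  sH_root _ _ := rfl
  sK_root _ _ := χ.map_neg_right _ _

theorem U.doubleRel :
    DoubleRel (datum χ π) (U.F χ π) (U.E χ π) (U.L χ π) (U.K χ π) where
  H_zero := by simpa using U.rel (Rel.L_zero (χ := χ) (π := π))
  K_zero := by simpa using U.rel (Rel.K_zero (χ := χ) (π := π))
  H_add a b := by simpa using U.rel (Rel.L_add (χ := χ) (π := π) a b)
  K_add a b := by simpa using U.rel (Rel.K_add (χ := χ) (π := π) a b)
  K_H a b := by simpa using U.rel (Rel.K_L (χ := χ) (π := π) a b)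
  H_X a i := by simpa [datum] using U.rel (Rel.L_F (χ := χ) (π := π) a i)
  K_X a i := by simpa [datum] using U.rel (Rel.K_F (χ := χ) (π := π) a i)
  H_Y a i := by
    simpa [datum, χ.map_neg_left] using U.rel (Rel.L_E (χ := χ) (π := π) a i)
  K_Y a i := by
    simpa [datum, χ.map_neg_right] using U.rel (Rel.K_E (χ := χ) (π := π) a i)
  Y_X i j := by
    have h := U.rel (Rel.E_F (χ := χ) (π := π) i j)
    split_ifs with hij
    · simpa [hij, datum, neg_add_eq_sub] using h
    · simpa [hij] using h

theorem U.evalWord_E_eq_zero {x : FreeAlgebra 𝕜 (Fin l)} (hx : x ∈ wordRad (flip (datum χ π).p)) :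
    evalWord (U.E χ π) x = 0 := by
  have h := U.rel (Rel.radE (χ := χ) (π := π) x ((mem_radPos_iff χ π x).2 hx))
  rw [map_zero, ← AlgHom.comp_apply] at h
  rw [← h]
  congr 1
  exact FreeAlgebra.hom_ext (funext fun i => by simp)

theorem U.evalWord_F_eq_zero {y : FreeAlgebra 𝕜 (Fin l)} (hy : y ∈ wordRad (datum χ π).p) :
    evalWord (U.F χ π) y = 0 := by
  have h := U.rel (Rel.radF (χ := χ) (π := π) y ((mem_radNeg_iff χ π y).2 hy))
  rw [map_zero, ← AlgHom.comp_apply] at h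
  rw [← h]
  congr 1
  exact FreeAlgebra.hom_ext (funext fun i => by simp)

variable {χ π} in
/-- The universal property of `U(χ, π)`. -/
def U.lift {R : Type*} [Ring R] [Algebra 𝕜 R] {X Y : Fin l → R} {H K : A → R}
    (h : DoubleRel (datum χ π) X Y H K) (hX : ∀ y ∈ wordRad (datum χ π).p, evalWord X y = 0)
    (hY : ∀ x ∈ wordRad (flip (datum χ π).p), evalWord Y x = 0) : U χ π →ₐ[𝕜] R :=
  RingQuot.liftAlgHom 𝕜 ⟨FreeAlgebra.lift 𝕜 (fun g => match g with
    | .K a => K a | .L a => H a | .E i => Y i | .F i => X i), by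
    intro x y hxy
    cases hxy with
    | K_zero => simpa using h.K_zero
    | L_zero => simpa using h.H_zero
    | K_add a b => simpa using h.K_add a b
    | L_add a b => simpa using h.H_add a b
    | K_L a b => simpa using h.K_H a b
    | K_E a i => simpa [datum, χ.map_neg_right] using h.K_Y a i
    | L_E a i => simpa [datum, χ.map_neg_left] using h.H_Y a i
    | K_F a i => simpa [datum] using h.K_X a i
    | L_F a i => simpa [datum] using h.H_X a i
    | E_F i j =>
      have h1 := h.Y_X i j
      split_ifs with hij
      · simpa [hij, datum, neg_add_eq_sub] using h1
      · simpa [hij] using h1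
    | radE x hx =>
      rw [map_zero, ← hY x ((mem_radPos_iff χ π x).1 hx), ← AlgHom.comp_apply]
      congr 1
      exact FreeAlgebra.hom_ext (funext fun i => by simp)
    | radF y hy =>
      rw [map_zero, ← hX y ((mem_radNeg_iff χ π y).1 hy), ← AlgHom.comp_apply]
      congr 1
      exact FreeAlgebra.hom_ext (funext fun i => by simp)⟩

theorem map_evalWord {R S : Type*} [Ring R] [Algebra 𝕜 R] [Ring S] [Algebra 𝕜 S] {ι : Type*}
    (φ : R →ₐ[𝕜] S) (X : ι → R) (x : FreeAlgebra 𝕜 ι) :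
    φ (evalWord X x) = evalWord (fun i => φ (X i)) x := by
  rw [← AlgHom.comp_apply]
  congr 1
  exact FreeAlgebra.hom_ext (funext fun i => by simp)

section lift

variable {χ π} {R : Type*} [Ring R] [Algebra 𝕜 R] {X Y : Fin l → R} {H K : A → R}
  (h : DoubleRel (datum χ π) X Y H K) (hX : ∀ y ∈ wordRad (datum χ π).p, evalWord X y = 0)
  (hY : ∀ x ∈ wordRad (flip (datum χ π).p), evalWord Y x = 0)

@[simp] theorem U.lift_K (a : A) : U.lift h hX hY (U.K χ π a) = K a :=
  (RingQuot.liftAlgHom_mkAlgHom_apply ..).trans (by simp)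

@[simp] theorem U.lift_L (a : A) : U.lift h hX hY (U.L χ π a) = H a :=
  (RingQuot.liftAlgHom_mkAlgHom_apply ..).trans (by simp)

@[simp] theorem U.lift_E (i : Fin l) : U.lift h hX hY (U.E χ π i) = Y i :=
  (RingQuot.liftAlgHom_mkAlgHom_apply ..).trans (by simp)

@[simp] theorem U.lift_F (i : Fin l) : U.lift h hX hY (U.F χ π i) = X i :=
  (RingQuot.liftAlgHom_mkAlgHom_apply ..).trans (by simp)

@[simp] theorem U.lift_evalWord_E (x : FreeAlgebra 𝕜 (Fin l)) :
    U.lift h hX hY (evalWord (U.E χ π) x) = evalWord Y x :=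
  (map_evalWord _ _ x).trans (by simp)

@[simp] theorem U.lift_evalWord_F (x : FreeAlgebra 𝕜 (Fin l)) :
    U.lift h hX hY (evalWord (U.F χ π) x) = evalWord X x :=
  (map_evalWord _ _ x).trans (by simp)

end lift

variable {χ π} in
/-- A submodule that contains `1` and is stable under left multiplication by the generators is all
of `U`. -/
theorem U.eq_top_of_stable {S : Submodule 𝕜 (U χ π)} (h1 : 1 ∈ S)
    (hg : ∀ g, ∀ x ∈ S, U.of χ π g * x ∈ S) : S = ⊤ := by
  refine eq_top_iff.2 fun x _ => ?_
  obtain ⟨y, rfl⟩ := RingQuot.mkAlgHom_surjective 𝕜 (Rel χ π) x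
  induction y using free_left_induction with
  | one => rw [map_one]; exact h1
  | ι_mul g y hy => rw [map_mul]; exact hg g _ (hy trivial)
  | add a b ha hb => rw [map_add]; exact add_mem (ha trivial) (hb trivial)
  | smul r a ha => rw [map_smul]; exact S.smul_mem r (ha trivial)

/-- `U = U^- U^0 U^+`. -/
theorem U.orderedSpan_FE : orderedSpan 𝕜 (U.F χ π) (U.E χ π) (U.L χ π) (U.K χ π) = ⊤ := by
  have h := U.doubleRel χ π
  refine U.eq_top_of_stable (Submodule.subset_span ⟨1, 0, 1, 0, ?_⟩) fun g x hx => ?_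
  · simp [h.H_zero, h.K_zero]
  · refine h.mul_mem_orderedSpan ?_ hx
    cases g with
    | K a => exact Or.inr (Or.inr (Or.inr ⟨a, rfl⟩))
    | L a => exact Or.inr (Or.inr (Or.inl ⟨a, rfl⟩))
    | E i => exact Or.inr (Or.inl ⟨i, rfl⟩)
    | F i => exact Or.inl ⟨i, rfl⟩

/-- `U = U^+ U^0 U^-`. -/
theorem U.orderedSpan_EF : orderedSpan 𝕜 (U.E χ π) (U.F χ π) (U.K χ π) (U.L χ π) = ⊤ := by
  have h := (U.doubleRel χ π).swap
  refine U.eq_top_of_stable (Submodule.subset_span ⟨1, 0, 1, 0, ?_⟩) fun g x hx => ?_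
  · simp [h.H_zero, h.K_zero]
  · refine h.mul_mem_orderedSpan ?_ hx
    cases g with
    | K a => exact Or.inr (Or.inr (Or.inl ⟨a, rfl⟩))
    | L a => exact Or.inr (Or.inr (Or.inr ⟨a, rfl⟩))
    | E i => exact Or.inl ⟨i, rfl⟩
    | F i => exact Or.inr (Or.inl ⟨i, rfl⟩)

/-- The coordinates of an element of `U` with respect to `U = U^- U^0 U^+`: its action on the unit
vector of the regular representation. -/
def U.coordFE : U χ π →ₗ[𝕜] RegSpace (datum χ π) :=
  LinearMap.applyₗ (ordered (datum χ π) 0 1 1) ∘ₗ (U.lift (regular_doubleRel (datum χ π))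
    (fun _ hy => evalWord_regX_eq_zero _ hy) (fun _ hx => evalWord_regY_eq_zero _ hx)).toLinearMap

/-- The coordinates of an element of `U` with respect to `U = U^+ U^0 U^-`. -/
def U.coordEF : U χ π →ₗ[𝕜] RegSpace (datum χ π).swap :=
  LinearMap.applyₗ (ordered (datum χ π).swap 0 1 1) ∘ₗ
    (U.lift (regular_doubleRel (datum χ π).swap).of_swap
      (fun _ hy => evalWord_regY_eq_zero (datum χ π).swap hy)
      (fun _ hx => evalWord_regX_eq_zero (datum χ π).swap hx)).toLinearMap

theorem U.coordFE_apply (y x : FreeAlgebra 𝕜 (Fin l)) (a b : A) :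
    U.coordFE χ π (evalWord (U.F χ π) y * U.L χ π a * evalWord (U.E χ π) x * U.K χ π b) =
      ordered (datum χ π) (a, b) y x := by
  rw [← regular_ordered_product]
  simp only [U.coordFE, LinearMap.comp_apply, AlgHom.toLinearMap_apply, map_mul,
    U.lift_evalWord_E, U.lift_evalWord_F, U.lift_L, U.lift_K]
  rfl

theorem U.coordEF_apply (x y : FreeAlgebra 𝕜 (Fin l)) (a b : A) :
    U.coordEF χ π (evalWord (U.E χ π) x * U.K χ π a * evalWord (U.F χ π) y * U.L χ π b) =
      ordered (datum χ π).swap (a, b) x y := by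
  rw [← regular_ordered_product]
  simp only [U.coordEF, LinearMap.comp_apply, AlgHom.toLinearMap_apply, map_mul,
    U.lift_evalWord_E, U.lift_evalWord_F, U.lift_L, U.lift_K]
  rfl

theorem U.coordFE_injective : Function.Injective (U.coordFE χ π) := by
  -- the multiplication map is a left inverse
  refine Function.LeftInverse.injective (g := orderedProduct (U.F χ π) (U.E χ π) (U.L χ π)
    (U.K χ π) (fun _ hy => U.evalWord_F_eq_zero χ π hy)
    (fun _ hx => U.evalWord_E_eq_zero χ π hx)) fun u => ?_
  refine DFunLike.congr_fun (f := orderedProduct _ _ _ _ _ _ ∘ₗ U.coordFE χ π)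
    (g := LinearMap.id) (LinearMap.ext_on (U.orderedSpan_FE χ π) ?_) u
  rintro _ ⟨y, a, x, b, rfl⟩
  rw [LinearMap.comp_apply, U.coordFE_apply, orderedProduct_ordered, LinearMap.id_apply]

theorem U.coordEF_surjective : Function.Surjective (U.coordEF χ π) := by
  rw [← LinearMap.range_eq_top, eq_top_iff, ← span_ordered, Submodule.span_le]
  rintro _ ⟨g, x, y, rfl⟩
  exact ⟨_, U.coordEF_apply χ π x y g.1 g.2⟩

/-! ### The Harish-Chandra projection -/

theorem U.mem_neg_iff (Y : U χ π) :
    Y ∈ U.neg χ π ↔ ∃ y : FreeAlgebra 𝕜 (Fin l), evalWord (U.F χ π) y = Y := by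
  rw [U.neg, Algebra.adjoin_range_eq_range_freeAlgebra_lift, AlgHom.mem_range]

theorem U.mem_pos_iff (X : U χ π) :
    X ∈ U.pos χ π ↔ ∃ x : FreeAlgebra 𝕜 (Fin l), evalWord (U.E χ π) x = X := by
  rw [U.pos, Algebra.adjoin_range_eq_range_freeAlgebra_lift, AlgHom.mem_range]

theorem U.counit_evalWord_F (y : FreeAlgebra 𝕜 (Fin l)) :
    U.counit χ π (evalWord (U.F χ π) y) = wordCounit 𝕜 (Fin l) y := by
  rw [map_evalWord]
  congr 1
  exact FreeAlgebra.hom_ext (funext fun i => by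
    rw [Function.comp_apply, FreeAlgebra.lift_ι_apply, Function.comp_apply, wordCounit_ι]
    exact (RingQuot.liftAlgHom_mkAlgHom_apply ..).trans (by simp))

theorem U.counit_evalWord_E (y : FreeAlgebra 𝕜 (Fin l)) :
    U.counit χ π (evalWord (U.E χ π) y) = wordCounit 𝕜 (Fin l) y := by
  rw [map_evalWord]
  congr 1
  exact FreeAlgebra.hom_ext (funext fun i => by
    rw [Function.comp_apply, FreeAlgebra.lift_ι_apply, Function.comp_apply, wordCounit_ι]
    exact (RingQuot.liftAlgHom_mkAlgHom_apply ..).trans (by simp))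

/-- The counit of the quotient of the free algebra by the kernel of the form. -/
def quotCounit {ι : Type*} [DecidableEq ι] (p : ι → ι → 𝕜ˣ) : WordQuot p →ₗ[𝕜] 𝕜 :=
  Submodule.liftQ _ (wordCounit 𝕜 ι).toLinearMap fun y hy => by
    simpa using mem_wordRad.1 hy 1

/-- The Harish-Chandra projection. -/
def U.harishChandra : U χ π →ₗ[𝕜] U χ π :=
  (TensorProduct.lid 𝕜 _).toLinearMap ∘ₗ
    TensorProduct.map (quotCounit _) ((TensorProduct.lid 𝕜 _).toLinearMap ∘ₗ
      TensorProduct.map (quotCounit _)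
        (Finsupp.linearCombination 𝕜 fun g : A × A => U.L χ π g.1 * U.K χ π g.2)) ∘ₗ
    U.coordFE χ π

theorem U.harishChandra_apply (y x : FreeAlgebra 𝕜 (Fin l)) (a b : A) :
    U.harishChandra χ π
        (evalWord (U.F χ π) y * U.L χ π a * evalWord (U.E χ π) x * U.K χ π b) =
      (wordCounit 𝕜 (Fin l) y * wordCounit 𝕜 (Fin l) x) • (U.K χ π b * U.L χ π a) := by
  simp only [U.harishChandra, LinearMap.comp_apply, U.coordFE_apply, ordered_apply]
  simp [quotCounit, smul_smul, (U.doubleRel χ π).K_H, mul_comm]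

/-- In `U.harishChandra_apply` the factor `K_b` stands to the right of `E(x)`; moving it to the left
scales `x`, which the counit does not see. -/
theorem U.isHarishChandra : U.IsHarishChandra χ π (U.harishChandra χ π) := by
  intro Y hY X hX a b
  obtain ⟨y, rfl⟩ := (U.mem_neg_iff χ π Y).1 hY
  obtain ⟨x, rfl⟩ := (U.mem_pos_iff χ π X).1 hX
  have h := U.doubleRel χ π
  rw [h.K_H, ← mul_assoc, mul_assoc _ (U.K χ π a), h.K_evalY, ← mul_assoc,
    U.harishChandra_apply, U.counit_evalWord_E, U.counit_evalWord_F, wordCounit_scale, h.K_H]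

variable {χ π} in
theorem U.IsHarishChandra.eq {Sh : U χ π →ₗ[𝕜] U χ π} (hSh : U.IsHarishChandra χ π Sh) :
    Sh = U.harishChandra χ π := by
  refine LinearMap.ext_on (U.orderedSpan_FE χ π) ?_
  rintro _ ⟨y, a, x, b, rfl⟩
  have h := U.doubleRel χ π
  have e : evalWord (U.F χ π) y * U.L χ π a * evalWord (U.E χ π) x * U.K χ π b =
      evalWord (U.F χ π) y * (U.K χ π b * U.L χ π a) *
        evalWord (U.E χ π) (scale ((datum χ π).sK b) x) := by
    have h1 := h.K_evalY b (scale ((datum χ π).sK b) x)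
    rw [scale_scale, inv_mul_cancel, scale_one] at h1
    rw [mul_assoc, ← h1, h.K_H]
    simp only [mul_assoc]
  have hF := (U.mem_neg_iff χ π _).2 ⟨y, rfl⟩
  have hE := (U.mem_pos_iff χ π _).2 ⟨scale ((datum χ π).sK b) x, rfl⟩
  rw [e, hSh _ hF _ hE, U.isHarishChandra χ π _ hF _ hE]

end Structure

/-! ### The map `Ω` -/

section Tensor

variable {𝕜 M N M' N' : Type*} [Field 𝕜] [AddCommGroup M] [Module 𝕜 M] [AddCommGroup N]
  [Module 𝕜 N] [AddCommGroup M'] [Module 𝕜 M'] [AddCommGroup N'] [Module 𝕜 N']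

/-- The tensor product of two bilinear pairings. -/
def tensorPairing (β : M →ₗ[𝕜] N →ₗ[𝕜] 𝕜) (γ : M' →ₗ[𝕜] N' →ₗ[𝕜] 𝕜) :
    M ⊗[𝕜] M' →ₗ[𝕜] N ⊗[𝕜] N' →ₗ[𝕜] 𝕜 :=
  TensorProduct.dualDistrib 𝕜 N N' ∘ₗ TensorProduct.map β γ

@[simp] theorem tensorPairing_tmul (β : M →ₗ[𝕜] N →ₗ[𝕜] 𝕜) (γ : M' →ₗ[𝕜] N' →ₗ[𝕜] 𝕜)
    (m : M) (m' : M') (n : N) (n' : N') :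
    tensorPairing β γ (m ⊗ₜ m') (n ⊗ₜ n') = β m n * γ m' n' := rfl

theorem tensorPairing_injective {β : M →ₗ[𝕜] N →ₗ[𝕜] 𝕜} {γ : M' →ₗ[𝕜] N' →ₗ[𝕜] 𝕜}
    (hβ : Function.Injective β) (hγ : Function.Injective γ) :
    Function.Injective (tensorPairing β γ) := by
  rw [injective_iff_map_eq_zero]
  intro t ht
  -- contracting `t` with `γ · n'` gives an element of `M` that is killed by `β`
  have h1 : ∀ n', TensorProduct.rid 𝕜 M (LinearMap.lTensor M (γ.flip n') t) = 0 := by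
    intro n'
    refine (injective_iff_map_eq_zero β).1 hβ _ (LinearMap.ext fun n => ?_)
    refine Eq.trans ?_ (DFunLike.congr_fun ht (n ⊗ₜ[𝕜] n'))
    clear ht
    induction t with
    | zero => simp
    | tmul x y => simp [mul_comm]
    | add x y hx hy => simp only [map_add, LinearMap.add_apply, hx, hy]
  classical
  let b := Module.Basis.ofVectorSpace 𝕜 M
  have h2 : ∀ i, TensorProduct.lid 𝕜 M' (LinearMap.rTensor M' (b.coord i) t) = 0 := by
    intro i
    refine (injective_iff_map_eq_zero γ).1 hγ _ (LinearMap.ext fun n' => ?_)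
    rw [LinearMap.zero_apply, ← map_zero (b.coord i), ← h1 n']
    clear ht h1
    induction t with
    | zero => simp
    | tmul x y => simp [mul_comm]
    | add x y hx hy => simp only [map_add, LinearMap.add_apply, hx, hy]
  refine (TensorProduct.equivFinsuppOfBasisLeft b).injective ?_
  rw [map_zero]
  ext i
  rw [Finsupp.zero_apply, ← h2 i]
  clear ht h1 h2
  induction t with
  | zero => simp
  | tmul x y => simp
  | add x y hx hy => simp only [map_add, Finsupp.add_apply, hx, hy]

end Tensor

section QuotPairing

variable {𝕜 ι : Type*} [Field 𝕜] [DecidableEq ι] (p : ι → ι → 𝕜ˣ)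

/-- The form on words, as a pairing of the quotients by its right and left kernels. -/
def quotPairing : WordQuot p →ₗ[𝕜] WordQuot (flip p) →ₗ[𝕜] 𝕜 :=
  Submodule.liftQ _ (LinearMap.flip (Submodule.liftQ _ (wordForm p) fun x hx =>
    LinearMap.ext fun y => mem_wordRad_flip.1 hx y)) fun y hy => LinearMap.ext fun x => by
      induction x using Submodule.Quotient.induction_on with
      | _ x => exact mem_wordRad.1 hy x

theorem quotPairing_injective : Function.Injective (quotPairing p) := by
  rw [injective_iff_map_eq_zero]
  intro y hy
  induction y using Submodule.Quotient.induction_on with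
  | _ y =>
    rw [Submodule.Quotient.mk_eq_zero, mem_wordRad]
    exact fun x => DFunLike.congr_fun hy ((wordRad (flip p)).mkQ x)

theorem quotPairing_flip_injective : Function.Injective (quotPairing p).flip := by
  rw [injective_iff_map_eq_zero]
  intro x hx
  induction x using Submodule.Quotient.induction_on with
  | _ x =>
    rw [Submodule.Quotient.mk_eq_zero, mem_wordRad_flip]
    exact fun y => DFunLike.congr_fun hx ((wordRad p).mkQ y)

end QuotPairing

section Omega

variable {𝕜 A : Type*} [Field 𝕜] [AddCommGroup A] {l : ℕ} (χ : Bicharacter 𝕜 A) (π : Fin l → A)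

/-- The pairing of group algebras with `((a, b), (c, d)) ↦ χ(c, a) χ(b, d)`. -/
def torusPairing : (A × A →₀ 𝕜) →ₗ[𝕜] (A × A →₀ 𝕜) →ₗ[𝕜] 𝕜 :=
  Finsupp.linearCombination 𝕜 fun g =>
    Finsupp.linearCombination 𝕜 fun h => (χ h.1 g.1 * χ g.2 h.2 : 𝕜)

@[simp] theorem torusPairing_single (g h : A × A) :
    torusPairing χ (Finsupp.single g 1) (Finsupp.single h 1) = χ h.1 g.1 * χ g.2 h.2 := by
  simp [torusPairing]

/-- If `χ` separates the points of `A` on both sides, then the torus pairing is nondegenerate, by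
the linear independence of characters. -/
theorem torusPairing_injective (h1 : ∀ a, (∀ b, χ b a = 1) → a = 0)
    (h2 : ∀ a, (∀ b, χ a b = 1) → a = 0) : Function.Injective (torusPairing χ) := by
  let f : A × A → (Multiplicative (A × A) →* 𝕜) := fun g =>
    { toFun := fun h => (χ h.toAdd.1 g.1 * χ g.2 h.toAdd.2 : 𝕜ˣ)
      map_one' := by simp [χ.map_zero_left, χ.map_zero_right]
      map_mul' := fun x y => by
        simp [χ.map_add_left, χ.map_add_right, mul_mul_mul_comm] }
  have hf : Function.Injective f := by
    intro g g' h
    have h3 : ∀ c d, χ c g.1 * χ g.2 d = χ c g'.1 * χ g'.2 d := fun c d =>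
      Units.ext (DFunLike.congr_fun h (Multiplicative.ofAdd (c, d)))
    refine Prod.ext (sub_eq_zero.1 (h1 _ fun b => ?_)) (sub_eq_zero.1 (h2 _ fun b => ?_))
    · have h4 := h3 b 0
      rw [χ.map_zero_right, χ.map_zero_right, mul_one, mul_one] at h4
      rw [sub_eq_add_neg, χ.map_add_right, χ.map_neg_right, h4, mul_inv_cancel]
    · have h4 := h3 0 b
      rw [χ.map_zero_left, χ.map_zero_left, one_mul, one_mul] at h4
      rw [sub_eq_add_neg, χ.map_add_left, χ.map_neg_left, h4, mul_inv_cancel]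
  have hli := (linearIndependent_monoidHom (Multiplicative (A × A)) 𝕜).comp f hf
  rw [injective_iff_map_eq_zero]
  intro t ht
  refine (linearIndependent_iff.1 hli) t (funext fun h => ?_)
  have h3 := DFunLike.congr_fun ht (Finsupp.single h.toAdd 1)
  refine Eq.trans ?_ h3
  clear ht h3
  induction t using Finsupp.induction_linear with
  | zero => simp
  | add a b ha hb => simp only [map_add, LinearMap.add_apply, Pi.add_apply, ha, hb]
  | single g r => simp [torusPairing, f]

/-- The pairing of the coordinate spaces that defines `Ω`. -/
def coordPairing : RegSpace (datum χ π) →ₗ[𝕜] RegSpace (datum χ π).swap →ₗ[𝕜] 𝕜 :=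
  tensorPairing (quotPairing (datum χ π).p)
    (tensorPairing (quotPairing (datum χ π).p).flip (torusPairing χ))

/-- The map `Ω : U → U^*`, the argument `z` taken in coordinates for `U = U^- U^0 U^+` and the
argument of `Ω(z)` in coordinates for `U = U^+ U^0 U^-`. -/
def U.omega : U χ π →ₗ[𝕜] Module.Dual 𝕜 (U χ π) :=
  (coordPairing χ π).compl₁₂ (U.coordFE χ π) (U.coordEF χ π)

variable {χ π} in
theorem U.omega_injective (h1 : ∀ a, (∀ b, χ b a = 1) → a = 0)
    (h2 : ∀ a, (∀ b, χ a b = 1) → a = 0) : Function.Injective (U.omega χ π) := by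
  rw [injective_iff_map_eq_zero]
  intro u hu
  refine (injective_iff_map_eq_zero _).1 (U.coordFE_injective χ π) _ ?_
  refine (injective_iff_map_eq_zero (coordPairing χ π)).1 (tensorPairing_injective
    (quotPairing_injective _) (tensorPairing_injective (quotPairing_flip_injective _)
      (torusPairing_injective χ h1 h2))) _ (LinearMap.ext fun m => ?_)
  obtain ⟨w, rfl⟩ := U.coordEF_surjective χ π m
  exact DFunLike.congr_fun hu w

theorem U.omega_apply (y x x' y' : FreeAlgebra 𝕜 (Fin l)) (d c a b : A) :
    U.omega χ π (evalWord (U.F χ π) y * U.L χ π d * evalWord (U.E χ π) x * U.K χ π c)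
        (evalWord (U.E χ π) x' * U.K χ π a * evalWord (U.F χ π) y' * U.L χ π b) =
      wordForm (datum χ π).p x' y * (wordForm (datum χ π).p x y' * (χ a d * χ c b)) := by
  rw [U.omega, LinearMap.compl₁₂_apply, U.coordFE_apply, U.coordEF_apply]
  refine (tensorPairing_tmul _ _ _ _ _ _).trans (congrArg₂ _ rfl ?_)
  refine (tensorPairing_tmul _ _ _ _ _ _).trans (congrArg₂ _ rfl ?_)
  exact torusPairing_single χ _ _

theorem U.ofPos_word (x : FreeAlgebra 𝕜 (Fin l)) (a : A) :
    U.ofPos χ π (posWord χ π x * PosBorel.of χ π (.K a)) =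
      evalWord (U.E χ π) x * U.K χ π a := by
  rw [map_mul, posWord, map_evalWord]
  simp [U.ofPos]

theorem U.ofNeg_word (y : FreeAlgebra 𝕜 (Fin l)) (a : A) :
    U.ofNeg χ π (negWord χ π y * NegBorel.of χ π (.L a)) =
      evalWord (U.F χ π) y * U.L χ π a := by
  rw [map_mul, negWord, map_evalWord]
  simp [U.ofNeg]

theorem U.isOmega : U.IsOmega χ π (U.omega χ π) := by
  intro a₁ a₂ b₁ b₂
  -- the claim is linear in each argument, so words suffice
  have ha₁ := (posWord_mul_K_span χ π).ge (Submodule.mem_top (x := a₁))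
  have ha₂ := (posWord_mul_K_span χ π).ge (Submodule.mem_top (x := a₂))
  have hb₁ := (negWord_mul_L_span χ π).ge (Submodule.mem_top (x := b₁))
  have hb₂ := (negWord_mul_L_span χ π).ge (Submodule.mem_top (x := b₂))
  simp only [← thetaFun_apply]
  have tadd : ∀ X X', thetaFun χ π (X + X') = thetaFun χ π X + thetaFun χ π X' := fun X X' => by
    simp [thetaFun]
  have tsmul : ∀ (r : 𝕜) X, thetaFun χ π (r • X) = r • thetaFun χ π X := fun r X => by
    simp [thetaFun]
  have tzero : thetaFun χ π 0 = 0 := by simp [thetaFun]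
  induction ha₁ using Submodule.span_induction with
  | zero => simp [tzero]
  | add u v _ _ hu hv => simp only [map_add, add_mul, hu, hv, tadd, LinearMap.add_apply]
  | smul r u _ hu =>
    simp only [map_smul, smul_mul_assoc, hu, tsmul, LinearMap.smul_apply]
  | mem _ hu =>
    obtain ⟨x', a, rfl⟩ := hu
    induction ha₂ using Submodule.span_induction with
    | zero => simp [tzero]
    | add u v _ _ hu hv => simp only [map_add, mul_add, hu, hv, tadd, LinearMap.add_apply]
    | smul r u _ hu =>
      simp only [map_smul, mul_smul_comm, hu, tsmul, LinearMap.smul_apply]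
    | mem _ hu =>
      obtain ⟨x, c, rfl⟩ := hu
      induction hb₁ using Submodule.span_induction with
      | zero => simp
      | add u v _ _ hu hv => simp only [map_add, mul_add, hu, hv]
      | smul r u _ hu =>
        simp only [map_smul, mul_smul_comm, hu]
      | mem _ hu =>
        obtain ⟨y', b, rfl⟩ := hu
        induction hb₂ using Submodule.span_induction with
        | zero => simp
        | add u v _ _ hu hv => simp only [map_add, add_mul, hu, hv, LinearMap.add_apply]
        | smul r u _ hu =>
          simp only [map_smul, smul_mul_assoc, hu, LinearMap.smul_apply]
        | mem _ hu =>
          obtain ⟨y, d, rfl⟩ := hu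
          simp only [thetaFun_apply, U.ofPos_word, U.ofNeg_word, ← mul_assoc, U.omega_apply,
            theta_word]
          simp only [datum]
          ring

variable {χ π} in
theorem U.IsOmega.eq {Ω : U χ π →ₗ[𝕜] Module.Dual 𝕜 (U χ π)} (hΩ : U.IsOmega χ π Ω) :
    Ω = U.omega χ π := by
  refine LinearMap.ext_on (U.orderedSpan_FE χ π) ?_
  rintro _ ⟨y, d, x, c, rfl⟩
  refine LinearMap.ext_on (U.orderedSpan_EF χ π) ?_
  rintro _ ⟨x', a, y', b, rfl⟩
  rw [mul_assoc _ (evalWord (U.E χ π) x), mul_assoc _ (evalWord (U.F χ π) y'), ← U.ofPos_word,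
    ← U.ofPos_word, ← U.ofNeg_word, ← U.ofNeg_word, hΩ, U.isOmega]

end Omega

/-! ### Centrality from the trace property -/

section Center

variable {𝕜 A : Type*} [Field 𝕜] [AddCommGroup A] {l : ℕ} (χ : Bicharacter 𝕜 A) (π : Fin l → A)

/-- The ordered product `E(x) K_a F(y) L_b`. -/
def U.wordEF (x : FreeAlgebra 𝕜 (Fin l)) (a : A) (y : FreeAlgebra 𝕜 (Fin l)) (b : A) : U χ π :=
  evalWord (U.E χ π) x * U.K χ π a * evalWord (U.F χ π) y * U.L χ π b

/-- The ordered product `F(y) L_a E(x) K_b`. -/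
def U.wordFE (y : FreeAlgebra 𝕜 (Fin l)) (a : A) (x : FreeAlgebra 𝕜 (Fin l)) (b : A) : U χ π :=
  evalWord (U.F χ π) y * U.L χ π a * evalWord (U.E χ π) x * U.K χ π b

theorem U.omega_wordFE_wordEF (y x x' y' : FreeAlgebra 𝕜 (Fin l)) (d c a b : A) :
    U.omega χ π (U.wordFE χ π y d x c) (U.wordEF χ π x' a y' b) =
      wordForm (datum χ π).p x' y * (wordForm (datum χ π).p x y' * (χ a d * χ c b)) :=
  U.omega_apply χ π y x x' y' d c a b

variable {χ π} in
theorem U.wordFE_induction {P : U χ π → Prop} (word : ∀ y d x c, P (U.wordFE χ π y d x c))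
    (add : ∀ u v, P u → P v → P (u + v)) (smul : ∀ (r : 𝕜) u, P u → P (r • u)) (z : U χ π) :
    P z := by
  induction (U.orderedSpan_FE χ π).ge (Submodule.mem_top (x := z))
    using Submodule.span_induction with
  | zero => simpa using smul 0 _ (word 1 0 1 0)
  | add u v _ _ hu hv => exact add u v hu hv
  | smul r u _ hu => exact smul r u hu
  | mem u hu =>
    obtain ⟨y, d, x, c, rfl⟩ := hu
    exact word y d x c

variable {χ π} in
theorem U.linearMap_ext_wordEF {P : Type*} [AddCommGroup P] [Module 𝕜 P] {φ ψ : U χ π →ₗ[𝕜] P}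
    (h : ∀ x a y b, φ (U.wordEF χ π x a y b) = ψ (U.wordEF χ π x a y b)) : φ = ψ := by
  refine LinearMap.ext_on (U.orderedSpan_EF χ π) ?_
  rintro _ ⟨y, d, x, c, rfl⟩
  exact h y d x c

theorem U.K_mul_E (a : A) (i : Fin l) :
    U.K χ π a * U.E χ π i = (χ a (π i) : 𝕜) • (U.E χ π i * U.K χ π a) := by
  simpa using U.rel (Rel.K_E (χ := χ) (π := π) a i)

theorem U.E_mul_L (a : A) (i : Fin l) :
    U.E χ π i * U.L χ π a = (χ (π i) a : 𝕜) • (U.L χ π a * U.E χ π i) := by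
  rw [(U.doubleRel χ π).H_Y, smul_smul]
  simp [datum]

theorem U.L_mul_F (a : A) (i : Fin l) :
    U.L χ π a * U.F χ π i = (χ (π i) a : 𝕜) • (U.F χ π i * U.L χ π a) :=
  (U.doubleRel χ π).H_X a i

theorem U.K_mul_F (a : A) (i : Fin l) :
    U.K χ π a * U.F χ π i = (χ a (-π i) : 𝕜) • (U.F χ π i * U.K χ π a) :=
  (U.doubleRel χ π).K_X a i

theorem U.F_mul_K (a : A) (i : Fin l) :
    U.F χ π i * U.K χ π a = (χ a (π i) : 𝕜) • (U.K χ π a * U.F χ π i) := by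
  rw [U.K_mul_F, smul_smul, χ.map_neg_right]
  simp

theorem U.wordFE_mul_E (y : FreeAlgebra 𝕜 (Fin l)) (d : A) (x : FreeAlgebra 𝕜 (Fin l)) (c : A)
    (i : Fin l) : U.wordFE χ π y d x c * U.E χ π i =
      (χ c (π i) : 𝕜) • U.wordFE χ π y d (x * FreeAlgebra.ι 𝕜 i) c := by
  rw [U.wordFE, U.wordFE, mul_assoc, U.K_mul_E, map_mul, FreeAlgebra.lift_ι_apply]
  simp only [mul_smul_comm, mul_assoc]

theorem U.E_mul_wordFE (i : Fin l) (y : FreeAlgebra 𝕜 (Fin l)) (d : A)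
    (x : FreeAlgebra 𝕜 (Fin l)) (c : A) : U.E χ π i * U.wordFE χ π y d x c =
      (χ (π i) d : 𝕜) • U.wordFE χ π y d (FreeAlgebra.ι 𝕜 i * x) c +
      U.wordFE χ π (rightDer (datum χ π).p i y) (π i + d) x c -
      U.wordFE χ π (scale ((datum χ π).sK (π i)) (leftDer (datum χ π).p i y)) d
        (scale ((datum χ π).sK (π i))⁻¹ x) (π i + c) :=
  (U.doubleRel χ π).Y_mul_ordered i y d x c

theorem U.F_mul_wordFE (i : Fin l) (y : FreeAlgebra 𝕜 (Fin l)) (d : A)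
    (x : FreeAlgebra 𝕜 (Fin l)) (c : A) : U.F χ π i * U.wordFE χ π y d x c =
      U.wordFE χ π (FreeAlgebra.ι 𝕜 i * y) d x c := by
  simp [U.wordFE, mul_assoc]

theorem U.wordFE_mul_F (y : FreeAlgebra 𝕜 (Fin l)) (d : A) (x : FreeAlgebra 𝕜 (Fin l)) (c : A)
    (i : Fin l) : U.wordFE χ π y d x c * U.F χ π i =
      (χ c (-π i) : 𝕜) • ((χ (π i) d : 𝕜) • U.wordFE χ π (y * FreeAlgebra.ι 𝕜 i) d x c +
        U.wordFE χ π y (d + π i) (leftDer (flip (datum χ π).p) i x) c -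
        U.wordFE χ π y d (rightDer (flip (datum χ π).p) i x) (π i + c)) := by
  have h := U.doubleRel χ π
  have h1 := h.evalY_X i x
  simp only [U.wordFE]
  rw [mul_assoc, U.K_mul_F, mul_smul_comm, ← mul_assoc, mul_assoc _ (evalWord (U.E χ π) x), h1,
    ← h.H_add, ← h.K_add, map_mul, FreeAlgebra.lift_ι_apply]
  simp only [mul_sub, sub_mul, mul_add, add_mul, ← mul_assoc]
  rw [mul_assoc _ (U.L χ π d) (U.F χ π i), U.L_mul_F]
  simp only [mul_smul_comm, smul_mul_assoc, mul_assoc]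
  rfl

/-- The adjoint under `Ω` of right multiplication by `E_i`, on ordered products. -/
theorem U.omega_mul_E (z : U χ π) (i : Fin l) (x' : FreeAlgebra 𝕜 (Fin l)) (a : A)
    (y' : FreeAlgebra 𝕜 (Fin l)) (b : A) :
    U.omega χ π (z * U.E χ π i) (U.wordEF χ π x' a y' b) =
      U.omega χ π z (U.wordEF χ π x' a (rightDer (datum χ π).p i y') (b + π i)) := by
  induction z using U.wordFE_induction with
  | word y d x c =>
    simp only [U.wordFE_mul_E, map_smul, LinearMap.smul_apply, U.omega_wordFE_wordEF,
      wordForm_mul_ι, χ.map_add_right, Units.val_mul, smul_eq_mul]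
    ring
  | add u v hu hv => simp only [add_mul, map_add, LinearMap.add_apply, hu, hv]
  | smul r u hu =>
    simp only [smul_mul_assoc, map_smul, LinearMap.smul_apply, hu]

/-- The adjoint under `Ω` of left multiplication by `E_i`, on ordered products. -/
theorem U.omega_E_mul (z : U χ π) (i : Fin l) (x' : FreeAlgebra 𝕜 (Fin l)) (a : A)
    (y' : FreeAlgebra 𝕜 (Fin l)) (b : A) :
    U.omega χ π (U.E χ π i * z) (U.wordEF χ π x' a y' b) =
      U.omega χ π z ((χ a (π i) : 𝕜) • U.wordEF χ π (x' * FreeAlgebra.ι 𝕜 i) a y' b +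
        U.wordEF χ π x' (a + π i) (leftDer (datum χ π).p i y') b -
        (χ (π i) b : 𝕜) • U.wordEF χ π (FreeAlgebra.ι 𝕜 i * scale ((datum χ π).sK (π i)) x') a
          (scale ((datum χ π).sK (π i))⁻¹ y') b) := by
  induction z using U.wordFE_induction with
  | word y d x c =>
    simp only [U.E_mul_wordFE, map_add, map_sub, map_smul, LinearMap.add_apply, LinearMap.sub_apply,
      LinearMap.smul_apply, U.omega_wordFE_wordEF, wordForm_mul_ι, wordForm_ι_mul, wordForm_scale,
      χ.map_add_right, χ.map_add_left, Units.val_mul, smul_eq_mul]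
    ring
  | add u v hu hv => simp only [mul_add, map_add, LinearMap.add_apply, hu, hv]
  | smul r u hu =>
    simp only [mul_smul_comm, map_smul, LinearMap.smul_apply, hu]

/-- The adjoint under `Ω` of left multiplication by `F_i`, on ordered products. -/
theorem U.omega_F_mul (z : U χ π) (i : Fin l) (x' : FreeAlgebra 𝕜 (Fin l)) (a : A)
    (y' : FreeAlgebra 𝕜 (Fin l)) (b : A) :
    U.omega χ π (U.F χ π i * z) (U.wordEF χ π x' a y' b) =
      U.omega χ π z (U.wordEF χ π (leftDer (flip (datum χ π).p) i x') a y' b) := by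
  induction z using U.wordFE_induction with
  | word y d x c =>
    simp only [U.F_mul_wordFE, U.omega_wordFE_wordEF, wordForm_apply_ι_mul]
  | add u v hu hv => simp only [mul_add, map_add, LinearMap.add_apply, hu, hv]
  | smul r u hu =>
    simp only [mul_smul_comm, map_smul, LinearMap.smul_apply, hu]

/-- The adjoint under `Ω` of right multiplication by `F_i`, on ordered products. -/
theorem U.omega_mul_F (z : U χ π) (i : Fin l) (x' : FreeAlgebra 𝕜 (Fin l)) (a : A)
    (y' : FreeAlgebra 𝕜 (Fin l)) (b : A) :
    U.omega χ π (z * U.F χ π i) (U.wordEF χ π x' a y' b) =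
      U.omega χ π z (U.wordEF χ π (rightDer (flip (datum χ π).p) i x') (a + π i) y' (b + -π i) +
        (χ a (π i) : 𝕜) • U.wordEF χ π x' a (FreeAlgebra.ι 𝕜 i * y') (b + -π i) -
        (χ (π i) b : 𝕜) • U.wordEF χ π x' a (y' * FreeAlgebra.ι 𝕜 i) (b + -π i)) := by
  induction z using U.wordFE_induction with
  | word y d x c =>
    simp only [U.wordFE_mul_F, map_add, map_sub, map_smul, LinearMap.add_apply, LinearMap.sub_apply,
      LinearMap.smul_apply, U.omega_wordFE_wordEF, wordForm_apply_mul_ι, wordForm_apply_ι_mul,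
      χ.map_add_right, χ.map_add_left, Units.val_mul, smul_eq_mul]
    ring
  | add u v hu hv => simp only [add_mul, map_add, LinearMap.add_apply, hu, hv]
  | smul r u hu =>
    simp only [smul_mul_assoc, map_smul, LinearMap.smul_apply, hu]

/-- Moving `E_i` from the right of `E(x) K_a F(y) L_b` into ordered position. -/
theorem U.wordEF_mul_E (i : Fin l) (x : FreeAlgebra 𝕜 (Fin l)) (a : A)
    (y : FreeAlgebra 𝕜 (Fin l)) (b : A) :
    (χ (π i) b : 𝕜) • (U.wordEF χ π x a y b * U.E χ π i) =
      (χ a (π i) : 𝕜) • U.wordEF χ π (x * FreeAlgebra.ι 𝕜 i) a y b +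
        U.wordEF χ π x (a + π i) (leftDer (datum χ π).p i y) b -
        U.wordEF χ π x a (rightDer (datum χ π).p i y) (b + π i) := by
  have h := U.doubleRel χ π
  have h1 : evalWord (U.F χ π) y * U.E χ π i = U.E χ π i * evalWord (U.F χ π) y +
      U.K χ π (π i) * evalWord (U.F χ π) (leftDer (datum χ π).p i y) -
      evalWord (U.F χ π) (rightDer (datum χ π).p i y) * U.L χ π (π i) := by
    rw [h.Y_evalX]
    simp only [datum]
    abel
  have h2 : (χ (π i) b : 𝕜) • (U.wordEF χ π x a y b * U.E χ π i) =
      evalWord (U.E χ π) x * U.K χ π a * (evalWord (U.F χ π) y * U.E χ π i) * U.L χ π b := by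
    simp only [U.wordEF, mul_assoc, U.E_mul_L, mul_smul_comm]
  rw [h2, h1]
  simp only [U.wordEF, ← h.K_add, add_comm b, ← h.H_add, map_mul,
    FreeAlgebra.lift_ι_apply, mul_sub, sub_mul, mul_add, add_mul]
  simp only [← mul_assoc]
  rw [mul_assoc _ (U.K χ π a) (U.E χ π i), U.K_mul_E]
  simp only [mul_smul_comm, smul_mul_assoc, mul_assoc]

/-- Moving `F_i` from the left of `E(x) K_a F(y)` into ordered position. -/
theorem U.F_mul_wordEF (i : Fin l) (x : FreeAlgebra 𝕜 (Fin l)) (a : A)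
    (y : FreeAlgebra 𝕜 (Fin l)) (b : A) :
    U.wordEF χ π (rightDer (flip (datum χ π).p) i x) (a + π i) y (b + -π i) +
        (χ a (π i) : 𝕜) • U.wordEF χ π x a (FreeAlgebra.ι 𝕜 i * y) (b + -π i) =
      (U.F χ π i * U.wordEF χ π x a y b +
        U.L χ π (π i) * U.wordEF χ π (leftDer (flip (datum χ π).p) i x) a y b) *
        U.L χ π (-π i) := by
  have h := U.doubleRel χ π
  have h1 : U.F χ π i * evalWord (U.E χ π) x + U.L χ π (π i) *
      evalWord (U.E χ π) (leftDer (flip (datum χ π).p) i x) =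
      evalWord (U.E χ π) x * U.F χ π i +
      evalWord (U.E χ π) (rightDer (flip (datum χ π).p) i x) * U.K χ π (π i) := by
    rw [h.evalY_X]
    simp only [datum]
    abel
  have h2 : (U.F χ π i * U.wordEF χ π x a y b +
        U.L χ π (π i) * U.wordEF χ π (leftDer (flip (datum χ π).p) i x) a y b) * U.L χ π (-π i) =
      (U.F χ π i * evalWord (U.E χ π) x + U.L χ π (π i) *
        evalWord (U.E χ π) (leftDer (flip (datum χ π).p) i x)) * U.K χ π a *
          evalWord (U.F χ π) y * U.L χ π b * U.L χ π (-π i) := by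
    simp only [U.wordEF, mul_assoc, add_mul]
  rw [h2, h1]
  simp only [U.wordEF, add_comm a, ← h.K_add, ← h.H_add, map_mul,
    FreeAlgebra.lift_ι_apply, add_mul]
  rw [mul_assoc _ (U.F χ π i) (U.K χ π a), U.F_mul_K]
  simp only [mul_smul_comm, smul_mul_assoc, mul_assoc, add_comm]

theorem U.wordEF_mul_F (i : Fin l) (x : FreeAlgebra 𝕜 (Fin l)) (a : A)
    (y : FreeAlgebra 𝕜 (Fin l)) (b : A) :
    (χ (π i) b : 𝕜) • U.wordEF χ π x a (y * FreeAlgebra.ι 𝕜 i) (b + -π i) =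
      U.wordEF χ π x a y b * U.F χ π i * U.L χ π (-π i) := by
  have h := U.doubleRel χ π
  simp only [U.wordEF, mul_assoc, ← h.H_add, map_mul, FreeAlgebra.lift_ι_apply]
  rw [← mul_assoc (U.L χ π b) (U.F χ π i), U.L_mul_F]
  simp only [mul_smul_comm, smul_mul_assoc, mul_assoc]

theorem U.wordEF_mul_K (x : FreeAlgebra 𝕜 (Fin l)) (a : A)
    (y : FreeAlgebra 𝕜 (Fin l)) (b c : A) :
    U.wordEF χ π x a y b * U.K χ π c = U.K χ π c *
      U.wordEF χ π (scale ((datum χ π).sK c) x) a (scale ((datum χ π).sK c)⁻¹ y) b := by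
  have h := U.doubleRel χ π
  have hE := h.K_evalY c (scale ((datum χ π).sK c) x)
  have hF := h.K_evalX c (scale ((datum χ π).sK c)⁻¹ y)
  rw [scale_scale, inv_mul_cancel, scale_one] at hE
  rw [scale_scale, mul_inv_cancel, scale_one] at hF
  simp only [U.wordEF, ← mul_assoc]
  rw [hE, mul_assoc _ (U.K χ π c), h.K_add, add_comm, ← h.K_add, ← mul_assoc,
    mul_assoc _ (U.K χ π c), hF, ← mul_assoc, mul_assoc _ (U.K χ π c), h.K_H, ← mul_assoc]

variable {χ π}

/-- A functional on `U` with the commutation properties of the twisted trace. -/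
structure IsTraceLike (f : Module.Dual 𝕜 (U χ π)) : Prop where
  mul_E : ∀ i u, f (u * U.E χ π i) = χ (π i) (π i) * f (U.E χ π i * u)
  F_mul : ∀ i u, f (U.F χ π i * u) = χ (π i) (π i) * f (u * U.F χ π i)
  mul_K : ∀ a u, f (u * U.K χ π a) = f (U.K χ π a * u)
  mul_L : ∀ a u, f (u * U.L χ π a) = f (U.L χ π a * u)

/-- If `Ω(z)` is a twisted trace, then `z` commutes with `E_i`. -/
theorem IsTraceLike.E_comm (hinj : Function.Injective (U.omega χ π)) {z : U χ π}
    (hz : IsTraceLike (U.omega χ π z)) (i : Fin l) : U.E χ π i * z = z * U.E χ π i := by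
  have h := U.doubleRel χ π
  refine hinj (U.linearMap_ext_wordEF fun x a y b => ?_)
  -- `w'` is the conjugate of the ordered product `u` by `K_{α_i}`; by the trace property `Ω(z)`
  -- takes the same value on `E_i w'` and on `u E_i`
  set w' := U.wordEF χ π (scale ((datum χ π).sK (π i)) x) a
    (scale ((datum χ π).sK (π i))⁻¹ y) b with hw'
  have e1 : U.wordEF χ π (FreeAlgebra.ι 𝕜 i * scale ((datum χ π).sK (π i)) x) a
      (scale ((datum χ π).sK (π i))⁻¹ y) b = U.E χ π i * w' := by
    simp [hw', U.wordEF, mul_assoc]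
  have e2 : U.omega χ π z (U.E χ π i * w') =
      U.omega χ π z (U.wordEF χ π x a y b * U.E χ π i) := by
    refine mul_left_cancel₀ (Units.ne_zero (χ (π i) (π i))) ?_
    have e3 : w' * U.E χ π i = U.K χ π (-π i) * (U.wordEF χ π x a y b * U.K χ π (π i)) *
        U.E χ π i := by
      rw [U.wordEF_mul_K, ← mul_assoc, h.K_add, neg_add_cancel, h.K_zero, one_mul]
    rw [← hz.mul_E, e3, mul_assoc, ← hz.mul_K, mul_assoc, mul_assoc,
      ← mul_assoc (U.K χ π (π i)), U.K_mul_E, smul_mul_assoc, mul_assoc (U.E χ π i), h.K_add,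
      add_neg_cancel, h.K_zero, mul_one, mul_smul_comm, map_smul, smul_eq_mul]
  have e4 := congrArg (U.omega χ π z) (U.wordEF_mul_E χ π i x a y b)
  rw [U.omega_mul_E, U.omega_E_mul, e1]
  simp only [map_sub, map_add, map_smul] at e4 ⊢
  rw [e2, e4]
  abel

/-- If `Ω(z)` is a twisted trace, then `z` commutes with `F_i`. -/
theorem IsTraceLike.F_comm (hinj : Function.Injective (U.omega χ π)) {z : U χ π}
    (hz : IsTraceLike (U.omega χ π z)) (i : Fin l) : U.F χ π i * z = z * U.F χ π i := by
  have h := U.doubleRel χ π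
  refine hinj (U.linearMap_ext_wordEF fun x a y b => ?_)
  -- both sides are values of `Ω(z)`, at elements that agree up to the trace property
  rw [U.omega_mul_F, U.omega_F_mul, U.F_mul_wordEF, U.wordEF_mul_F, add_mul, map_sub, map_add]
  have e1 : ∀ u, U.omega χ π z (U.L χ π (π i) * u * U.L χ π (-π i)) = U.omega χ π z u := by
    intro u
    rw [hz.mul_L, ← mul_assoc, h.H_add, neg_add_cancel, h.H_zero, one_mul]
  have e2 : U.omega χ π z (U.F χ π i * U.wordEF χ π x a y b * U.L χ π (-π i)) =
      U.omega χ π z (U.wordEF χ π x a y b * U.F χ π i * U.L χ π (-π i)) := by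
    rw [mul_assoc, hz.F_mul, mul_assoc, U.L_mul_F, mul_smul_comm, map_smul, smul_eq_mul,
      ← mul_assoc, χ.map_neg_right, Units.mul_inv, one_mul, mul_assoc]
  rw [e1, e2]
  abel

variable (χ π)

theorem U.K_mul_homog {c : A} {X : U χ π} (hX : X ∈ U.homog χ π c) (a : A) :
    U.K χ π a * X = (χ a c : 𝕜) • (X * U.K χ π a) := by
  have h := U.doubleRel χ π
  induction hX using Submodule.span_induction with
  | zero => simp
  | add u v _ _ hu hv => rw [mul_add, hu, hv, add_mul, smul_add]
  | smul r u _ hu => rw [mul_smul_comm, hu, smul_mul_assoc, smul_comm]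
  | mem u hu =>
    obtain ⟨w, rfl, rfl⟩ := hu
    induction w with
    | nil => simp [χ.map_zero_right]
    | cons g w ih =>
      have hg : U.K χ π a * U.of χ π g =
          (χ a (U.genDegree π g) : 𝕜) • (U.of χ π g * U.K χ π a) := by
        cases g with
        | K b => simp [U.genDegree, χ.map_zero_right, h.K_add, add_comm]
        | L b => simp [U.genDegree, χ.map_zero_right, h.K_H]
        | E i => exact U.K_mul_E χ π a i
        | F i => exact U.K_mul_F χ π a i
      rw [List.map_cons, List.map_cons, List.prod_cons, List.sum_cons, ← mul_assoc, hg,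
        smul_mul_assoc, mul_assoc, ih, χ.map_add_right, Units.val_mul, mul_smul_comm, smul_smul,
        mul_assoc]

theorem U.L_mul_homog {c : A} {X : U χ π} (hX : X ∈ U.homog χ π c) (a : A) :
    U.L χ π a * X = (χ (-c) a : 𝕜) • (X * U.L χ π a) := by
  have h := U.doubleRel χ π
  induction hX using Submodule.span_induction with
  | zero => simp
  | add u v _ _ hu hv => rw [mul_add, hu, hv, add_mul, smul_add]
  | smul r u _ hu => rw [mul_smul_comm, hu, smul_mul_assoc, smul_comm]
  | mem u hu =>
    obtain ⟨w, rfl, rfl⟩ := hu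
    induction w with
    | nil => simp [χ.map_zero_left]
    | cons g w ih =>
      have hg : U.L χ π a * U.of χ π g =
          (χ (-U.genDegree π g) a : 𝕜) • (U.of χ π g * U.L χ π a) := by
        cases g with
        | K b => simp [U.genDegree, χ.map_zero_left, h.K_H]
        | L b => simp [U.genDegree, χ.map_zero_left, h.H_add, add_comm]
        | E i => simpa [U.genDegree] using U.rel (Rel.L_E (χ := χ) (π := π) a i)
        | F i => rw [U.genDegree, neg_neg]; exact U.L_mul_F χ π a i
      rw [List.map_cons, List.map_cons, List.prod_cons, List.sum_cons, ← mul_assoc, hg,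
        smul_mul_assoc, mul_assoc, ih, neg_add, χ.map_add_left, Units.val_mul, mul_smul_comm,
        smul_smul, mul_assoc]

variable {χ π}

/-- If `Ω(z)` is a twisted trace and `z` has degree `0`, then `z` is central. -/
theorem IsTraceLike.mem_skewCenter (hinj : Function.Injective (U.omega χ π)) {z : U χ π}
    (hz : IsTraceLike (U.omega χ π z)) (h0 : z ∈ U.homog χ π 0) :
    z ∈ U.skewCenter χ π 1 := by
  refine ⟨h0, fun a X _ => ?_⟩
  rw [MonoidHom.one_apply, Units.val_one, one_smul]
  have hg : ∀ g, U.of χ π g * z = z * U.of χ π g := by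
    intro g
    cases g with
    | K b => simpa [χ.map_zero_right] using U.K_mul_homog χ π h0 b
    | L b => simpa [χ.map_zero_left] using U.L_mul_homog χ π h0 b
    | E i => exact hz.E_comm hinj i
    | F i => exact hz.F_comm hinj i
  have htop : LinearMap.ker (LinearMap.mulLeft 𝕜 z - LinearMap.mulRight 𝕜 z) = ⊤ := by
    refine U.eq_top_of_stable (by simp) fun g x hx => ?_
    rw [LinearMap.mem_ker, LinearMap.sub_apply, LinearMap.mulLeft_apply, LinearMap.mulRight_apply,
      sub_eq_zero] at hx ⊢
    rw [mul_assoc, ← hx, ← mul_assoc, ← mul_assoc, hg]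
  have hX := htop.ge (Submodule.mem_top (x := X))
  rwa [LinearMap.mem_ker, LinearMap.sub_apply, LinearMap.mulLeft_apply, LinearMap.mulRight_apply,
    sub_eq_zero] at hX

end Center

/-! ### Degrees of words -/

section Degree

variable {𝕜 ι : Type*} [Field 𝕜] [DecidableEq ι]

/-- The degree of a word: the numbers of occurrences of the letters, as integers. -/
def wordDeg (w : List ι) : ι → ℤ := (w.map fun i => Pi.single i 1).sum

omit [Field 𝕜] in
theorem wordDeg_cons (i : ι) (w : List ι) : wordDeg (i :: w) = Pi.single i 1 + wordDeg w := by
  simp [wordDeg]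

theorem wordDeg_nonneg (w : List ι) (i : ι) : 0 ≤ wordDeg w i := by
  induction w with
  | nil => simp [wordDeg]
  | cons j w ih =>
    rw [wordDeg_cons, Pi.add_apply]
    refine add_nonneg ?_ ih
    rw [Pi.single_apply]
    split_ifs <;> simp

/-- The component of degree `n` of the free algebra. -/
def wordSpan (𝕜 : Type*) [Field 𝕜] (n : ι → ℤ) : Submodule 𝕜 (FreeAlgebra 𝕜 ι) :=
  Submodule.span 𝕜 {x | ∃ w : List ι, wordDeg w = n ∧ x = (w.map (FreeAlgebra.ι 𝕜)).prod}

theorem one_mem_wordSpan : (1 : FreeAlgebra 𝕜 ι) ∈ wordSpan 𝕜 (0 : ι → ℤ) :=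
  Submodule.subset_span ⟨[], rfl, rfl⟩

theorem ι_mul_mem_wordSpan (i : ι) {n : ι → ℤ} {x : FreeAlgebra 𝕜 ι} (hx : x ∈ wordSpan 𝕜 n) :
    FreeAlgebra.ι 𝕜 i * x ∈ wordSpan 𝕜 (Pi.single i 1 + n) := by
  induction hx using Submodule.span_induction with
  | zero => rw [mul_zero]; exact zero_mem _
  | add u v _ _ hu hv => rw [mul_add]; exact add_mem hu hv
  | smul r u _ hu => rw [mul_smul_comm]; exact Submodule.smul_mem _ _ hu
  | mem u hu =>
    obtain ⟨w, rfl, rfl⟩ := hu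
    exact Submodule.subset_span ⟨i :: w, wordDeg_cons i w, by simp⟩

theorem iSup_wordSpan : ⨆ n : ι → ℤ, wordSpan 𝕜 n = ⊤ := by
  refine eq_top_iff.2 fun x _ => ?_
  induction x using free_left_induction with
  | one => exact Submodule.mem_iSup_of_mem 0 one_mem_wordSpan
  | add x y hx hy => exact add_mem (hx trivial) (hy trivial)
  | smul r x hx => exact Submodule.smul_mem _ r (hx trivial)
  | ι_mul i x hx =>
    have h : ⨆ n : ι → ℤ, wordSpan 𝕜 n ≤ (⨆ n : ι → ℤ, wordSpan 𝕜 n).comap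
        (LinearMap.mulLeft 𝕜 (FreeAlgebra.ι 𝕜 i)) := iSup_le fun n x hx =>
      Submodule.mem_iSup_of_mem _ (ι_mul_mem_wordSpan i hx)
    exact h (hx trivial)

theorem linearMap_ext_wordSpan {P : Type*} [AddCommGroup P] [Module 𝕜 P]
    {φ ψ : FreeAlgebra 𝕜 ι →ₗ[𝕜] P} (h : ∀ n : ι → ℤ, ∀ x ∈ wordSpan 𝕜 n, φ x = ψ x) : φ = ψ := by
  rw [← sub_eq_zero, ← LinearMap.ker_eq_top, eq_top_iff, ← iSup_wordSpan]
  refine iSup_le fun n x hx => ?_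
  rw [LinearMap.mem_ker, LinearMap.sub_apply, h n x hx, sub_self]

theorem wordCounit_eq_zero {n : ι → ℤ} (hn : n ≠ 0) {x : FreeAlgebra 𝕜 ι}
    (hx : x ∈ wordSpan 𝕜 n) : wordCounit 𝕜 ι x = 0 := by
  induction hx using Submodule.span_induction with
  | zero => rw [map_zero]
  | add u v _ _ hu hv => rw [map_add, hu, hv, add_zero]
  | smul r u _ hu => rw [map_smul, hu, smul_zero]
  | mem u hu =>
    obtain ⟨w, rfl, rfl⟩ := hu
    cases w with
    | nil => exact absurd rfl hn
    | cons i w => simp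

theorem leftDer_mem_wordSpan (p : ι → ι → 𝕜ˣ) (i : ι) {n : ι → ℤ} {x : FreeAlgebra 𝕜 ι}
    (hx : x ∈ wordSpan 𝕜 n) : leftDer p i x ∈ wordSpan 𝕜 (n - Pi.single i 1) := by
  induction hx using Submodule.span_induction with
  | zero => rw [map_zero]; exact zero_mem _
  | add u v _ _ hu hv => rw [map_add]; exact add_mem hu hv
  | smul r u _ hu => rw [map_smul]; exact Submodule.smul_mem _ _ hu
  | mem u hu =>
    obtain ⟨w, rfl, rfl⟩ := hu
    induction w with
    | nil => rw [List.map_nil, List.prod_nil, leftDer_one]; exact zero_mem _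
    | cons j w ih =>
      rw [List.map_cons, List.prod_cons, leftDer_ι_mul, wordDeg_cons]
      refine add_mem ?_ (Submodule.smul_mem _ _ ?_)
      · split_ifs with h
        · subst h
          rw [add_sub_cancel_left]
          exact Submodule.subset_span ⟨w, rfl, rfl⟩
        · exact zero_mem _
      · rw [add_sub_assoc]
        exact ι_mul_mem_wordSpan j ih

/-- Components of different degrees are orthogonal. -/
theorem wordForm_eq_zero_of_ne (p : ι → ι → 𝕜ˣ) {m n : ι → ℤ} (hmn : m ≠ n)
    {x y : FreeAlgebra 𝕜 ι} (hx : x ∈ wordSpan 𝕜 m) (hy : y ∈ wordSpan 𝕜 n) :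
    wordForm p x y = 0 := by
  induction hx using Submodule.span_induction with
  | zero => rw [map_zero, LinearMap.zero_apply]
  | add u v _ _ hu hv => rw [map_add, LinearMap.add_apply, hu, hv, add_zero]
  | smul r u _ hu => rw [map_smul, LinearMap.smul_apply, hu, smul_zero]
  | mem u hu =>
    obtain ⟨w, rfl, rfl⟩ := hu
    induction w generalizing n y with
    | nil =>
      rw [List.map_nil, List.prod_nil, wordForm_one_left]
      exact wordCounit_eq_zero (Ne.symm hmn) hy
    | cons i w ih =>
      rw [List.map_cons, List.prod_cons, wordForm_ι_mul]
      refine ih (leftDer_mem_wordSpan p i hy) (fun h => hmn ?_)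
      rw [wordDeg_cons, h, add_sub_cancel]

theorem sum_wordDeg [Fintype ι] (w : List ι) : ∑ i, wordDeg w i = w.length := by
  induction w with
  | nil => simp [wordDeg]
  | cons j w ih =>
    simp only [wordDeg_cons, Pi.add_apply, Finset.sum_add_distrib, ih]
    simp [add_comm]

theorem finiteDimensional_wordSpan [Fintype ι] (n : ι → ℤ) :
    FiniteDimensional 𝕜 (wordSpan 𝕜 n) := by
  refine FiniteDimensional.span_of_finite 𝕜 (Set.Finite.subset
    ((List.finite_length_eq ι (∑ i, n i).toNat).image
      fun w => (w.map (FreeAlgebra.ι 𝕜)).prod) ?_)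
  rintro _ ⟨w, rfl, rfl⟩
  exact ⟨w, by simp [sum_wordDeg], rfl⟩

/-- A functional on the free algebra that is supported in a single degree and vanishes on the left
kernel of the form is represented by an element of that degree: in each degree the form is a pairing
of finite-dimensional spaces. -/
theorem exists_wordForm_eq [Fintype ι] (p : ι → ι → 𝕜ˣ) (n : ι → ℤ)
    (φ : FreeAlgebra 𝕜 ι →ₗ[𝕜] 𝕜) (hφ : ∀ x ∈ wordRad (flip p), φ x = 0)
    (hn : ∀ m, m ≠ n → ∀ x ∈ wordSpan 𝕜 m, φ x = 0) :
    ∃ y ∈ wordSpan 𝕜 n, ∀ x, wordForm p x y = φ x := by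
  have := finiteDimensional_wordSpan (𝕜 := 𝕜) n
  let β : wordSpan 𝕜 n →ₗ[𝕜] Module.Dual 𝕜 (wordSpan 𝕜 n) :=
    (wordForm p).compl₁₂ (wordSpan 𝕜 n).subtype (wordSpan 𝕜 n).subtype
  have hker : φ ∘ₗ (wordSpan 𝕜 n).subtype ∈ (LinearMap.ker β).dualAnnihilator := by
    rw [Submodule.mem_dualAnnihilator]
    rintro ⟨x, hx⟩ hxβ
    refine hφ x (mem_wordRad_flip.2 fun y => ?_)
    refine DFunLike.congr_fun (f := wordForm p x) (g := 0)
      (linearMap_ext_wordSpan fun m y hy => ?_) y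
    by_cases hm : n = m
    · subst hm
      exact DFunLike.congr_fun (LinearMap.mem_ker.1 hxβ) ⟨y, hy⟩
    · exact wordForm_eq_zero_of_ne p hm hx hy
  rw [← LinearMap.range_dualMap_eq_dualAnnihilator_ker] at hker
  obtain ⟨ψ, hψ⟩ := hker
  obtain ⟨y, rfl⟩ := (Module.bijective_dual_eval 𝕜 (wordSpan 𝕜 n)).surjective ψ
  refine ⟨y, y.2, fun x => ?_⟩
  refine DFunLike.congr_fun (f := (wordForm p).flip y) (g := φ)
    (linearMap_ext_wordSpan fun m x hx => ?_) x
  by_cases hm : m = n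
  · subst hm
    exact DFunLike.congr_fun hψ ⟨x, hx⟩
  · rw [hn m hm x hx]
    exact wordForm_eq_zero_of_ne p hm hx y.2

theorem exists_wordForm_eq_right [Fintype ι] (p : ι → ι → 𝕜ˣ) (n : ι → ℤ)
    (φ : FreeAlgebra 𝕜 ι →ₗ[𝕜] 𝕜) (hφ : ∀ y ∈ wordRad p, φ y = 0)
    (hn : ∀ m, m ≠ n → ∀ y ∈ wordSpan 𝕜 m, φ y = 0) :
    ∃ x ∈ wordSpan 𝕜 n, ∀ y, wordForm p x y = φ y := by
  obtain ⟨x, hx, h⟩ := exists_wordForm_eq (flip p) n φ hφ hn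
  exact ⟨x, hx, fun y => by rw [← wordForm_flip, h]⟩

end Degree

/-! ### Weight spaces and the twist of a highest weight module -/

section Module

variable {𝕜 A : Type*} [Field 𝕜] [AddCommGroup A] {l : ℕ} (χ : Bicharacter 𝕜 A) (π : Fin l → A)

/-- The element `∑ n_i α_i` of the root lattice, for integers `n_i`. -/
def intRoot : (Fin l → ℤ) →ₗ[ℤ] A := Fintype.linearCombination ℤ π

theorem intRoot_single (i : Fin l) : intRoot π (Pi.single i 1) = π i := by
  rw [intRoot, Fintype.linearCombination_apply_single, one_smul]

theorem intRoot_natCast (n : Fin l → ℕ) : intRoot π (fun i => (n i : ℤ)) = posRoot π n := by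
  simp [intRoot, Fintype.linearCombination_apply, posRoot]

/-- The extension of `rhoHat` to the root lattice. -/
def intRhoHat (n : Fin l → ℤ) : 𝕜ˣ := ∏ i, χ (π i) (π i) ^ n i

theorem intRhoHat_add (m n : Fin l → ℤ) :
    intRhoHat χ π (m + n) = intRhoHat χ π m * intRhoHat χ π n := by
  simp [intRhoHat, zpow_add, Finset.prod_mul_distrib]

theorem intRhoHat_single (i : Fin l) : intRhoHat χ π (Pi.single i 1) = χ (π i) (π i) := by
  rw [intRhoHat, Finset.prod_eq_single i]
  · simp
  · intro j _ hj; simp [hj]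
  · simp

theorem intRhoHat_neg (n : Fin l → ℤ) : intRhoHat χ π (-n) = (intRhoHat χ π n)⁻¹ := by
  simp [intRhoHat]

theorem intRhoHat_natCast (n : Fin l → ℕ) :
    intRhoHat χ π (fun i => (n i : ℤ)) = rhoHat χ π n := by
  simp [intRhoHat, rhoHat]

variable {π} in
theorem mul_mem_homog {a b : A} {X Y : U χ π} (hX : X ∈ U.homog χ π a) (hY : Y ∈ U.homog χ π b) :
    X * Y ∈ U.homog χ π (a + b) := by
  induction hX using Submodule.span_induction with
  | zero => rw [zero_mul]; exact zero_mem _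
  | add u v _ _ hu hv => rw [add_mul]; exact add_mem hu hv
  | smul r u _ hu => rw [smul_mul_assoc]; exact Submodule.smul_mem _ _ hu
  | mem u hu =>
    obtain ⟨w, rfl, rfl⟩ := hu
    induction hY using Submodule.span_induction with
    | zero => rw [mul_zero]; exact zero_mem _
    | add u v _ _ hu hv => rw [mul_add]; exact add_mem hu hv
    | smul r u _ hu => rw [mul_smul_comm]; exact Submodule.smul_mem _ _ hu
    | mem u hu =>
      obtain ⟨w', rfl, rfl⟩ := hu
      exact Submodule.subset_span ⟨w ++ w', by simp, by simp⟩

theorem of_mem_homog (g : Gen A l) : U.of χ π g ∈ U.homog χ π (U.genDegree π g) :=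
  Submodule.subset_span ⟨[g], by simp, by simp⟩

theorem evalWord_E_mem_homog {n : Fin l → ℤ} {x : FreeAlgebra 𝕜 (Fin l)} (hx : x ∈ wordSpan 𝕜 n) :
    evalWord (U.E χ π) x ∈ U.homog χ π (intRoot π n) := by
  induction hx using Submodule.span_induction with
  | zero => rw [map_zero]; exact zero_mem _
  | add u v _ _ hu hv => rw [map_add]; exact add_mem hu hv
  | smul r u _ hu => rw [map_smul]; exact Submodule.smul_mem _ _ hu
  | mem u hu =>
    obtain ⟨w, rfl, rfl⟩ := hu
    induction w with
    | nil => exact Submodule.subset_span ⟨[], by simp [wordDeg], by simp⟩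
    | cons i w ih =>
      rw [wordDeg_cons, map_add, intRoot_single, List.map_cons, List.prod_cons, map_mul,
        FreeAlgebra.lift_ι_apply]
      exact mul_mem_homog χ (of_mem_homog χ π (.E i)) ih

theorem evalWord_F_mem_homog {n : Fin l → ℤ} {y : FreeAlgebra 𝕜 (Fin l)} (hy : y ∈ wordSpan 𝕜 n) :
    evalWord (U.F χ π) y ∈ U.homog χ π (-intRoot π n) := by
  induction hy using Submodule.span_induction with
  | zero => rw [map_zero]; exact zero_mem _
  | add u v _ _ hu hv => rw [map_add]; exact add_mem hu hv
  | smul r u _ hu => rw [map_smul]; exact Submodule.smul_mem _ _ hu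
  | mem u hu =>
    obtain ⟨w, rfl, rfl⟩ := hu
    induction w with
    | nil => exact Submodule.subset_span ⟨[], by simp [wordDeg], by simp⟩
    | cons i w ih =>
      rw [wordDeg_cons, map_add, intRoot_single, neg_add, List.map_cons, List.prod_cons, map_mul,
        FreeAlgebra.lift_ι_apply]
      exact mul_mem_homog χ (of_mem_homog χ π (.F i)) ih

variable {χ π} {V : Type*} [AddCommGroup V] [Module 𝕜 V] (ρ : U χ π →ₐ[𝕜] Module.End 𝕜 V)
  (lam mu : A)

/-- The weight space on which `K_a L_b` acts by `χ(lam + ν, b) χ(a, mu - ν)`, `ν = ∑ n_i α_i`. -/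
def weightSpace (n : Fin l → ℤ) : Submodule 𝕜 V where
  carrier := {u | ∀ a b, ρ (U.K χ π a * U.L χ π b) u =
    (χ (lam + intRoot π n) b * χ a (mu - intRoot π n) : 𝕜) • u}
  add_mem' hu hv a b := by rw [map_add, hu, hv, smul_add]
  zero_mem' a b := by rw [map_zero, smul_zero]
  smul_mem' r u hu a b := by rw [map_smul, hu, smul_comm]

variable {ρ lam mu}

theorem mem_weightSpace {n : Fin l → ℤ} {u : V} : u ∈ weightSpace ρ lam mu n ↔
    ∀ a b, ρ (U.K χ π a * U.L χ π b) u =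
      (χ (lam + intRoot π n) b * χ a (mu - intRoot π n) : 𝕜) • u := Iff.rfl

theorem K_apply_weightSpace {n : Fin l → ℤ} {u : V} (hu : u ∈ weightSpace ρ lam mu n) (a : A) :
    ρ (U.K χ π a) u = (χ a (mu - intRoot π n) : 𝕜) • u := by
  have h := mem_weightSpace.1 hu a 0
  rwa [(U.doubleRel χ π).H_zero, mul_one, χ.map_zero_right, Units.val_one, one_mul] at h

theorem L_apply_weightSpace {n : Fin l → ℤ} {u : V} (hu : u ∈ weightSpace ρ lam mu n) (b : A) :
    ρ (U.L χ π b) u = (χ (lam + intRoot π n) b : 𝕜) • u := by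
  have h := mem_weightSpace.1 hu 0 b
  rwa [(U.doubleRel χ π).K_zero, one_mul, χ.map_zero_left, Units.val_one, mul_one] at h

/-- An element of degree `-ν` lowers weights by `ν`. -/
theorem homog_apply_mem_weightSpace {m n : Fin l → ℤ} {X : U χ π}
    (hX : X ∈ U.homog χ π (-intRoot π m)) {u : V} (hu : u ∈ weightSpace ρ lam mu n) :
    ρ X u ∈ weightSpace ρ lam mu (n + m) := by
  intro a b
  have h : U.K χ π a * U.L χ π b * X =
      (χ (intRoot π m) b * χ a (-intRoot π m) : 𝕜) • (X * (U.K χ π a * U.L χ π b)) := by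
    rw [mul_assoc, U.L_mul_homog χ π hX, neg_neg, mul_smul_comm, ← mul_assoc,
      U.K_mul_homog χ π hX, smul_mul_assoc, smul_smul, mul_assoc]
  rw [← Module.End.mul_apply, ← map_mul, h, map_smul, map_mul, LinearMap.smul_apply,
    Module.End.mul_apply, mem_weightSpace.1 hu, map_smul, smul_smul, map_add, ← add_assoc,
    χ.map_add_left (lam + intRoot π n), sub_add_eq_sub_sub,
    sub_eq_add_neg (mu - intRoot π n) (intRoot π m), χ.map_add_right a (mu - intRoot π n)]
  congr 1
  push_cast
  ring

/-- Weight spaces of different weights are independent if the roots have different characters. -/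
theorem iSupIndep_weightSpace
    (hroot : ∀ n : Fin l → ℤ, (∀ a, χ a (intRoot π n) = 1) → n = 0) :
    iSupIndep (weightSpace ρ lam mu) := by
  -- weight spaces are joint eigenspaces of the commuting operators `K_a L_b`
  let f : A × A → Module.End 𝕜 V := fun g => ρ (U.K χ π g.1 * U.L χ π g.2)
  let c : (Fin l → ℤ) → A × A → 𝕜 := fun n g =>
    χ (lam + intRoot π n) g.2 * χ g.1 (mu - intRoot π n)
  have hc : Function.Injective c := by
    intro m n hmn
    refine sub_eq_zero.1 (hroot _ fun a => ?_)
    have h1 := congrFun hmn (a, 0)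
    simp only [c, χ.map_zero_right, Units.val_one, one_mul] at h1
    have h2 := Units.ext h1
    rw [sub_eq_add_neg, sub_eq_add_neg, χ.map_add_right, χ.map_add_right, mul_left_cancel_iff,
      χ.map_neg_right, χ.map_neg_right, inv_inj] at h2
    rw [map_sub, sub_eq_add_neg, χ.map_add_right, χ.map_neg_right, h2, mul_inv_cancel]
  have hcomm : ∀ g h, Commute (f g) (f h) := by
    intro g h
    have d := U.doubleRel χ π
    have e : ∀ a b c d', U.K χ π a * U.L χ π b * (U.K χ π c * U.L χ π d') =
        U.K χ π (a + c) * U.L χ π (b + d') := by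
      intro a b c d'
      rw [← d.K_add, ← d.H_add, mul_assoc, ← mul_assoc (U.L χ π b), ← d.K_H]
      simp only [mul_assoc]
    change ρ _ * ρ _ = ρ _ * ρ _
    rw [← map_mul, ← map_mul, e, e, add_comm g.1, add_comm g.2]
  refine iSupIndep.mono ((Module.End.independent_iInf_maxGenEigenspace_of_forall_mapsTo f
    fun g h φ => Module.End.mapsTo_maxGenEigenspace_of_comm (hcomm h g) φ).comp hc) fun n u hu => ?_
  rw [Function.comp_apply, Submodule.mem_iInf]
  exact fun g => Module.End.eigenspace_le_maxGenEigenspace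
    (Module.End.mem_eigenspace_iff.2 (mem_weightSpace.1 hu g.1 g.2))

variable {v : V}

namespace IsHighestWeight

variable (hv : IsHighestWeight ρ lam mu v)

include hv

theorem mem_weightSpace_zero : v ∈ weightSpace ρ lam mu 0 := by
  intro a b
  rw [map_zero, add_zero, sub_zero]
  exact hv.weight a b

theorem evalWord_E_apply (x : FreeAlgebra 𝕜 (Fin l)) :
    ρ (evalWord (U.E χ π) x) v = wordCounit 𝕜 (Fin l) x • v := by
  induction x using free_left_induction with
  | one => simp
  | ι_mul i x ih =>
    rw [map_mul, map_mul, Module.End.mul_apply, ih, map_smul, FreeAlgebra.lift_ι_apply,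
      hv.E_smul, smul_zero, map_mul, wordCounit, FreeAlgebra.lift_ι_apply, zero_mul, zero_smul]
  | add x y hx hy => simp only [map_add, LinearMap.add_apply, hx, hy, add_smul]
  | smul r x hx => simp only [map_smul, LinearMap.smul_apply, hx, smul_assoc]

theorem exists_evalWord_F (u : V) :
    ∃ y : FreeAlgebra 𝕜 (Fin l), ρ (evalWord (U.F χ π) y) v = u := by
  obtain ⟨X, rfl⟩ := hv.generates u
  induction X using U.wordFE_induction with
  | word y d x c =>
    have hE := hv.evalWord_E_apply x
    refine ⟨((χ lam d : 𝕜) * (wordCounit 𝕜 (Fin l) x * χ c mu)) • y, ?_⟩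
    have h0 := hv.mem_weightSpace_zero
    simp only [U.wordFE, map_mul, Module.End.mul_apply, K_apply_weightSpace h0, map_smul, hE,
      L_apply_weightSpace h0, LinearMap.smul_apply, map_zero, add_zero, sub_zero, smul_smul]
    congr 1
    ring
  | add a b ha hb =>
    obtain ⟨y, hy⟩ := ha
    obtain ⟨y', hy'⟩ := hb
    exact ⟨y + y', by simp only [map_add, LinearMap.add_apply, hy, hy']⟩
  | smul r a ha =>
    obtain ⟨y, hy⟩ := ha
    exact ⟨r • y, by simp only [map_smul, LinearMap.smul_apply, hy]⟩

end IsHighestWeight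

end Module

/-! ### Independent families of subspaces -/

section Graded

universe u

variable {𝕜 V : Type*} {κ : Type u} [Field 𝕜] [AddCommGroup V] [Module 𝕜 V] {W : κ → Submodule 𝕜 V}

/-- Shrinking the members of an independent family of subspaces without losing the span changes
nothing. -/
theorem eq_of_le_of_iSupIndep {P : κ → Submodule 𝕜 V} (hW : iSupIndep W) (hPW : ∀ n, P n ≤ W n)
    (hP : ⨆ n, P n = ⊤) (n : κ) : W n = P n := by
  refine le_antisymm ?_ (hPW n)
  have h1 : P n ⊔ ⨆ (j) (_ : j ≠ n), P j = ⊤ := by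
    rw [eq_top_iff, ← hP]
    refine iSup_le fun j => ?_
    by_cases hj : j = n
    · subst hj; exact le_sup_left
    · exact le_sup_of_le_right (le_iSup₂_of_le j hj le_rfl)
  calc W n = (P n ⊔ ⨆ (j) (_ : j ≠ n), P j) ⊓ W n := by rw [h1, top_inf_eq]
    _ = P n ⊔ (⨆ (j) (_ : j ≠ n), P j) ⊓ W n := sup_inf_assoc_of_le _ (hPW n)
    _ ≤ P n ⊔ ⊥ := sup_le_sup_left (by
        rw [inf_comm]
        exact (inf_le_inf_left _ (iSup₂_mono fun j _ => hPW j)).trans (hW n).le_bot) _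
    _ = P n := sup_bot_eq _

theorem linearMap_ext_iSup {V' : Type*} [AddCommGroup V'] [Module 𝕜 V'] (hT : ⨆ n, W n = ⊤)
    {f g : V →ₗ[𝕜] V'} (h : ∀ n, ∀ u ∈ W n, f u = g u) : f = g := by
  rw [← sub_eq_zero, ← LinearMap.ker_eq_top, eq_top_iff, ← hT]
  refine iSup_le fun n u hu => ?_
  rw [LinearMap.mem_ker, LinearMap.sub_apply, h n u hu, sub_self]

/-- There is an endomorphism acting by prescribed scalars on the summands of a direct sum. -/
theorem exists_scalar_on (hW : iSupIndep W) (hT : ⨆ n, W n = ⊤) (c : κ → 𝕜) :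
    ∃ r : Module.End 𝕜 V, ∀ n, ∀ u ∈ W n, r u = c n • u := by
  classical
  have hI := DirectSum.isInternal_submodule_of_iSupIndep_of_iSup_eq_top hW hT
  let e := LinearEquiv.ofBijective (DirectSum.coeLinearMap W) hI
  refine ⟨DirectSum.toModule 𝕜 κ V (fun n => c n • (W n).subtype) ∘ₗ e.symm.toLinearMap,
    fun n u hu => ?_⟩
  have h : e.symm u = DirectSum.lof 𝕜 κ (fun n => W n) n ⟨u, hu⟩ := by
    rw [LinearEquiv.symm_apply_eq]
    exact (DirectSum.coeLinearMap_lof W n ⟨u, hu⟩).symm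
  rw [LinearMap.comp_apply, LinearEquiv.coe_coe, h, DirectSum.toModule_lof]
  rfl

/-- A finite-dimensional direct sum has a basis of homogeneous vectors. -/
theorem exists_homogeneous_basis [FiniteDimensional 𝕜 V] (hW : iSupIndep W) (hT : ⨆ n, W n = ⊤) :
    ∃ (I : Type u) (_ : Fintype I) (b : Module.Basis I 𝕜 V) (ν : I → κ),
      (∀ k, b k ∈ W (ν k)) ∧ (∀ n, ∀ u ∈ W n, ∀ k, ν k ≠ n → b.coord k u = 0) ∧
      ∀ n, Nat.card {k // ν k = n} = Module.finrank 𝕜 (W n) := by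
  classical
  have hI := DirectSum.isInternal_submodule_of_iSupIndep_of_iSup_eq_top hW hT
  let b : Module.Basis (Σ n, Fin (Module.finrank 𝕜 (W n))) 𝕜 V :=
    hI.collectedBasis fun n => Module.finBasis 𝕜 (W n)
  refine ⟨Σ n, Fin (Module.finrank 𝕜 (W n)), FiniteDimensional.fintypeBasisIndex b, b, Sigma.fst,
    fun k => hI.collectedBasis_mem _ k, fun n u hu k hk => ?_, fun n => ?_⟩
  · exact hI.collectedBasis_repr_of_mem_ne (fun n => Module.finBasis 𝕜 (W n)) (Ne.symm hk)
      (a := k.2) hu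
  · rw [Nat.card_congr (Equiv.sigmaSubtype n), Nat.card_eq_fintype_card, Fintype.card_fin]

theorem trace_eq_sum_coord {I : Type*} [Fintype I] (b : Module.Basis I 𝕜 V) (f : Module.End 𝕜 V) :
    LinearMap.trace 𝕜 V f = ∑ k, b.coord k (f (b k)) := by
  classical
  rw [LinearMap.trace_eq_matrix_trace 𝕜 b, Matrix.trace]
  simp [LinearMap.toMatrix_apply]

end Graded

/-! ### The weight decomposition of a highest weight module -/

section Module

variable {𝕜 A : Type*} [Field 𝕜] [AddCommGroup A] {l : ℕ} {χ : Bicharacter 𝕜 A} {π : Fin l → A}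
  {V : Type*} [AddCommGroup V] [Module 𝕜 V] {ρ : U χ π →ₐ[𝕜] Module.End 𝕜 V} {lam mu : A} {v : V}

theorem evalWord_F_apply_mem_weightSpace {m n : Fin l → ℤ} {y : FreeAlgebra 𝕜 (Fin l)}
    (hy : y ∈ wordSpan 𝕜 m) {u : V} (hu : u ∈ weightSpace ρ lam mu n) :
    ρ (evalWord (U.F χ π) y) u ∈ weightSpace ρ lam mu (n + m) :=
  homog_apply_mem_weightSpace (evalWord_F_mem_homog χ π hy) hu

theorem evalWord_E_apply_mem_weightSpace {m n : Fin l → ℤ} {x : FreeAlgebra 𝕜 (Fin l)}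
    (hx : x ∈ wordSpan 𝕜 m) {u : V} (hu : u ∈ weightSpace ρ lam mu n) :
    ρ (evalWord (U.E χ π) x) u ∈ weightSpace ρ lam mu (n - m) := by
  rw [sub_eq_add_neg]
  refine homog_apply_mem_weightSpace ?_ hu
  rw [map_neg, neg_neg]
  exact evalWord_E_mem_homog χ π hx

namespace IsHighestWeight

variable (hv : IsHighestWeight ρ lam mu v)
  (hroot : ∀ n : Fin l → ℤ, (∀ a, χ a (intRoot π n) = 1) → n = 0)

include hv hroot

/-- The weight spaces are the homogeneous components of `U^- v`. -/
theorem weightSpace_eq_map (n : Fin l → ℤ) : weightSpace ρ lam mu n = (wordSpan 𝕜 n).map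
    (LinearMap.applyₗ v ∘ₗ ρ.toLinearMap ∘ₗ (evalWord (U.F χ π)).toLinearMap) := by
  refine eq_of_le_of_iSupIndep (P := fun n => (wordSpan 𝕜 n).map _)
    (iSupIndep_weightSpace (ρ := ρ) (lam := lam) (mu := mu) hroot) (fun n => ?_) ?_ n
  · rintro _ ⟨y, hy, rfl⟩
    have h := evalWord_F_apply_mem_weightSpace hy hv.mem_weightSpace_zero
    rwa [zero_add] at h
  · rw [← Submodule.map_iSup, iSup_wordSpan, Submodule.map_top, LinearMap.range_eq_top]
    exact hv.exists_evalWord_F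

theorem iSup_weightSpace : ⨆ n, weightSpace ρ lam mu n = ⊤ := by
  simp_rw [hv.weightSpace_eq_map hroot]
  rw [← Submodule.map_iSup, iSup_wordSpan, Submodule.map_top, LinearMap.range_eq_top]
  exact hv.exists_evalWord_F

theorem weightPart_eq (n : Fin l → ℕ) :
    weightPart ρ v n = weightSpace ρ lam mu (fun i => (n i : ℤ)) := by
  apply le_antisymm
  · rintro _ ⟨Y, hY, rfl⟩
    rw [← intRoot_natCast] at hY
    simpa using homog_apply_mem_weightSpace hY.2 hv.mem_weightSpace_zero
  · rw [hv.weightSpace_eq_map hroot]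
    rintro _ ⟨y, hy, rfl⟩
    refine ⟨evalWord (U.F χ π) y, ⟨(U.mem_neg_iff χ π _).2 ⟨y, rfl⟩, ?_⟩, rfl⟩
    rw [← intRoot_natCast]
    exact evalWord_F_mem_homog χ π hy

theorem exists_natCast_of_mem_weightSpace {n : Fin l → ℤ} {u : V}
    (hu : u ∈ weightSpace ρ lam mu n) (h0 : u ≠ 0) : ∃ m : Fin l → ℕ, (fun i => (m i : ℤ)) = n := by
  by_contra hn
  refine h0 ?_
  rw [hv.weightSpace_eq_map hroot, wordSpan, Set.eq_empty_of_forall_notMem (s := {x | _}),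
    Submodule.span_empty, Submodule.map_bot, Submodule.mem_bot] at hu
  · exact hu
  · rintro _ ⟨w, hw, -⟩
    exact hn ⟨fun i => (n i).toNat, funext fun i => Int.toNat_of_nonneg (hw ▸ wordDeg_nonneg w i)⟩

/-- An endomorphism acting on each weight space by the value of `intRhoHat` is the twist. -/
theorem isTwist {r : Module.End 𝕜 V}
    (hr : ∀ n, ∀ u ∈ weightSpace ρ lam mu n, r u = (intRhoHat χ π n : 𝕜) • u) : IsTwist ρ v r := by
  intro n Y hY
  rw [← intRhoHat_natCast]
  refine hr _ _ ?_
  rw [← hv.weightPart_eq hroot]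
  exact ⟨Y, hY, rfl⟩

theorem twist_unique {r r' : Module.End 𝕜 V} (hr : IsTwist ρ v r) (hr' : IsTwist ρ v r') :
    r' = r := by
  refine linearMap_ext_iSup (hv.iSup_weightSpace hroot) fun n u hu => ?_
  by_cases h0 : u = 0
  · rw [h0, map_zero, map_zero]
  obtain ⟨m, rfl⟩ := hv.exists_natCast_of_mem_weightSpace hroot hu h0
  rw [← hv.weightPart_eq hroot] at hu
  obtain ⟨Y, hY, rfl⟩ := hu
  exact (hr' m Y hY).trans (hr m Y hY).symm

variable {r : Module.End 𝕜 V}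
  (hr : ∀ n, ∀ u ∈ weightSpace ρ lam mu n, r u = (intRhoHat χ π n : 𝕜) • u)

include hr

/-- The twist commutes with homogeneous elements up to the scalar of their degree. -/
theorem twist_mul {m : Fin l → ℤ} {X : U χ π} (hX : X ∈ U.homog χ π (-intRoot π m)) :
    r * ρ X = (intRhoHat χ π m : 𝕜) • (ρ X * r) := by
  refine linearMap_ext_iSup (hv.iSup_weightSpace hroot) fun n u hu => ?_
  rw [LinearMap.smul_apply, Module.End.mul_apply, Module.End.mul_apply, hr n u hu, map_smul,
    hr _ _ (homog_apply_mem_weightSpace hX hu), smul_smul, ← Units.val_mul, ← intRhoHat_add,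
    add_comm]

/-- The twisted trace has the trace property up to the scalars by which the twist commutes with
homogeneous elements. -/
theorem isTraceLike : IsTraceLike (twistedTrace ρ r) := by
  have hf : ∀ X, twistedTrace ρ r X = LinearMap.trace 𝕜 V (ρ X * r) := fun _ => rfl
  have key : ∀ (m : Fin l → ℤ) (X : U χ π), X ∈ U.homog χ π (-intRoot π m) → ∀ u,
      twistedTrace ρ r (X * u) = intRhoHat χ π m * twistedTrace ρ r (u * X) := by
    intro m X hX u
    rw [hf, hf, map_mul ρ, map_mul ρ, mul_assoc, LinearMap.trace_mul_comm, mul_assoc,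
      hv.twist_mul hroot hr hX, mul_smul_comm, map_smul, smul_eq_mul, mul_assoc]
  refine ⟨fun i u => ?_, fun i u => ?_, fun a u => ?_, fun a u => ?_⟩
  · have h : U.E χ π i ∈ U.homog χ π (-intRoot π (-Pi.single i 1)) := by
      rw [map_neg, neg_neg, intRoot_single]
      exact of_mem_homog χ π (.E i)
    rw [key _ _ h, intRhoHat_neg, intRhoHat_single, Units.mul_inv_cancel_left]
  · have h : U.F χ π i ∈ U.homog χ π (-intRoot π (Pi.single i 1)) := by
      rw [intRoot_single]
      exact of_mem_homog χ π (.F i)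
    rw [key _ _ h, intRhoHat_single]
  · have h : U.K χ π a ∈ U.homog χ π (-intRoot π 0) := by
      rw [map_zero, neg_zero]
      exact of_mem_homog χ π (.K a)
    rw [key _ _ h]
    simp [intRhoHat]
  · have h : U.L χ π a ∈ U.homog χ π (-intRoot π 0) := by
      rw [map_zero, neg_zero]
      exact of_mem_homog χ π (.L a)
    rw [key _ _ h]
    simp [intRhoHat]

end IsHighestWeight

end Module

/-! ### The central element of a highest weight module -/

section Central

variable {𝕜 A : Type*} [Field 𝕜] [AddCommGroup A] {l : ℕ} {χ : Bicharacter 𝕜 A} {π : Fin l → A}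
  {V : Type*} [AddCommGroup V] [Module 𝕜 V] {ρ : U χ π →ₐ[𝕜] Module.End 𝕜 V} {lam mu : A}
  {I : Type*} {b : Module.Basis I 𝕜 V} {ν : I → Fin l → ℤ}

/-- The matrix coefficients of `U^+` in a basis of weight vectors are represented by homogeneous
polynomials in the `F_i`. -/
theorem exists_coeff_E (hb : ∀ k, b k ∈ weightSpace ρ lam mu (ν k))
    (hb0 : ∀ n, ∀ u ∈ weightSpace ρ lam mu n, ∀ k, ν k ≠ n → b.coord k u = 0) (k m : I) :
    ∃ y ∈ wordSpan 𝕜 (ν m - ν k), ∀ x, wordForm (datum χ π).p x y =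
      b.coord k (ρ (evalWord (U.E χ π) x) (b m)) := by
  refine exists_wordForm_eq (datum χ π).p (ν m - ν k) (b.coord k ∘ₗ LinearMap.applyₗ (b m) ∘ₗ
    ρ.toLinearMap ∘ₗ (evalWord (U.E χ π)).toLinearMap) (fun x hx => ?_) fun n hn x hx => ?_
  · simp [U.evalWord_E_eq_zero χ π hx]
  · refine hb0 _ _ (evalWord_E_apply_mem_weightSpace hx (hb m)) k fun h => hn ?_
    rw [h, sub_sub_cancel]

/-- The matrix coefficients of `U^-` in a basis of weight vectors are represented by homogeneous
polynomials in the `E_i`. -/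
theorem exists_coeff_F (hb : ∀ k, b k ∈ weightSpace ρ lam mu (ν k))
    (hb0 : ∀ n, ∀ u ∈ weightSpace ρ lam mu n, ∀ k, ν k ≠ n → b.coord k u = 0) (k m : I) :
    ∃ x ∈ wordSpan 𝕜 (ν m - ν k), ∀ y, wordForm (datum χ π).p x y =
      b.coord m (ρ (evalWord (U.F χ π) y) (b k)) := by
  refine exists_wordForm_eq_right (datum χ π).p (ν m - ν k) (b.coord m ∘ₗ LinearMap.applyₗ (b k) ∘ₗ
    ρ.toLinearMap ∘ₗ (evalWord (U.F χ π)).toLinearMap) (fun y hy => ?_) fun n hn y hy => ?_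
  · simp [U.evalWord_F_eq_zero χ π hy]
  · refine hb0 _ _ (evalWord_F_apply_mem_weightSpace hy (hb k)) m fun h => hn ?_
    rw [h, add_sub_cancel_left]

theorem wordFE_mem_homog_zero {n : Fin l → ℤ} {y x : FreeAlgebra 𝕜 (Fin l)}
    (hy : y ∈ wordSpan 𝕜 n) (hx : x ∈ wordSpan 𝕜 n) (d c : A) :
    U.wordFE χ π y d x c ∈ U.homog χ π 0 := by
  have h := mul_mem_homog χ (mul_mem_homog χ (mul_mem_homog χ (evalWord_F_mem_homog χ π hy)
    (of_mem_homog χ π (.L d))) (evalWord_E_mem_homog χ π hx)) (of_mem_homog χ π (.K c))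
  simpa [U.genDegree, U.wordFE] using h

/-- A trace on a module with a finite basis of weight vectors, twisted by a diagonal endomorphism,
is the image under `Ω` of an element of degree `0`, whose Harish-Chandra projection reads off
the weights. -/
theorem exists_omega_eq_twistedTrace [Fintype I] {r : Module.End 𝕜 V} {c : (Fin l → ℤ) → 𝕜}
    (hr : ∀ n, ∀ u ∈ weightSpace ρ lam mu n, r u = c n • u)
    (hb : ∀ k, b k ∈ weightSpace ρ lam mu (ν k))
    (hb0 : ∀ n, ∀ u ∈ weightSpace ρ lam mu n, ∀ k, ν k ≠ n → b.coord k u = 0) :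
    ∃ z ∈ U.homog χ π 0, U.omega χ π z = twistedTrace ρ r ∧ U.harishChandra χ π z =
      ∑ k, c (ν k) • (U.K χ π (lam + intRoot π (ν k)) * U.L χ π (mu - intRoot π (ν k))) := by
  classical
  choose y hy hyx using exists_coeff_E hb hb0
  choose x hx hxy using exists_coeff_F hb hb0
  -- the factors `L` and `K` reproduce the scalars by which `K_a` acts on `b m` and `L_b` on `b k`
  refine ⟨∑ k, ∑ m, c (ν k) • U.wordFE χ π (y k m) (mu - intRoot π (ν m)) (x k m)
    (lam + intRoot π (ν k)), ?_, ?_, ?_⟩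
  · exact sum_mem fun k _ => sum_mem fun m _ => Submodule.smul_mem _ _
      (wordFE_mem_homog_zero (hy k m) (hx k m) _ _)
  · refine U.linearMap_ext_wordEF fun x' a y' d => ?_
    have hT : twistedTrace ρ r (U.wordEF χ π x' a y' d) =
        LinearMap.trace 𝕜 V (ρ (U.wordEF χ π x' a y' d) * r) := rfl
    rw [hT, trace_eq_sum_coord b, map_sum, LinearMap.sum_apply]
    refine Finset.sum_congr rfl fun k _ => ?_
    have hF : ρ (evalWord (U.F χ π) y') (b k) =
        ∑ m, wordForm (datum χ π).p (x k m) y' • b m := by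
      simp only [hxy, Module.Basis.coord_apply]
      exact (b.sum_repr _).symm
    have hk : (ρ (U.wordEF χ π x' a y' d) * r) (b k) =
        ∑ m, (χ (lam + intRoot π (ν k)) d * c (ν k) * wordForm (datum χ π).p (x k m) y' *
          χ a (mu - intRoot π (ν m)) : 𝕜) • ρ (evalWord (U.E χ π) x') (b m) := by
      simp only [U.wordEF, map_mul ρ, Module.End.mul_apply, hr _ _ (hb k), map_smul,
        L_apply_weightSpace (hb k), hF, map_sum, K_apply_weightSpace (hb _), Finset.smul_sum,
        smul_smul]
      refine Finset.sum_congr rfl fun m _ => ?_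
      congr 1
      ring
    rw [hk, map_sum, map_sum, LinearMap.sum_apply]
    refine Finset.sum_congr rfl fun m _ => ?_
    rw [map_smul, map_smul, LinearMap.smul_apply, U.omega_wordFE_wordEF, hyx, smul_eq_mul,
      smul_eq_mul]
    ring
  -- the augmentations of `y k m` and `x k m` are matrix coefficients of the identity
  · have h1 : ∀ k m, wordCounit 𝕜 (Fin l) (y k m) = if k = m then 1 else 0 := fun k m => by
      rw [← wordForm_one_left (datum χ π).p, hyx, map_one, map_one, Module.End.one_apply,
        Module.Basis.coord_apply, Module.Basis.repr_self, Finsupp.single_apply]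
      simp only [eq_comm]
    have h2 : ∀ k m, wordCounit 𝕜 (Fin l) (x k m) = if k = m then 1 else 0 := fun k m => by
      rw [← wordForm_one_right (datum χ π).p, hxy, map_one, map_one, Module.End.one_apply,
        Module.Basis.coord_apply, Module.Basis.repr_self, Finsupp.single_apply]
    simp only [map_sum, map_smul, U.wordFE, U.harishChandra_apply, h1, h2]
    simp

end Central

section Main

variable {𝕜 A : Type*} [Field 𝕜] [AddCommGroup A] {l : ℕ} {χ : Bicharacter 𝕜 A}

/-- If roots have nontrivial characters and `Ω` is injective, then the twisted trace of a
finite-dimensional highest weight module comes from a central element, with the asserted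
Harish-Chandra projection. -/
theorem IsHighestWeight.exists_central {π : Fin l → A} {V : Type*} [AddCommGroup V] [Module 𝕜 V]
    [FiniteDimensional 𝕜 V] {ρ : U χ π →ₐ[𝕜] Module.End 𝕜 V} {lam mu : A} {v : V}
    (hv : IsHighestWeight ρ lam mu v)
    (hroot : ∀ n : Fin l → ℤ, (∀ a, χ a (intRoot π n) = 1) → n = 0)
    (hinj : Function.Injective (U.omega χ π)) :
    ∃ r : Module.End 𝕜 V, (IsTwist ρ v r ∧ ∀ r', IsTwist ρ v r' → r' = r) ∧
      {n | weightPart ρ v n ≠ ⊥}.Finite ∧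
      ∃ Z ∈ U.skewCenter χ π 1, U.omega χ π Z = twistedTrace ρ r ∧
        U.harishChandra χ π Z = ∑ᶠ n : Fin l → ℕ,
          ((rhoHat χ π n : 𝕜) * (Module.finrank 𝕜 (weightPart ρ v n) : 𝕜)) •
            (U.K χ π (lam + posRoot π n) * U.L χ π (mu - posRoot π n)) := by
  classical
  have hW := iSupIndep_weightSpace (ρ := ρ) (lam := lam) (mu := mu) hroot
  have hT := hv.iSup_weightSpace hroot
  obtain ⟨r, hr⟩ := exists_scalar_on hW hT fun n => (intRhoHat χ π n : 𝕜)
  obtain ⟨I, _, b, ν, hb, hb0, hcard⟩ := exists_homogeneous_basis hW hT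
  choose N hN using fun k => hv.exists_natCast_of_mem_weightSpace hroot (hb k) (b.ne_zero k)
  have hfin : ∀ n, Module.finrank 𝕜 (weightPart ρ v n) = (Finset.univ.filter (N · = n)).card := by
    intro n
    rw [hv.weightPart_eq hroot, ← hcard, Nat.card_eq_fintype_card, Fintype.card_subtype]
    refine congrArg _ (Finset.filter_congr fun k _ => ?_)
    rw [← hN k, funext_iff, funext_iff]
    simp
  have hmem : ∀ n, weightPart ρ v n ≠ ⊥ → n ∈ Finset.univ.image N := by
    intro n hn
    obtain ⟨k, hk⟩ := Finset.card_pos.1 (hfin n ▸ (Submodule.one_le_finrank_iff.2 hn))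
    exact Finset.mem_image.2 ⟨k, Finset.mem_univ k, (Finset.mem_filter.1 hk).2⟩
  obtain ⟨z, hz0, hz, hSh⟩ := exists_omega_eq_twistedTrace hr hb hb0
  refine ⟨r, ⟨hv.isTwist hroot hr, fun r' h => hv.twist_unique hroot (hv.isTwist hroot hr) h⟩,
    (Finset.finite_toSet _).subset hmem, z, ?_, hz, ?_⟩
  · exact IsTraceLike.mem_skewCenter hinj (hz ▸ hv.isTraceLike hroot hr) hz0
  · rw [finsum_eq_sum_of_support_subset (s := Finset.univ.image N), hSh]
    -- group the basis vectors by weight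
    · have h := Finset.sum_comp (s := Finset.univ) (fun n : Fin l → ℕ => (rhoHat χ π n : 𝕜) •
        (U.K χ π (lam + posRoot π n) * U.L χ π (mu - posRoot π n))) N
      simp only [← hN, intRhoHat_natCast, intRoot_natCast]
      rw [h]
      refine Finset.sum_congr rfl fun n _ => ?_
      rw [hfin, mul_comm, mul_smul, Nat.cast_smul_eq_nsmul]
    · intro n hn
      refine hmem n fun h0 => hn ?_
      simp [Submodule.finrank_eq_zero.2 h0]

end Main

/-! ### The extended setting -/

section Extended

variable {𝕜 A : Type*} [Field 𝕜] [AddCommGroup A] {l : ℕ} {χ : Bicharacter 𝕜 A}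
  {α : Module.Basis (Fin (l + 1) ⊕ Fin (l + 1)) ℤ A} {q : 𝕜ˣ}
  {ω : Multiplicative (U.rootLattice (simpleRoot α)) →* 𝕜ˣ}

theorem Bicharacter.map_basis_right (χ : Bicharacter 𝕜 A) {ι : Type*} [Fintype ι]
    (α : Module.Basis ι ℤ A) (a c : A) : χ c a = ∏ j, χ c (α j) ^ α.repr a j := by
  let φ : A →+ Additive 𝕜ˣ := AddMonoidHom.mk' (fun a => Additive.ofMul (χ c a))
    fun a b => congrArg Additive.ofMul (χ.map_add_right c a b)
  have h : φ a = ∑ j, α.repr a j • φ (α j) := by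
    conv_lhs => rw [← α.sum_repr a, map_sum]
    simp only [map_zsmul]
  exact h

theorem Bicharacter.map_basis_left (χ : Bicharacter 𝕜 A) {ι : Type*} [Fintype ι]
    (α : Module.Basis ι ℤ A) (a c : A) : χ a c = ∏ j, χ (α j) c ^ α.repr a j :=
  Bicharacter.map_basis_right ⟨fun a b => χ b a, fun a b c => χ.map_add_right c a b,
    fun a b c => χ.map_add_left b c a⟩ α a c

namespace IsExtended

variable (h : IsExtended χ α q ω)

include h

theorem zpow_eq_one {n : ℤ} (hn : q ^ n = 1) : n = 0 := by
  have : ¬IsOfFinOrder q := fun hq => by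
    obtain ⟨m, hm, h1⟩ := isOfFinOrder_iff_pow_eq_one.1 hq
    exact h.not_root_of_unity m hm h1
  by_contra hn0
  exact this (isOfFinOrder_iff_zpow_eq_one.2 ⟨n, hn0, hn⟩)

/-- Pairing with the second half of the basis reads off the coordinates in the first half. -/
theorem repr_inl (a : A) (j : Fin (l + 1)) :
    χ (α (.inr j)) a = q ^ α.repr a (.inl j) ∧ χ a (α (.inr j)) = q ^ α.repr a (.inl j) := by
  rw [χ.map_basis_right α, χ.map_basis_left α]
  simp [Fintype.prod_sum_type, h.inr_inl, h.inr_inr, h.inl_inr, ite_pow]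

/-- If the coordinates in the first half of the basis vanish, then pairing with the first half reads
off the others. -/
theorem repr_inr {a : A} (ha : ∀ j, α.repr a (.inl j) = 0) (j : Fin (l + 1)) :
    χ (α (.inl j)) a = q ^ α.repr a (.inr j) ∧ χ a (α (.inl j)) = q ^ α.repr a (.inr j) := by
  rw [χ.map_basis_right α, χ.map_basis_left α]
  simp [Fintype.prod_sum_type, ha, h.inr_inl, h.inl_inr, ite_pow, Finset.prod_ite_eq]

theorem eq_zero_of_left {a : A} (ha : ∀ b, χ b a = 1) : a = 0 := by
  have h1 : ∀ j, α.repr a (.inl j) = 0 := fun j =>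
    h.zpow_eq_one ((h.repr_inl a j).1.symm.trans (ha _))
  refine α.ext_elem fun k => ?_
  rw [map_zero, Finsupp.zero_apply]
  obtain j | j := k
  · exact h1 j
  · exact h.zpow_eq_one ((h.repr_inr h1 j).1.symm.trans (ha _))

theorem eq_zero_of_right {a : A} (ha : ∀ b, χ a b = 1) : a = 0 := by
  have h1 : ∀ j, α.repr a (.inl j) = 0 := fun j =>
    h.zpow_eq_one ((h.repr_inl a j).2.symm.trans (ha _))
  refine α.ext_elem fun k => ?_
  rw [map_zero, Finsupp.zero_apply]
  obtain j | j := k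
  · exact h1 j
  · exact h.zpow_eq_one ((h.repr_inr h1 j).2.symm.trans (ha _))

theorem intRoot_eq_zero {n : Fin l → ℤ} (hn : ∀ a, χ a (intRoot (simpleRoot α) n) = 1) : n = 0 := by
  have h0 := h.eq_zero_of_left hn
  have hli : LinearIndependent ℤ (simpleRoot α) :=
    α.linearIndependent.comp (fun i : Fin l => Sum.inl i.castSucc)
      (Sum.inl_injective.comp (Fin.castSucc_injective l))
  exact funext (Fintype.linearIndependent_iff.1 hli n h0)

end IsExtended

end Extended

end GQG

end

theorem mainTheorem2 {𝕜 A : Type*} [Field 𝕜] [AddCommGroup A] {l : ℕ} (hl : 1 ≤ l)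
    (χ : GQG.Bicharacter 𝕜 A) (α : Module.Basis (Fin (l + 1) ⊕ Fin (l + 1)) ℤ A)
    (q : 𝕜ˣ) (ω : Multiplicative (GQG.U.rootLattice (GQG.simpleRoot α)) →* 𝕜ˣ)
    (hext : GQG.IsExtended χ α q ω) (lam mu : A)
    {V : Type*} [AddCommGroup V] [Module 𝕜 V] [FiniteDimensional 𝕜 V]
    (ρ : GQG.U χ (GQG.simpleRoot α) →ₐ[𝕜] Module.End 𝕜 V) (v : V)
    (hv : GQG.IsHighestWeight ρ lam mu v) :
    ∃ (Ω : GQG.U χ (GQG.simpleRoot α) →ₗ[𝕜] Module.Dual 𝕜 (GQG.U χ (GQG.simpleRoot α)))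
      (Sh : GQG.U χ (GQG.simpleRoot α) →ₗ[𝕜] GQG.U χ (GQG.simpleRoot α))
      (r : Module.End 𝕜 V),
      -- `Ω`, `Sh` and `r = ρ̆` are the unique maps with their defining properties
      (GQG.U.IsOmega χ (GQG.simpleRoot α) Ω ∧
        ∀ Ω', GQG.U.IsOmega χ (GQG.simpleRoot α) Ω' → Ω' = Ω) ∧
      (GQG.U.IsHarishChandra χ (GQG.simpleRoot α) Sh ∧
        ∀ Sh', GQG.U.IsHarishChandra χ (GQG.simpleRoot α) Sh' → Sh' = Sh) ∧
      (GQG.IsTwist ρ v r ∧ ∀ r', GQG.IsTwist ρ v r' → r' = r) ∧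
      Function.Injective Ω ∧
      {n | GQG.weightPart ρ v n ≠ ⊥}.Finite ∧
      ∃ Z ∈ GQG.U.skewCenter χ (GQG.simpleRoot α) 1,
        Ω Z = GQG.twistedTrace ρ r ∧
        Sh Z = ∑ᶠ n : Fin l → ℕ,
          ((GQG.rhoHat χ (GQG.simpleRoot α) n : 𝕜) *
              (Module.finrank 𝕜 (GQG.weightPart ρ v n) : 𝕜)) •
            (GQG.U.K χ (GQG.simpleRoot α) (lam + GQG.posRoot (GQG.simpleRoot α) n) *
              GQG.U.L χ (GQG.simpleRoot α) (mu - GQG.posRoot (GQG.simpleRoot α) n)) := by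
  have hinj := GQG.U.omega_injective (χ := χ) (π := GQG.simpleRoot α)
    (fun _ ha => hext.eq_zero_of_left ha) (fun _ ha => hext.eq_zero_of_right ha)
  obtain ⟨r, hr, hfin, Z, hZ, hΩ, hSh⟩ :=
    hv.exists_central (fun _ hn => hext.intRoot_eq_zero hn) hinj
  exact ⟨GQG.U.omega χ _, GQG.U.harishChandra χ _, r,
    ⟨GQG.U.isOmega χ _, fun _ h => h.eq⟩,
    ⟨GQG.U.isHarishChandra χ _, fun _ h => h.eq⟩, hr, hinj, hfin, Z, hZ, hΩ, hSh⟩
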